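/- Let $k$ be a field and let $A=\bigoplus_{i\ge 0}A_i$ be a (not necessarily commutative) graded $k$-algebra with $A_0=k$, with $\dim_k A_i<\infty$ for all $i$, and generated as a $k$-algebra by $A_1$. Put $\mathfrak m=\bigoplus_{i>0}A_i$. Assume that $A$ is Koszul: the left $A$-module $k=A/\mathfrak m$ has a graded free resolution whose $n$-th term is generated in degree $n$, for every $n\ge 0$. Let $V=A_1$, $V^*=\operatorname{Hom}_k(V,k)$, and let $Q_2\subseteq V\otimes_k V$ be the kernel of the multiplication map $V\otimes_k V\to A_2$. Let $A^!=T(V^*)/(Q_2^\perp)$ be the quadratic dual algebra, where $Q_2^\perp\subseteq V^*\otimes_k V^*$ is the orthogonal complement of $Q_2$ under $\langle v\otimes w,f\otimes g\rangle=f(v)g(w)$, and let $(A^!)^*_n$ be the $k$-dual of the component of $A^!$ spanned by the words of length $n$ in $V^*$. For a graded left $A$-module $M$ let $\beta_{n,j}(M)=\dim_k\operatorname{Tor}_n^A(M,k)_j$, where $\operatorname{Tor}_n^A(M,k)_j$ is the homology of $k\otimes_A F$ in homological degree $n$ and internal degree $j$, for any graded free resolution $F$ of $M$. Let $a\ge 1$.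 (1) The left module $\mathfrak m^a$ has a minimal graded free resolution, and every minimal graded free resolution of $\mathfrak m^a$ is $a$-linear, i.e. its $n$-th term is generated in degree $n+a$ for every $n\ge 0$. (2) All $\operatorname{Tor}_n^A(\mathfrak m^a,k)_j$ are finite-dimensional; for all $n\ge 0$, $$\beta_{n,n+a}(\mathfrak m^a)=\sum_{i=1}^{a}(-1)^{i+1}\dim_k (A^!)^*_{n+i}\,\dim_k A_{a-i},$$ and $\beta_{n,j}(\mathfrak m^a)=0$ for $j\ne n+a$. (3) With $H_{(A^!)^*}(t)=\sum_{\ell\ge 0}\dim_k (A^!)^*_\ell\,t^\ell$ and $H_{A/\mathfrak m^a}(t)=\sum_{j=0}^{a-1}\dim_k A_j\,t^j$, the graded Poincaré series $P_{\mathfrak m^a}(y,z)=\sum_{n,j\ge 0}\beta_{n,j}(\mathfrak m^a)\,y^jz^n$ is $$P_{\mathfrak m^a}(y,z)=-(-z)^{-a}\bigl(H_{(A^!)^*}(yz)\,H_{A/\mathfrak m^a}(-yz)-1\bigr)$$ in the ring of Laurent series in $z$ over $\mathbb Z[[y]]$. (4) The left module $A/\mathfrak m^a$ has a minimal graded free resolution,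 all $\operatorname{Tor}_n^A(A/\mathfrak m^a,k)_j$ are finite-dimensional, and $$\beta_{n,j}(A/\mathfrak m^a)=\begin{cases}\displaystyle\sum_{i=1}^{a}(-1)^{i+1}\dim_k (A^!)^*_{n+i-1}\,\dim_k A_{a-i}& n>0,\ j=n+a-1,\\ 1& n=j=0,\\ 0&\text{otherwise.}\end{cases}$$ -/

import Mathlib

open scoped TensorProduct

universe u v x w w'

namespace KoszulPowers

section Algebra

variable {k : Type u} {A : Type v} [Field k] [Ring A] [Algebra k A]

/-- The standing assumptions on the graded `k`-algebra `A = ⨁ i, 𝒜 i` (not necessarily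
commutative): `A₀ = k`, the graded components are finite-dimensional, and `A` is generated
by `A₁` as a `k`-algebra. -/
structure IsStandardGraded (𝒜 : ℕ → Submodule k A) [GradedAlgebra 𝒜] : Prop where
  nontrivial : Nontrivial A
  zero_eq_one : 𝒜 0 = 1
  finite : ∀ i, Module.Finite k (𝒜 i)
  adjoin_one : Algebra.adjoin k (𝒜 1 : Set A) = ⊤

/-- The `ℕ`-grading regarded as a `ℤ`-grading, with `A_j = 0` for `j < 0`. -/
def component (𝒜 : ℕ → Submodule k A) : ℤ → Submodule k A
  | Int.ofNat n => 𝒜 n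
  | Int.negSucc _ => ⊥

/-- The homogeneous maximal ideal `𝔪 = A_{>0}`. It is two-sided; an `Ideal` is a left ideal, and
the powers `𝔪 ^ a` are its usual powers. -/
abbrev maxIdeal (𝒜 : ℕ → Submodule k A) [GradedAlgebra 𝒜] : Ideal A :=
  (HomogeneousIdeal.irrelevant 𝒜).toIdeal

/-- The grading on a (homogeneous) left ideal `I`, as a left `A`-module: `I_j = I ∩ A_j`. -/
def idealGrading (𝒜 : ℕ → Submodule k A) (I : Ideal A) (j : ℤ) : Submodule k I :=
  (component 𝒜 j).comap (I.subtype.restrictScalars k)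

/-- The grading on the left `A`-module `A ⧸ I`, for `I` a (homogeneous) left ideal:
`(A ⧸ I)_j` is the image of `A_j`. -/
def quotientGrading (𝒜 : ℕ → Submodule k A) (I : Ideal A) (j : ℤ) : Submodule k (A ⧸ I) :=
  (component 𝒜 j).map (I.mkQ.restrictScalars k)

/-- The degree `j` part of the graded free left `A`-module `⨁ b, A(-deg b)` on basis elements `b`
of degree `deg b`. -/
noncomputable def freeComponent (𝒜 : ℕ → Submodule k A) {ι : Type w} (deg : ι → ℤ) (j : ℤ) :
    Submodule k (ι →₀ A) :=
  ⨅ b, (component 𝒜 (j - deg b)).comap (Finsupp.lapply b : (ι →₀ A) →ₗ[k] A)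

/-- A graded free resolution `⋯ → F₁ → F₀ → M → 0` of the graded left `A`-module `M = ⨁ j, ℳ j`.
Here `F_n` is free on the set `ι n`, the basis element `b : ι n` has degree `deg n b`, and all maps
are `A`-linear and preserve degrees. -/
structure GradedFreeResolution (𝒜 : ℕ → Submodule k A) {M : Type x} [AddCommGroup M]
    [Module k M] [Module A M] (ℳ : ℤ → Submodule k M) where
  ι : ℕ → Type w
  deg : ∀ n, ι n → ℤ
  d : ∀ n, (ι (n + 1) →₀ A) →ₗ[A] (ι n →₀ A)
  ε : (ι 0 →₀ A) →ₗ[A] M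
  d_mem : ∀ n j, ∀ f ∈ freeComponent 𝒜 (deg (n + 1)) j, d n f ∈ freeComponent 𝒜 (deg n) j
  ε_mem : ∀ j, ∀ f ∈ freeComponent 𝒜 (deg 0) j, ε f ∈ ℳ j
  ε_surjective : Function.Surjective ε
  exact_zero : Function.Exact (d 0) ε
  exact_succ : ∀ n, Function.Exact (d (n + 1)) (d n)

namespace GradedFreeResolution

variable {𝒜 : ℕ → Submodule k A} {M : Type x} [AddCommGroup M] [Module k M] [Module A M]
  {ℳ : ℤ → Submodule k M}

/-- `F` is `a`-linear: `F_n` is generated in degree `n + a`. -/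
def IsLinear (F : GradedFreeResolution.{u, v, x, w} 𝒜 ℳ) (a : ℤ) : Prop :=
  ∀ n (b : F.ι n), F.deg n b = n + a

variable [GradedAlgebra 𝒜]

/-- `F` is minimal: `d(F_{n+1}) ⊆ 𝔪 F_n`. -/
def IsMinimal (F : GradedFreeResolution.{u, v, x, w} 𝒜 ℳ) : Prop :=
  ∀ n, LinearMap.range (F.d n) ≤ maxIdeal 𝒜 • (⊤ : Submodule A (F.ι n →₀ A))

/-- The term `k ⊗_A F_n = F_n / 𝔪 F_n`. -/
abbrev residue (F : GradedFreeResolution.{u, v, x, w} 𝒜 ℳ) (n : ℕ) : Type (max v w) :=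
  (F.ι n →₀ A) ⧸ (maxIdeal 𝒜 • (⊤ : Submodule A (F.ι n →₀ A)))

/-- The differential of the complex `k ⊗_A F`. -/
noncomputable def residueD (F : GradedFreeResolution.{u, v, x, w} 𝒜 ℳ) (n : ℕ) :
    F.residue (n + 1) →ₗ[k] F.residue n :=
  (Submodule.mapQ _ _ (F.d n) (Submodule.map_le_iff_le_comap.mp (by
    rw [Submodule.map_smul'']
    exact Submodule.smul_mono le_rfl le_top))).restrictScalars k

/-- The degree `j` part of `k ⊗_A F_n`. -/
noncomputable def residueComponent (F : GradedFreeResolution.{u, v, x, w} 𝒜 ℳ) (n : ℕ) (j : ℤ) :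
    Submodule k (F.residue n) :=
  (freeComponent 𝒜 (F.deg n) j).map
    ((maxIdeal 𝒜 • (⊤ : Submodule A (F.ι n →₀ A))).mkQ.restrictScalars k)

/-- The cycles of `k ⊗_A F` of homological degree `n` and internal degree `j`. -/
noncomputable def cycles (F : GradedFreeResolution.{u, v, x, w} 𝒜 ℳ) :
    ∀ (n : ℕ) (_ : ℤ), Submodule k (F.residue n)
  | 0, j => F.residueComponent 0 j
  | n + 1, j => F.residueComponent (n + 1) j ⊓ LinearMap.ker (F.residueD n)

/-- `Tor_n(M, k)_j`, the homology of `k ⊗_A F` in homological degree `n` and internal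
degree `j`. -/
abbrev tor (F : GradedFreeResolution.{u, v, x, w} 𝒜 ℳ) (n : ℕ) (j : ℤ) : Type (max v w) :=
  F.cycles n j ⧸ (LinearMap.range (F.residueD n)).comap (F.cycles n j).subtype

/-- The graded Betti number `β_{n,j}(M) = dim_k Tor_n(M, k)_j`, computed from `F`. -/
noncomputable def betti (F : GradedFreeResolution.{u, v, x, w} 𝒜 ℳ) (n : ℕ) (j : ℤ) : ℕ :=
  Module.finrank k (F.tor n j)

/-- The graded Poincaré series `∑_{n,j ≥ 0} β_{n,j}(M) y^j z^n`, as a power series in `z` with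
coefficients power series in `y`. -/
noncomputable def poincareSeries (F : GradedFreeResolution.{u, v, x, w} 𝒜 ℳ) :
    PowerSeries (PowerSeries ℤ) :=
  PowerSeries.mk fun n => PowerSeries.mk fun j => (F.betti n j : ℤ)

end GradedFreeResolution

/-- `A` is Koszul: the graded `A`-module `k = A / A_{>0}`, in degree `0`, admits a linear graded
free resolution. -/
def IsKoszul (𝒜 : ℕ → Submodule k A) [GradedAlgebra 𝒜] : Prop :=
  ∃ F : GradedFreeResolution.{u, v, v, w} 𝒜 (quotientGrading 𝒜 (maxIdeal 𝒜)), F.IsLinear 0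

/-- The space `Q₂` of quadratic relations of `A`: the kernel of the multiplication
`A₁ ⊗ A₁ → A`. -/
noncomputable def quadraticRelations (𝒜 : ℕ → Submodule k A) :
    Submodule k (𝒜 1 ⊗[k] 𝒜 1) :=
  LinearMap.ker (LinearMap.mul' k A ∘ₗ TensorProduct.map (𝒜 1).subtype (𝒜 1).subtype)

/-- The orthogonal complement of `Q₂` in `V* ⊗ V*`, where `V = A₁`, for the pairing
`⟨v ⊗ w, f ⊗ g⟩ = f v * g w`. -/
noncomputable def dualRelations (𝒜 : ℕ → Submodule k A) :
    Submodule k (Module.Dual k (𝒜 1) ⊗[k] Module.Dual k (𝒜 1)) :=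
  (quadraticRelations 𝒜).dualAnnihilator.comap (TensorProduct.dualDistrib k (𝒜 1) (𝒜 1))

/-- The identification of `V* ⊗ V*` with the degree two part of the tensor algebra `T(V*)`. -/
noncomputable def toTensorAlgebra (𝒜 : ℕ → Submodule k A) :
    Module.Dual k (𝒜 1) ⊗[k] Module.Dual k (𝒜 1) →ₗ[k]
      TensorAlgebra k (Module.Dual k (𝒜 1)) :=
  LinearMap.mul' k _ ∘ₗ TensorProduct.map (TensorAlgebra.ι k) (TensorAlgebra.ι k)

/-- The relations `φ = 0` in `T(V*)`, for `φ` in the orthogonal complement of `Q₂`. -/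
def DualRel (𝒜 : ℕ → Submodule k A) (s t : TensorAlgebra k (Module.Dual k (𝒜 1))) : Prop :=
  (∃ φ ∈ dualRelations 𝒜, s = toTensorAlgebra 𝒜 φ) ∧ t = 0

/-- The quadratic dual algebra `A^!`, the quotient of `T(V*)` by the two-sided ideal generated by
the orthogonal complement of `Q₂`. -/
abbrev QuadraticDual (𝒜 : ℕ → Submodule k A) : Type (max u v) := RingQuot (DualRel 𝒜)

/-- The component of `A^!` spanned by the images of the words of length `n` in `V*`. -/
noncomputable def dualComponent (𝒜 : ℕ → Submodule k A) (n : ℕ) :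
    Submodule k (QuadraticDual 𝒜) :=
  (LinearMap.range (TensorAlgebra.ι k (M := Module.Dual k (𝒜 1))) ^ n).map
    (RingQuot.mkAlgHom k (DualRel 𝒜)).toLinearMap

/-- `dim_k A_n`. -/
noncomputable def dimA (𝒜 : ℕ → Submodule k A) (n : ℕ) : ℕ := Module.finrank k (𝒜 n)

/-- `dim_k (A^!)^*_n`, where `(A^!)^*` is the graded dual of `A^!`. -/
noncomputable def dimDual (𝒜 : ℕ → Submodule k A) (n : ℕ) : ℕ :=
  Module.finrank k (Module.Dual k (dualComponent 𝒜 n))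

/-- The Hilbert series `H_{(A^!)^*}(t) = ∑_ℓ dim_k (A^!)^*_ℓ t^ℓ`. -/
noncomputable def hilbertDual (𝒜 : ℕ → Submodule k A) : PowerSeries ℤ :=
  PowerSeries.mk fun l => (dimDual 𝒜 l : ℤ)

/-- The Hilbert series `H_{A/𝔪^a}(t) = ∑_{j < a} dim_k A_j t^j`. -/
noncomputable def hilbertTrunc (𝒜 : ℕ → Submodule k A) (a : ℕ) : PowerSeries ℤ :=
  ∑ j ∈ Finset.range a, PowerSeries.monomial j (dimA 𝒜 j : ℤ)

end Algebra

/-- The substitution `H(t) ↦ H(c y z)`, with values in the Laurent series in `z` over the ring of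
power series in `y`: the coefficient of `z^n` is `c^n h_n y^n`. -/
noncomputable def evalYZ (c : ℤ) (H : PowerSeries ℤ) : LaurentSeries (PowerSeries ℤ) :=
  HahnSeries.ofPowerSeries ℤ _
    (PowerSeries.mk fun n => PowerSeries.monomial n (c ^ n * PowerSeries.coeff n H))

end KoszulPowers

/-! The powers of `𝔪` are linked by the sequences `0 → 𝔪^(a+1) → 𝔪^a → 𝔪^a/𝔪^(a+1) → 0`, whose last
term is `k ⊗ A_a`, a sum of `dim A_a` copies of the residue field. Covering `𝔪^a` and `k ⊗ A_a` by
the same free module `A ⊗ A_a` turns this into an exact sequence of first syzygies `0 → Ω(𝔪^a) → Ω(k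
⊗ A_a) → 𝔪^(a+1) → 0`, with all three terms generated in degree `a + 1` once `𝔪^a` is linear
(`isShortExact_power`).

Such a sequence induces exact sequences of generators and of relations at every later stage, so
linearity of the first two terms forces linearity of the third (`IsShortExact.syzygy`,
`IsShortExact.hasLinearResolution`). Starting from the free module `𝔪^0 = A`, induction on `a` makes
every `𝔪^a` linear. Counting generators gives `dim A_a · β_(n+1)(k) = β_(n+1)(𝔪^a) + β_n(𝔪^(a+1))`,
and unrolling this recursion yields the alternating sum (`powerBetti_eq`).

The Betti numbers of `k` are then identified with the dimensions of the components of `A^!`. Taking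
linear relations repeatedly, starting with `k`, produces spaces `U_n` with `U_(n+2)` the kernel of
`A₁ ⊗ U_(n+1) → A₂ ⊗ U_n`. Their duals satisfy exactly the relations defining `A^!`: a recursive map
`U_n^* → A^!` and the action of `A^!` on the product of the `U_n^*` are mutually inverse in each
degree (`ContractionSystem.finrank_dualComponent`).

To speak about arbitrary resolutions, the Koszul hypothesis is translated into linearity of these
iterated syzygies (`IsPresentedBy.exists_basis`), and `Tor` is shown to be independent of the
resolution (`nonempty_tor_equiv`). A minimal resolution has nonzero `Tor` in the degree of each
generator, hence is as linear as the constructed one. The resolution of `A/𝔪^a` comes from splicing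
with `A`, and the Poincaré series is the Betti formula read coefficient by coefficient. -/

namespace KoszulPowers

/-! ### Homogeneous components and powers of the maximal ideal. -/

section Grading

variable {k : Type u} {A : Type v} [Field k] [Ring A] [Algebra k A]
  {𝒜 : ℕ → Submodule k A} [GradedAlgebra 𝒜]

theorem proj_of_mem {i : ℕ} {x : A} (hx : x ∈ 𝒜 i) : GradedAlgebra.proj 𝒜 i x = x := by
  rw [GradedAlgebra.proj_apply, DirectSum.decompose_of_mem_same _ hx]

theorem proj_of_mem_ne {i j : ℕ} {x : A} (hx : x ∈ 𝒜 i) (h : i ≠ j) :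
    GradedAlgebra.proj 𝒜 j x = 0 := by
  rw [GradedAlgebra.proj_apply, DirectSum.decompose_of_mem_ne _ hx h]

variable (𝒜) in
theorem proj_mem (i : ℕ) (x : A) : GradedAlgebra.proj 𝒜 i x ∈ 𝒜 i := by
  rw [GradedAlgebra.proj_apply]; exact SetLike.coe_mem _

theorem proj_eq_self_iff {i : ℕ} {x : A} : GradedAlgebra.proj 𝒜 i x = x ↔ x ∈ 𝒜 i :=
  ⟨fun h => h ▸ proj_mem 𝒜 i x, proj_of_mem⟩

variable (𝒜) in
theorem homogeneous_induction {p : A → Prop} (hom : ∀ i, ∀ x ∈ 𝒜 i, p x) (zero : p 0)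
    (add : ∀ x y, p x → p y → p (x + y)) (x : A) : p x :=
  DirectSum.Decomposition.inductionOn 𝒜 zero (fun m => hom _ _ m.2) (fun x y => add x y) x

/-- For `b` homogeneous of degree `i`, multiplication by `b` on the right shifts projections. -/
theorem proj_add_mul {i j : ℕ} (a : A) {b : A} (hb : b ∈ 𝒜 i) :
    GradedAlgebra.proj 𝒜 (j + i) (a * b) = GradedAlgebra.proj 𝒜 j a * b := by
  induction a using homogeneous_induction 𝒜 with
  | hom l x hx =>
    by_cases h : l = j
    · subst h
      rw [proj_of_mem hx, proj_of_mem (SetLike.mul_mem_graded hx hb)]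
    · rw [proj_of_mem_ne hx h, proj_of_mem_ne (SetLike.mul_mem_graded hx hb) (by omega), zero_mul]
  | zero => simp
  | add x y hx hy => simp only [add_mul, map_add, hx, hy]

theorem proj_mul_of_lt {i j : ℕ} (a : A) {b : A} (hb : b ∈ 𝒜 i) (h : j < i) :
    GradedAlgebra.proj 𝒜 j (a * b) = 0 := by
  induction a using homogeneous_induction 𝒜 with
  | hom l x hx => exact proj_of_mem_ne (SetLike.mul_mem_graded hx hb) (by omega)
  | zero => simp
  | add x y hx hy => simp only [add_mul, map_add, hx, hy, add_zero]

theorem mem_maxIdeal {x : A} : x ∈ maxIdeal 𝒜 ↔ GradedAlgebra.proj 𝒜 0 x = 0 :=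
  HomogeneousIdeal.mem_irrelevant_iff 𝒜 x

theorem mem_maxIdeal_of_mem {i : ℕ} (hi : 0 < i) {x : A} (hx : x ∈ 𝒜 i) : x ∈ maxIdeal 𝒜 :=
  mem_maxIdeal.2 (proj_of_mem_ne hx (by omega))

theorem mul_mem_maxIdeal_left {x : A} (hx : x ∈ maxIdeal 𝒜) (y : A) : x * y ∈ maxIdeal 𝒜 := by
  rw [mem_maxIdeal] at *
  have h : ∀ z, GradedAlgebra.proj 𝒜 0 z = GradedRing.projZeroRingHom 𝒜 z := fun z => rfl
  rw [h, map_mul, ← h, hx, zero_mul]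

/-- The sum of all powers of `A₁` is closed under products and contains the generators, so it is all
of `A`; projecting to degree `n` keeps only the `n`-th power. -/
theorem pow_degree_one (hA : IsStandardGraded 𝒜) (n : ℕ) : (𝒜 1) ^ n = 𝒜 n := by
  have hle : ∀ n, (𝒜 1) ^ n ≤ 𝒜 n := by
    intro n
    induction n with
    | zero => rw [pow_zero, hA.zero_eq_one]
    | succ n ih =>
      rw [pow_succ, Submodule.mul_le]
      exact fun x hx y hy => SetLike.mul_mem_graded (ih hx) hy
  have htop : ∀ x : A, x ∈ ⨆ i, (𝒜 1) ^ i := by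
    intro x
    have hx : x ∈ Algebra.adjoin k (𝒜 1 : Set A) := hA.adjoin_one ▸ Algebra.mem_top
    induction hx using Algebra.adjoin_induction with
    | mem x hx => exact Submodule.mem_iSup_of_mem 1 (by simpa using hx)
    | algebraMap r =>
      exact Submodule.mem_iSup_of_mem 0 (by rw [pow_zero]; exact Submodule.algebraMap_mem r)
    | add x y _ _ hx hy => exact add_mem hx hy
    | mul x y _ _ hx hy =>
      have := Submodule.mul_mem_mul hx hy
      rw [Submodule.iSup_mul] at this
      have hle : ⨆ i, 𝒜 1 ^ i * ⨆ i, 𝒜 1 ^ i ≤ ⨆ i, 𝒜 1 ^ i := by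
        refine iSup_le fun i => ?_
        rw [Submodule.mul_iSup]
        exact iSup_le fun j => pow_add (𝒜 1) i j ▸ le_iSup (fun i => (𝒜 1) ^ i) (i + j)
      exact hle this
  refine le_antisymm (hle n) fun x hx => ?_
  have key : ∀ y ∈ ⨆ i, (𝒜 1) ^ i, GradedAlgebra.proj 𝒜 n y ∈ (𝒜 1) ^ n := by
    intro y hy
    induction hy using Submodule.iSup_induction' with
    | mem i y hy =>
      by_cases h : i = n
      · subst h; rwa [proj_of_mem (hle _ hy)]
      · rw [proj_of_mem_ne (hle _ hy) h]; exact zero_mem _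
    | zero => simp
    | add y z _ _ hy hz => rw [map_add]; exact add_mem hy hz
  have := key x (htop x)
  rwa [proj_of_mem hx] at this

theorem degree_succ_eq_mul (hA : IsStandardGraded 𝒜) (n : ℕ) : 𝒜 (n + 1) = 𝒜 n * 𝒜 1 := by
  rw [← pow_degree_one hA (n + 1), ← pow_degree_one hA n, pow_succ]

theorem maxIdeal_pow_zero : maxIdeal 𝒜 ^ 0 = ⊤ := by
  rw [Submodule.pow_zero, Submodule.one_eq_span, ← Ideal.span, Ideal.span_singleton_one]

/-- In a product `r * n` with `n ∈ 𝔪`, each homogeneous piece of `n` has degree `j > 0`, so the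
degree `i` part only sees the degree `i - j` part of `r`, which is covered by induction. -/
theorem proj_eq_zero_of_mem_pow {a : ℕ} {x : A} (hx : x ∈ maxIdeal 𝒜 ^ a) {i : ℕ} (hi : i < a) :
    GradedAlgebra.proj 𝒜 i x = 0 := by
  induction a generalizing x i with
  | zero => omega
  | succ a ih =>
    rw [Submodule.pow_succ] at hx
    have hmul : ∀ r ∈ maxIdeal 𝒜 ^ a, ∀ n ∈ maxIdeal 𝒜,
        GradedAlgebra.proj 𝒜 i (r * n) = 0 := by
      intro r hr n hn
      classical
      rw [← DirectSum.sum_support_decompose 𝒜 n, Finset.mul_sum, map_sum]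
      refine Finset.sum_eq_zero fun j _ => ?_
      have hj : (DirectSum.decompose 𝒜 n j : A) ∈ 𝒜 j := SetLike.coe_mem _
      rcases Nat.lt_or_ge i j with h | h
      · exact proj_mul_of_lt _ hj h
      · rcases Nat.eq_zero_or_pos j with rfl | h0
        · rw [← GradedAlgebra.proj_apply, mem_maxIdeal.1 hn, mul_zero, map_zero]
        · obtain ⟨l, rfl⟩ := Nat.exists_eq_add_of_le' h
          rw [proj_add_mul _ hj, ih hr (by omega), zero_mul]
    exact Submodule.smul_induction_on hx hmul fun x y hx hy => by rw [map_add, hx, hy, add_zero]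

theorem degree_le_maxIdeal_pow (hA : IsStandardGraded 𝒜) {a i : ℕ} (h : a ≤ i) {x : A}
    (hx : x ∈ 𝒜 i) : x ∈ maxIdeal 𝒜 ^ a := by
  induction a generalizing i x with
  | zero => rw [maxIdeal_pow_zero]; trivial
  | succ a ih =>
    obtain ⟨i, rfl⟩ := Nat.exists_eq_add_of_le' (show 1 ≤ i by omega)
    rw [degree_succ_eq_mul hA] at hx
    rw [Submodule.pow_succ]
    induction hx using Submodule.mul_induction_on' with
    | mem_mul_mem y hy z hz =>
      exact Submodule.smul_mem_smul (ih (by omega) hy) (mem_maxIdeal_of_mem one_pos hz)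
    | add y _ z _ hy hz => exact add_mem hy hz

theorem finrank_degree_zero (hA : IsStandardGraded 𝒜) : Module.finrank k (𝒜 0) = 1 := by
  have := hA.nontrivial
  rw [hA.zero_eq_one, Submodule.one_eq_span]
  exact finrank_span_singleton one_ne_zero

theorem exists_algebraMap_eq (hA : IsStandardGraded 𝒜) {x : A} (hx : x ∈ 𝒜 0) :
    ∃ c : k, algebraMap k A c = x := by
  rw [hA.zero_eq_one] at hx
  exact Submodule.mem_one.1 hx

end Grading

/-! ### Presentations by free modules `A ⊗ U`, their linear relations and iterated syzygies. -/

section Presentation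

variable {k : Type u} {A : Type v} [Field k] [Ring A] [Algebra k A]

/-- The `A`-linear extension `A ⊗ S → M`, `a ⊗ s ↦ a • f s`, of a `k`-linear map `f : S → M`. -/
noncomputable def scalarExtension {S : Type w} {M : Type x} [AddCommMonoid S] [Module k S]
    [AddCommMonoid M] [Module k M] [Module A M] [IsScalarTower k A M] (f : S →ₗ[k] M) :
    A ⊗[k] S →ₗ[A] M :=
  TensorProduct.AlgebraTensorModule.lift
    { toFun := fun a => (Algebra.lsmul k k M a) ∘ₗ f
      map_add' := fun a b => by ext; simp
      map_smul' := fun a b => by ext; simp }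

variable (𝒜 : ℕ → Submodule k A) [GradedAlgebra 𝒜]

/-- The projection `A ⊗ U → A_i ⊗ U ⊆ A ⊗ U`. -/
noncomputable def degProj (U : Type w) [AddCommGroup U] [Module k U] (i : ℕ) :
    A ⊗[k] U →ₗ[k] A ⊗[k] U :=
  (GradedAlgebra.proj 𝒜 i).rTensor U

@[simp] theorem degProj_tmul {U : Type w} [AddCommGroup U] [Module k U] (i : ℕ) (a : A) (y : U) :
    degProj 𝒜 U i (a ⊗ₜ y) = GradedAlgebra.proj 𝒜 i a ⊗ₜ y := rfl

theorem degProj_baseChange {U : Type w} {U' : Type w'} [AddCommGroup U] [Module k U]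
    [AddCommGroup U'] [Module k U'] (f : U →ₗ[k] U') (i : ℕ) (y : A ⊗[k] U) :
    degProj 𝒜 U' i (f.baseChange A y) = f.baseChange A (degProj 𝒜 U i y) := by
  induction y using TensorProduct.induction_on with
  | zero => simp
  | tmul a y => simp
  | add y z hy hz => simp only [map_add, hy, hz]

theorem degProj_degProj {U : Type w} [AddCommGroup U] [Module k U] (i : ℕ) (y : A ⊗[k] U) :
    degProj 𝒜 U i (degProj 𝒜 U i y) = degProj 𝒜 U i y := by
  induction y using TensorProduct.induction_on with
  | zero => simp
  | tmul a y => simp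
  | add y z hy hz => simp only [map_add, hy, hz]

/-- A left `A`-module presented as the quotient of a free module `A ⊗ U` by `rel`. -/
structure Presentation (k : Type u) (A : Type v) [Field k] [Ring A] [Algebra k A] where
  U : Type v
  [addCommGroup : AddCommGroup U]
  [module : Module k U]
  rel : Submodule A (A ⊗[k] U)

attribute [instance] Presentation.addCommGroup Presentation.module

namespace Presentation

/-- The relations lying in `A₁ ⊗ U`. -/
noncomputable def linearPart (P : Presentation k A) : Submodule k (A ⊗[k] P.U) :=
  P.rel.restrictScalars k ⊓ LinearMap.eqLocus (degProj 𝒜 P.U 1) LinearMap.id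

/-- The presentation of the module generated by the linear relations. -/
noncomputable def syzygy (P : Presentation k A) : Presentation k A where
  U := P.linearPart 𝒜
  rel := LinearMap.ker (scalarExtension (P.linearPart 𝒜).subtype)

/-- The inclusion of the linear relations. -/
noncomputable def incl (P : Presentation k A) : (P.syzygy 𝒜).U →ₗ[k] A ⊗[k] P.U :=
  (P.linearPart 𝒜).subtype

/-- The map from the free module on the linear relations to `A ⊗ U`. -/
noncomputable def evalMap (P : Presentation k A) : A ⊗[k] (P.syzygy 𝒜).U →ₗ[A] A ⊗[k] P.U :=
  scalarExtension (P.incl 𝒜)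

theorem evalMap_tmul (P : Presentation k A) (a : A) (y : (P.syzygy 𝒜).U) :
    P.evalMap 𝒜 (a ⊗ₜ y) = a • P.incl 𝒜 y := rfl

theorem mem_syzygy_rel (P : Presentation k A) (y : A ⊗[k] (P.syzygy 𝒜).U) :
    y ∈ (P.syzygy 𝒜).rel ↔ P.evalMap 𝒜 y = 0 := Iff.rfl

theorem incl_injective (P : Presentation k A) : Function.Injective (P.incl 𝒜) :=
  Subtype.val_injective

theorem incl_mem_rel (P : Presentation k A) (y : (P.syzygy 𝒜).U) : P.incl 𝒜 y ∈ P.rel := y.2.1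

theorem degProj_incl (P : Presentation k A) (y : (P.syzygy 𝒜).U) :
    degProj 𝒜 P.U 1 (P.incl 𝒜 y) = P.incl 𝒜 y := y.2.2

theorem exists_incl_eq (P : Presentation k A) {y : A ⊗[k] P.U} (hy : y ∈ P.rel)
    (hy' : degProj 𝒜 P.U 1 y = y) : ∃ z, P.incl 𝒜 z = y := ⟨⟨y, hy, hy'⟩, rfl⟩

/-- The relations are generated by the linear ones, and are stable under the projection to
the linear part. -/
structure IsLinearlyRelated (P : Presentation k A) : Prop where
  range_evalMap : LinearMap.range (P.evalMap 𝒜) = P.rel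
  degProj_mem : ∀ y ∈ P.rel, degProj 𝒜 P.U 1 y ∈ P.rel

/-- All the iterated syzygies are linearly related: the presented module has a linear
resolution. -/
def HasLinearResolution (P : Presentation k A) : Prop :=
  ∀ n, ((syzygy 𝒜)^[n] P).IsLinearlyRelated 𝒜

variable {𝒜}

theorem HasLinearResolution.isLinearlyRelated {P : Presentation k A}
    (h : P.HasLinearResolution 𝒜) : P.IsLinearlyRelated 𝒜 := h 0

theorem HasLinearResolution.syzygy {P : Presentation k A}
    (h : P.HasLinearResolution 𝒜) : (P.syzygy 𝒜).HasLinearResolution 𝒜 := fun n => h (n + 1)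

theorem evalMap_mem (P : Presentation k A) (y : A ⊗[k] (P.syzygy 𝒜).U) :
    P.evalMap 𝒜 y ∈ P.rel := by
  induction y using TensorProduct.induction_on with
  | zero => simp
  | tmul a y => rw [evalMap_tmul]; exact P.rel.smul_mem a (P.incl_mem_rel 𝒜 y)
  | add y z hy hz => rw [map_add]; exact add_mem hy hz

theorem IsLinearlyRelated.exists_eq {P : Presentation k A} (h : P.IsLinearlyRelated 𝒜)
    {y : A ⊗[k] P.U} (hy : y ∈ P.rel) : ∃ z, P.evalMap 𝒜 z = y := by
  rw [← h.range_evalMap] at hy; exact hy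

theorem IsLinearlyRelated.of_exists {P : Presentation k A}
    (h : ∀ y ∈ P.rel, ∃ z, P.evalMap 𝒜 z = y)
    (h' : ∀ y ∈ P.rel, degProj 𝒜 P.U 1 y ∈ P.rel) : P.IsLinearlyRelated 𝒜 :=
  ⟨le_antisymm (by rintro _ ⟨z, rfl⟩; exact P.evalMap_mem z) h, h'⟩

variable {P Q R : Presentation k A}

variable (𝒜) in
/-- The map induced on linear relations by a morphism of presentations. -/
noncomputable def syzygyMap (f : P.U →ₗ[k] Q.U) (hf : ∀ y ∈ P.rel, f.baseChange A y ∈ Q.rel) :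
    (P.syzygy 𝒜).U →ₗ[k] (Q.syzygy 𝒜).U :=
  ((f.baseChange A).restrictScalars k).restrict (p := P.linearPart 𝒜) (q := Q.linearPart 𝒜)
    fun y hy => ⟨hf y hy.1, by
      change degProj 𝒜 Q.U 1 (f.baseChange A y) = f.baseChange A y
      rw [degProj_baseChange, show degProj 𝒜 P.U 1 y = y from hy.2]⟩

theorem incl_syzygyMap (f : P.U →ₗ[k] Q.U) (hf : ∀ y ∈ P.rel, f.baseChange A y ∈ Q.rel)
    (y : (P.syzygy 𝒜).U) :
    Q.incl 𝒜 (syzygyMap 𝒜 f hf y) = f.baseChange A (P.incl 𝒜 y) := rfl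

theorem evalMap_syzygyMap (f : P.U →ₗ[k] Q.U) (hf : ∀ y ∈ P.rel, f.baseChange A y ∈ Q.rel)
    (y : A ⊗[k] (P.syzygy 𝒜).U) :
    Q.evalMap 𝒜 ((syzygyMap 𝒜 f hf).baseChange A y) = f.baseChange A (P.evalMap 𝒜 y) := by
  induction y using TensorProduct.induction_on with
  | zero => simp
  | tmul a y =>
    rw [LinearMap.baseChange_tmul, evalMap_tmul, evalMap_tmul, map_smul, incl_syzygyMap]
  | add y z hy hz => simp only [map_add, hy, hz]

theorem syzygyMap_mem_rel (f : P.U →ₗ[k] Q.U) (hf : ∀ y ∈ P.rel, f.baseChange A y ∈ Q.rel) :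
    ∀ y ∈ (P.syzygy 𝒜).rel, (syzygyMap 𝒜 f hf).baseChange A y ∈ (Q.syzygy 𝒜).rel := by
  intro y hy
  rw [mem_syzygy_rel] at *
  rw [evalMap_syzygyMap, hy, map_zero]

/-! ### Short exact sequences of presentations and the passage to syzygies. -/

section ShortExact

/-- Short exact sequences of presentations: exact on generators and on relations. -/
structure IsShortExact (f : P.U →ₗ[k] Q.U) (g : Q.U →ₗ[k] R.U) : Prop where
  injective : Function.Injective f
  exact : Function.Exact f g
  surjective : Function.Surjective g
  rel_iff : ∀ y, f.baseChange A y ∈ Q.rel ↔ y ∈ P.rel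
  rel_map : ∀ y ∈ Q.rel, g.baseChange A y ∈ R.rel
  rel_lift : ∀ z ∈ R.rel, ∃ y ∈ Q.rel, g.baseChange A y = z

variable {f : P.U →ₗ[k] Q.U} {g : Q.U →ₗ[k] R.U}

theorem baseChange_injective {U U' : Type*} [AddCommGroup U] [Module k U] [AddCommGroup U']
    [Module k U'] {f : U →ₗ[k] U'} (hf : Function.Injective f) :
    Function.Injective (f.baseChange A) :=
  Module.Flat.lTensor_preserves_injective_linearMap (M := A) f hf

theorem baseChange_exact {U U' U'' : Type*} [AddCommGroup U] [Module k U] [AddCommGroup U']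
    [Module k U'] [AddCommGroup U''] [Module k U''] {f : U →ₗ[k] U'} {g : U' →ₗ[k] U''}
    (h : Function.Exact f g) : Function.Exact (f.baseChange A) (g.baseChange A) :=
  Module.Flat.lTensor_exact (M := A) h

theorem baseChange_surjective {U U' : Type*} [AddCommGroup U] [Module k U] [AddCommGroup U']
    [Module k U'] {f : U →ₗ[k] U'} (hf : Function.Surjective f) :
    Function.Surjective (f.baseChange A) :=
  LinearMap.lTensor_surjective A hf

/-- Every relation of `R` is the image of one of `Q`, and the images of the linear relations of `Q`
are linear relations of `R`. -/
theorem IsShortExact.isLinearlyRelated (h : IsShortExact f g) (hQ : Q.IsLinearlyRelated 𝒜) :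
    R.IsLinearlyRelated 𝒜 := by
  refine .of_exists (fun z hz => ?_) fun z hz => ?_
  · obtain ⟨y, hy, rfl⟩ := h.rel_lift z hz
    obtain ⟨w, rfl⟩ := hQ.exists_eq hy
    exact ⟨_, evalMap_syzygyMap g h.rel_map w⟩
  · obtain ⟨y, hy, rfl⟩ := h.rel_lift z hz
    rw [degProj_baseChange]
    exact h.rel_map _ (hQ.degProj_mem y hy)

/-- A diagram chase of snake type. Linear relations of `R` lift to `Q` because the relations of `Q`
are stable under projection to degree one; lifting second-order relations needs that the relations
of `P` are generated by the linear ones. Nothing about `R` is used, which allows linearity of `R` to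
be the conclusion. -/
theorem IsShortExact.syzygy (h : IsShortExact f g) (hP : P.IsLinearlyRelated 𝒜)
    (hQ : Q.IsLinearlyRelated 𝒜) :
    IsShortExact (P := P.syzygy 𝒜) (Q := Q.syzygy 𝒜) (R := R.syzygy 𝒜)
      (syzygyMap 𝒜 f fun y hy => (h.rel_iff y).2 hy) (syzygyMap 𝒜 g h.rel_map) := by
  have hinj := baseChange_injective (A := A) h.injective
  have hex := baseChange_exact (A := A) h.exact
  have hsurj : Function.Surjective (syzygyMap 𝒜 g h.rel_map) := by
    intro z
    obtain ⟨y, hy, hyz⟩ := h.rel_lift _ (R.incl_mem_rel 𝒜 z)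
    obtain ⟨s, hs⟩ := Q.exists_incl_eq 𝒜 (hQ.degProj_mem y hy) (degProj_degProj 𝒜 1 y)
    refine ⟨s, R.incl_injective 𝒜 ?_⟩
    rw [incl_syzygyMap, hs, ← degProj_baseChange, hyz, degProj_incl]
  have hexact : Function.Exact (syzygyMap 𝒜 f fun y hy => (h.rel_iff y).2 hy)
      (syzygyMap 𝒜 g h.rel_map) := by
    intro y
    rw [← map_eq_zero_iff _ (R.incl_injective 𝒜), incl_syzygyMap, hex]
    constructor
    · rintro ⟨z, hz⟩
      obtain ⟨s, hs⟩ := P.exists_incl_eq 𝒜 (y := z)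
        ((h.rel_iff z).1 (hz ▸ Q.incl_mem_rel 𝒜 y))
        (hinj (by rw [← degProj_baseChange, hz, degProj_incl]))
      exact ⟨s, Q.incl_injective 𝒜 (by rw [incl_syzygyMap, hs, hz])⟩
    · rintro ⟨z, rfl⟩
      exact ⟨P.incl 𝒜 z, rfl⟩
  refine ⟨?_, hexact, hsurj, fun y => ?_, syzygyMap_mem_rel g h.rel_map, fun z hz => ?_⟩
  · intro y z hyz
    have := congrArg (Q.incl 𝒜) hyz
    rw [incl_syzygyMap, incl_syzygyMap] at this
    exact P.incl_injective 𝒜 (hinj this)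
  · rw [mem_syzygy_rel, mem_syzygy_rel, evalMap_syzygyMap, map_eq_zero_iff _ hinj]
  · obtain ⟨y, rfl⟩ := baseChange_surjective (A := A) hsurj z
    rw [mem_syzygy_rel, evalMap_syzygyMap] at hz
    -- A lift `y` of the relation `z` evaluates to a relation coming from `P`; since `P` is linearly
    -- related, that error is the value of some `s`, and subtracting the image of `s` does not
    -- change `z`.
    obtain ⟨t, ht⟩ := (hex _).1 hz
    have htP : t ∈ P.rel := (h.rel_iff t).1 (ht ▸ Q.evalMap_mem y)
    obtain ⟨s, rfl⟩ := hP.exists_eq htP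
    refine ⟨y - (syzygyMap 𝒜 f fun y hy => (h.rel_iff y).2 hy).baseChange A s, ?_, ?_⟩
    · rw [mem_syzygy_rel, map_sub, evalMap_syzygyMap, ht, sub_self]
    · rw [map_sub, (baseChange_exact hexact).apply_apply_eq_zero, sub_zero]

theorem IsShortExact.exists_iterate (h : IsShortExact f g) (hP : P.HasLinearResolution 𝒜)
    (hQ : Q.HasLinearResolution 𝒜) (n : ℕ) :
    ∃ (f' : ((Presentation.syzygy 𝒜)^[n] P).U →ₗ[k] ((Presentation.syzygy 𝒜)^[n] Q).U)
      (g' : ((Presentation.syzygy 𝒜)^[n] Q).U →ₗ[k] ((Presentation.syzygy 𝒜)^[n] R).U),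
      IsShortExact f' g' := by
  induction n generalizing P Q R with
  | zero => exact ⟨f, g, h⟩
  | succ n ih =>
    exact ih (h.syzygy hP.isLinearlyRelated hQ.isLinearlyRelated) hP.syzygy hQ.syzygy

/-- Iterating the passage to syzygies keeps the sequence exact at every stage, and each stage of `R`
inherits its linear relations from `Q`. -/
theorem IsShortExact.hasLinearResolution (h : IsShortExact f g) (hP : P.HasLinearResolution 𝒜)
    (hQ : Q.HasLinearResolution 𝒜) : R.HasLinearResolution 𝒜 := fun n => by
  obtain ⟨f', g', h'⟩ := h.exists_iterate hP hQ n
  exact h'.isLinearlyRelated (hQ n)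

theorem IsShortExact.finrank_eq [Module.Finite k Q.U] (h : IsShortExact f g) :
    Module.finrank k Q.U = Module.finrank k P.U + Module.finrank k R.U := by
  rw [← LinearMap.finrank_range_add_finrank_ker g, LinearMap.range_eq_top.2 h.surjective,
    finrank_top, h.exact.linearMap_ker_eq, LinearMap.finrank_range_of_inj h.injective, add_comm]

end ShortExact

/-! ### Finite direct sums of copies of a presentation. -/

section Biproduct

/-- `Q` is the direct sum of copies of `P` indexed by `J`, with injections `f` and
projections `p`. -/
structure IsBiproduct {J : Type w} [Fintype J] [DecidableEq J] (f : J → P.U →ₗ[k] Q.U)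
    (p : J → Q.U →ₗ[k] P.U) : Prop where
  map_f : ∀ j, ∀ y ∈ P.rel, (f j).baseChange A y ∈ Q.rel
  map_p : ∀ j, ∀ y ∈ Q.rel, (p j).baseChange A y ∈ P.rel
  sum_eq : ∑ j, f j ∘ₗ p j = LinearMap.id
  comp_eq : ∀ i j, p i ∘ₗ f j = if i = j then LinearMap.id else 0

variable {J : Type w} [Fintype J] [DecidableEq J] {f : J → P.U →ₗ[k] Q.U}
  {p : J → Q.U →ₗ[k] P.U}

theorem IsBiproduct.sum_baseChange (h : IsBiproduct f p) (y : A ⊗[k] Q.U) :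
    ∑ j, (f j).baseChange A ((p j).baseChange A y) = y := by
  induction y using TensorProduct.induction_on with
  | zero => simp
  | tmul a y =>
    simp only [LinearMap.baseChange_tmul]
    rw [← TensorProduct.tmul_sum]
    congr 1
    simpa using LinearMap.congr_fun h.sum_eq y
  | add y z hy hz => simp only [map_add, Finset.sum_add_distrib, hy, hz]

theorem IsBiproduct.comp_baseChange (h : IsBiproduct f p) (i j : J) (y : A ⊗[k] P.U) :
    (p i).baseChange A ((f j).baseChange A y) = if i = j then y else 0 := by
  rw [← LinearMap.comp_apply, ← LinearMap.baseChange_comp, h.comp_eq]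
  split_ifs <;> simp

theorem IsBiproduct.isLinearlyRelated (h : IsBiproduct f p) (hP : P.IsLinearlyRelated 𝒜) :
    Q.IsLinearlyRelated 𝒜 := by
  refine .of_exists (fun y hy => ?_) fun y hy => ?_
  · choose z hz using fun j => hP.exists_eq (h.map_p j y hy)
    refine ⟨∑ j, (syzygyMap 𝒜 (f j) (h.map_f j)).baseChange A (z j), ?_⟩
    simp only [map_sum]
    rw [← h.sum_baseChange y]
    exact Finset.sum_congr rfl fun j _ => by rw [evalMap_syzygyMap, hz]
  · rw [← h.sum_baseChange (degProj 𝒜 Q.U 1 y)]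
    refine sum_mem fun j _ => h.map_f j _ ?_
    rw [← degProj_baseChange]
    exact hP.degProj_mem _ (h.map_p j y hy)

/-- Functoriality alone: the identities among injections and projections survive base change, hence
hold on linear relations. No linearity is required, so ranks can be computed at every stage. -/
theorem IsBiproduct.syzygy (h : IsBiproduct f p) :
    IsBiproduct (P := P.syzygy 𝒜) (Q := Q.syzygy 𝒜) (fun j => syzygyMap 𝒜 (f j) (h.map_f j))
      (fun j => syzygyMap 𝒜 (p j) (h.map_p j)) := by
  refine ⟨fun j => syzygyMap_mem_rel _ _, fun j => syzygyMap_mem_rel _ _, ?_, fun i j => ?_⟩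
  · refine LinearMap.ext fun y => Q.incl_injective 𝒜 ?_
    simpa [LinearMap.sum_apply, incl_syzygyMap] using h.sum_baseChange (Q.incl 𝒜 y)
  · refine LinearMap.ext fun y => P.incl_injective 𝒜 ?_
    rw [LinearMap.comp_apply, incl_syzygyMap, incl_syzygyMap, h.comp_baseChange]
    split_ifs <;> simp

theorem IsBiproduct.exists_iterate (h : IsBiproduct f p) (n : ℕ) :
    ∃ (f' : J → ((Presentation.syzygy 𝒜)^[n] P).U →ₗ[k] ((Presentation.syzygy 𝒜)^[n] Q).U)
      (p' : J → ((Presentation.syzygy 𝒜)^[n] Q).U →ₗ[k] ((Presentation.syzygy 𝒜)^[n] P).U),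
      IsBiproduct f' p' := by
  induction n generalizing P Q with
  | zero => exact ⟨f, p, h⟩
  | succ n ih => exact ih h.syzygy

theorem IsBiproduct.hasLinearResolution (h : IsBiproduct f p) (hP : P.HasLinearResolution 𝒜) :
    Q.HasLinearResolution 𝒜 := fun n => by
  obtain ⟨f', p', h'⟩ := h.exists_iterate (𝒜 := 𝒜) n
  exact h'.isLinearlyRelated (hP n)

/-- The generators of a direct sum of copies of `P`. -/
noncomputable def IsBiproduct.equiv (h : IsBiproduct f p) : Q.U ≃ₗ[k] (J → P.U) :=
  LinearEquiv.ofLinearMap (LinearMap.pi p) (∑ j, f j ∘ₗ LinearMap.proj j)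
    (by
      refine LinearMap.ext fun y => funext fun i => ?_
      simp only [LinearMap.comp_apply, LinearMap.pi_apply, LinearMap.sum_apply, map_sum,
        LinearMap.proj_apply, LinearMap.id_apply]
      have : ∀ j, p i (f j (y j)) = if i = j then y j else 0 := fun j => by
        rw [← LinearMap.comp_apply, h.comp_eq]; split_ifs <;> rfl
      simp [this])
    (by
      refine LinearMap.ext fun y => ?_
      simpa [LinearMap.sum_apply] using LinearMap.congr_fun h.sum_eq y)

theorem IsBiproduct.finrank_eq [Module.Finite k P.U] (h : IsBiproduct f p) :
    Module.finrank k Q.U = Fintype.card J * Module.finrank k P.U := by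
  rw [h.equiv.finrank_eq, Module.finrank_pi_fintype]
  simp

end Biproduct

end Presentation

end Presentation

/-! ### The multiplication maps `A ⊗ A_a → A`. -/

section MulMap

variable {k : Type u} {A : Type v} [Field k] [Ring A] [Algebra k A] {𝒜 : ℕ → Submodule k A}

variable (𝒜) in
/-- The presentation `A ⊗ A_a → 𝔪 ^ a` of the powers of the maximal ideal. -/
noncomputable def powerPresentation (a : ℕ) : Presentation k A where
  U := 𝒜 a
  rel := LinearMap.ker (scalarExtension (𝒜 a).subtype)

/-- The multiplication map `A ⊗ A_a → A`. -/
noncomputable def mulMap (𝒜 : ℕ → Submodule k A) (a : ℕ) : A ⊗[k] 𝒜 a →ₗ[A] A :=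
  scalarExtension (𝒜 a).subtype

theorem mulMap_tmul (a : ℕ) (b : A) (y : 𝒜 a) : mulMap 𝒜 a (b ⊗ₜ y) = b * y := rfl

theorem mem_powerPresentation_rel {a : ℕ} {y : A ⊗[k] 𝒜 a} :
    y ∈ (powerPresentation 𝒜 a).rel ↔ mulMap 𝒜 a y = 0 := Iff.rfl

end MulMap

/-! ### Powers of the maximal ideal: linearity and the recursion for Betti numbers. -/

section PowerPresentations

variable {k : Type u} {A : Type v} [Field k] [Ring A] [Algebra k A]
  {𝒜 : ℕ → Submodule k A} [GradedAlgebra 𝒜]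

theorem degProj_zero_smul {U : Type w} [AddCommGroup U] [Module k U] (a : A) (y : A ⊗[k] U) :
    degProj 𝒜 U 0 (a • y) = GradedAlgebra.proj 𝒜 0 a • degProj 𝒜 U 0 y := by
  induction y using TensorProduct.induction_on with
  | zero => simp
  | tmul b y =>
    have h : ∀ z, GradedAlgebra.proj 𝒜 0 z = GradedRing.projZeroRingHom 𝒜 z := fun z => rfl
    simp only [TensorProduct.smul_tmul', smul_eq_mul, degProj_tmul, h, map_mul]
  | add y z hy hz => simp only [smul_add, map_add, hy, hz]

theorem degProj_degProj_ne {U : Type w} [AddCommGroup U] [Module k U] {i j : ℕ} (h : j ≠ i)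
    (y : A ⊗[k] U) : degProj 𝒜 U i (degProj 𝒜 U j y) = 0 := by
  induction y using TensorProduct.induction_on with
  | zero => simp
  | tmul b y => rw [degProj_tmul, degProj_tmul, proj_of_mem_ne (proj_mem 𝒜 j b) h,
      TensorProduct.zero_tmul]
  | add y z hy hz => simp only [map_add, hy, hz, add_zero]

theorem degProj_mem_range {U : Type w} [AddCommGroup U] [Module k U] (i : ℕ) (y : A ⊗[k] U) :
    degProj 𝒜 U i y ∈ LinearMap.range ((𝒜 i).subtype.rTensor U) := by
  induction y using TensorProduct.induction_on with
  | zero => simp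
  | tmul b y => exact ⟨⟨_, proj_mem 𝒜 i b⟩ ⊗ₜ y, rfl⟩
  | add y z hy hz => rw [map_add]; exact add_mem hy hz

/-- An element of `A₀ ⊗ U` is of the form `1 ⊗ y`. -/
theorem exists_degProj_zero_eq (hA : IsStandardGraded 𝒜) {U : Type w} [AddCommGroup U] [Module k U]
    (y : A ⊗[k] U) : ∃ z : U, degProj 𝒜 U 0 y = 1 ⊗ₜ z := by
  induction y using TensorProduct.induction_on with
  | zero => exact ⟨0, by simp⟩
  | tmul b y =>
    obtain ⟨c, hc⟩ := exists_algebraMap_eq hA (proj_mem 𝒜 0 b)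
    exact ⟨c • y, by rw [degProj_tmul, ← hc, TensorProduct.tmul_smul, TensorProduct.smul_tmul',
      Algebra.algebraMap_eq_smul_one]⟩
  | add y z hy hz =>
    obtain ⟨s, hs⟩ := hy
    obtain ⟨t, ht⟩ := hz
    exact ⟨s + t, by rw [map_add, hs, ht, TensorProduct.tmul_add]⟩

namespace Presentation

theorem finite_syzygy (hA : IsStandardGraded 𝒜) (P : Presentation k A) [Module.Finite k P.U] :
    Module.Finite k (P.syzygy 𝒜).U := by
  have := hA.finite 1
  have hmem : ∀ y, P.incl 𝒜 y ∈ LinearMap.range ((𝒜 1).subtype.rTensor P.U) := fun y => by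
    rw [← degProj_incl]; exact degProj_mem_range 1 _
  have : Module.Finite k (LinearMap.range ((𝒜 1).subtype.rTensor P.U)) :=
    Module.Finite.range _
  have := isNoetherian_of_isNoetherianRing_of_finite k
    (LinearMap.range ((𝒜 1).subtype.rTensor P.U))
  exact Module.Finite.of_injective ((P.incl 𝒜).codRestrict _ hmem)
    ((P.incl_injective 𝒜).codRestrict hmem)

theorem finite_iterate (hA : IsStandardGraded 𝒜) (P : Presentation k A) [h : Module.Finite k P.U]
    (n : ℕ) : Module.Finite k ((syzygy 𝒜)^[n] P).U := by
  induction n with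
  | zero => exact h
  | succ n ih => rw [Function.iterate_succ_apply']; exact finite_syzygy hA _

theorem rel_syzygy_eq_bot {P : Presentation k A} (h : P.rel = ⊥) : (P.syzygy 𝒜).rel = ⊥ := by
  have hU : Subsingleton (P.syzygy 𝒜).U := ⟨fun y z => P.incl_injective 𝒜 (by
    have h0 : ∀ y, P.incl 𝒜 y = 0 := fun y =>
      (Submodule.mem_bot A).1 (h.le (P.incl_mem_rel 𝒜 y))
    rw [h0, h0])⟩
  exact Subsingleton.elim _ _

theorem rel_iterate_eq_bot {P : Presentation k A} (h : P.rel = ⊥) (n : ℕ) :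
    ((syzygy 𝒜)^[n] P).rel = ⊥ := by
  induction n with
  | zero => exact h
  | succ n ih => rw [Function.iterate_succ_apply']; exact rel_syzygy_eq_bot ih

theorem hasLinearResolution_of_rel_eq_bot {P : Presentation k A} (h : P.rel = ⊥) :
    P.HasLinearResolution 𝒜 := fun n => by
  refine .of_exists (fun y hy => ⟨0, ?_⟩) fun y hy => ?_ <;>
  · rw [rel_iterate_eq_bot h, Submodule.mem_bot] at hy
    subst hy
    simp

theorem finrank_syzygy_eq_zero {P : Presentation k A} (h : P.rel = ⊥) :
    Module.finrank k (P.syzygy 𝒜).U = 0 := by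
  have hU : Subsingleton (P.syzygy 𝒜).U := ⟨fun y z => P.incl_injective 𝒜 (by
    have h0 : ∀ y, P.incl 𝒜 y = 0 := fun y =>
      (Submodule.mem_bot A).1 (h.le (P.incl_mem_rel 𝒜 y))
    rw [h0, h0])⟩
  exact Module.finrank_zero_of_subsingleton

end Presentation

open Presentation

variable (𝒜) in
/-- The presentation of `k ⊗ A_a`, the direct sum of `dim A_a` copies of the residue field. -/
noncomputable def residuePresentation (a : ℕ) : Presentation k A where
  U := 𝒜 a
  rel :=
    { carrier := {y | degProj 𝒜 (𝒜 a) 0 y = 0}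
      add_mem' := fun {y z} hy hz => by
        rw [Set.mem_ofPred_eq] at *; rw [map_add, hy, hz, add_zero]
      zero_mem' := map_zero _
      smul_mem' := fun c y hy => by
        rw [Set.mem_ofPred_eq] at *; rw [degProj_zero_smul, hy, smul_zero] }

theorem mem_residuePresentation_rel {a : ℕ} {y : A ⊗[k] 𝒜 a} :
    y ∈ (residuePresentation 𝒜 a).rel ↔ degProj 𝒜 (𝒜 a) 0 y = 0 := Iff.rfl

theorem mulMap_degProj (a i : ℕ) (y : A ⊗[k] 𝒜 a) :
    mulMap 𝒜 a (degProj 𝒜 (𝒜 a) i y) = GradedAlgebra.proj 𝒜 (i + a) (mulMap 𝒜 a y) := by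
  induction y using TensorProduct.induction_on with
  | zero => simp
  | tmul b y => rw [degProj_tmul, mulMap_tmul, mulMap_tmul, proj_add_mul _ y.2]
  | add y z hy hz => simp only [map_add, hy, hz]

/-- The degree zero part of `A ⊗ A_a` is `1 ⊗ A_a`, on which multiplication is injective. Thus the
generators `A_a` of `𝔪^a` are minimal, and the identity of `A_a` maps relations of `𝔪^a` to
relations of `k ⊗ A_a`. -/
theorem powerPresentation_rel_le (hA : IsStandardGraded 𝒜) {a : ℕ} {y : A ⊗[k] 𝒜 a}
    (hy : mulMap 𝒜 a y = 0) : degProj 𝒜 (𝒜 a) 0 y = 0 := by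
  obtain ⟨z, hz⟩ := exists_degProj_zero_eq hA y
  have := mulMap_degProj a 0 y
  rw [hy, map_zero, hz, mulMap_tmul, one_mul] at this
  have h0 : z = 0 := Subtype.ext this
  rw [hz, h0, TensorProduct.tmul_zero]

theorem exists_mulMap_eq (hA : IsStandardGraded 𝒜) {a i : ℕ} (z : 𝒜 (i + a)) :
    ∃ y, mulMap 𝒜 a y = z ∧ degProj 𝒜 (𝒜 a) i y = y := by
  have h : ∃ y, mulMap 𝒜 a y = z := by
    obtain ⟨z, hz⟩ := z
    change ∃ y, mulMap 𝒜 a y = z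
    rw [← pow_degree_one hA, pow_add, pow_degree_one hA, pow_degree_one hA] at hz
    induction hz using Submodule.mul_induction_on' with
    | mem_mul_mem b hb y hy => exact ⟨b ⊗ₜ ⟨y, hy⟩, rfl⟩
    | add b _ c _ hb hc =>
      obtain ⟨s, rfl⟩ := hb
      obtain ⟨t, rfl⟩ := hc
      exact ⟨s + t, map_add _ _ _⟩
  obtain ⟨y, hy⟩ := h
  exact ⟨degProj 𝒜 (𝒜 a) i y, by rw [mulMap_degProj, hy, proj_of_mem z.2], degProj_degProj 𝒜 i y⟩

variable (𝒜) in
/-- The identity of `A_a`, as a morphism of presentations `𝔪 ^ a → 𝔪 ^ a / 𝔪 ^ (a + 1)`. -/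
noncomputable def powerToResidue (a : ℕ) :
    (powerPresentation 𝒜 a).U →ₗ[k] (residuePresentation 𝒜 a).U :=
  (LinearMap.id : 𝒜 a →ₗ[k] 𝒜 a)

theorem powerToResidue_baseChange (a : ℕ) (y : A ⊗[k] (powerPresentation 𝒜 a).U) :
    (powerToResidue 𝒜 a).baseChange A y = y := by
  change (LinearMap.id : 𝒜 a →ₗ[k] 𝒜 a).baseChange A y = y
  rw [LinearMap.baseChange_id]
  rfl

theorem powerToResidue_mem (hA : IsStandardGraded 𝒜) (a : ℕ) :
    ∀ y ∈ (powerPresentation 𝒜 a).rel,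
      (powerToResidue 𝒜 a).baseChange A y ∈ (residuePresentation 𝒜 a).rel := by
  intro y hy
  rw [powerToResidue_baseChange]
  exact powerPresentation_rel_le hA hy

/-- The linear relations of `k ⊗ A_a` are `A₁ ⊗ A_a`, which multiplies to `A_{a+1}`. -/
noncomputable def residueSyzygyToPower (𝒜 : ℕ → Submodule k A) [GradedAlgebra 𝒜] (a : ℕ) :
    ((residuePresentation 𝒜 a).syzygy 𝒜).U →ₗ[k] (powerPresentation 𝒜 (a + 1)).U :=
  LinearMap.codRestrict (𝒜 (a + 1))
    (((mulMap 𝒜 a).restrictScalars k) ∘ₗ (residuePresentation 𝒜 a).incl 𝒜) fun y => by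
      have h := (residuePresentation 𝒜 a).degProj_incl 𝒜 y
      have h' := mulMap_degProj a 1 ((residuePresentation 𝒜 a).incl 𝒜 y)
      rw [add_comm a 1, ← proj_eq_self_iff (𝒜 := 𝒜)]
      exact h'.symm.trans (congrArg _ h)

theorem coe_residueSyzygyToPower (a : ℕ) (y : ((residuePresentation 𝒜 a).syzygy 𝒜).U) :
    (show 𝒜 (a + 1) from residueSyzygyToPower 𝒜 a y).1 =
      mulMap 𝒜 a ((residuePresentation 𝒜 a).incl 𝒜 y) := rfl

theorem mulMap_residueSyzygyToPower (a : ℕ)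
    (y : A ⊗[k] ((residuePresentation 𝒜 a).syzygy 𝒜).U) :
    mulMap 𝒜 (a + 1) ((residueSyzygyToPower 𝒜 a).baseChange A y) =
      mulMap 𝒜 a ((residuePresentation 𝒜 a).evalMap 𝒜 y) := by
  induction y using TensorProduct.induction_on with
  | zero => rw [map_zero, map_zero]; exact (map_zero (mulMap 𝒜 (a + 1))).trans (map_zero _).symm
  | tmul b y => 
    rw [LinearMap.baseChange_tmul, evalMap_tmul]
    exact ((mulMap 𝒜 a).map_smul b _).symm
  | add y z hy hz =>
    rw [map_add, map_add]
    exact (map_add (mulMap 𝒜 (a + 1)) _ _).trans ((congrArg₂ _ hy hz).trans (map_add _ _ _).symm)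

/-- Inside `A ⊗ A_a`, the relations of `k ⊗ A_a` form `𝔪 ⊗ A_a`, those of `𝔪^a` form the kernel of
multiplication, and the quotient of the former by the latter is `𝔪^(a+1)`. On generators this is `0
→ (linear relations of 𝔪^a) → A₁ ⊗ A_a → A_(a+1) → 0`. -/
theorem isShortExact_power (hA : IsStandardGraded 𝒜) (a : ℕ)
    (hR : (powerPresentation 𝒜 a).IsLinearlyRelated 𝒜) :
    IsShortExact (P := (powerPresentation 𝒜 a).syzygy 𝒜)
      (Q := (residuePresentation 𝒜 a).syzygy 𝒜)
      (syzygyMap 𝒜 (powerToResidue 𝒜 a) (powerToResidue_mem hA a))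
      (residueSyzygyToPower 𝒜 a) := by
  set f := syzygyMap 𝒜 (powerToResidue 𝒜 a) (powerToResidue_mem hA a)
  have hf : ∀ y, (residuePresentation 𝒜 a).incl 𝒜 (f y) = (powerPresentation 𝒜 a).incl 𝒜 y :=
    fun y => powerToResidue_baseChange a _
  have hf' : ∀ y, (residuePresentation 𝒜 a).evalMap 𝒜 (f.baseChange A y) =
      (powerPresentation 𝒜 a).evalMap 𝒜 y := fun y => by
    rw [evalMap_syzygyMap, powerToResidue_baseChange]
  have hsurj : Function.Surjective (residueSyzygyToPower 𝒜 a) := by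
    intro z
    obtain ⟨y, hy, hy'⟩ := exists_mulMap_eq hA (a := a) (i := 1)
      ⟨(show 𝒜 (a + 1) from z).1, by rw [add_comm]; exact (show 𝒜 (a + 1) from z).2⟩
    obtain ⟨s, hs⟩ := (residuePresentation 𝒜 a).exists_incl_eq 𝒜 (y := y)
      (mem_residuePresentation_rel.2 (by rw [← hy', degProj_degProj_ne one_ne_zero])) hy'
    exact ⟨s, Subtype.ext ((coe_residueSyzygyToPower a s).trans (hs ▸ hy))⟩
  have hexact : Function.Exact f (residueSyzygyToPower 𝒜 a) := by
    intro y
    constructor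
    · intro hy
      have hy : mulMap 𝒜 a ((residuePresentation 𝒜 a).incl 𝒜 y) = 0 := congrArg Subtype.val hy
      obtain ⟨s, hs⟩ := (powerPresentation 𝒜 a).exists_incl_eq 𝒜
        (y := (residuePresentation 𝒜 a).incl 𝒜 y) hy ((residuePresentation 𝒜 a).degProj_incl 𝒜 y)
      exact ⟨s, (residuePresentation 𝒜 a).incl_injective 𝒜 ((hf s).trans hs)⟩
    · rintro ⟨y, rfl⟩
      refine Subtype.ext ((coe_residueSyzygyToPower a _).trans ?_)
      rw [hf]
      exact (powerPresentation 𝒜 a).incl_mem_rel 𝒜 y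
  refine ⟨fun y z h => ?_, hexact, hsurj, fun y => ?_, fun y hy => ?_, fun z hz => ?_⟩
  · have := congrArg ((residuePresentation 𝒜 a).incl 𝒜) h
    exact (powerPresentation 𝒜 a).incl_injective 𝒜 ((hf y).symm.trans (this.trans (hf z)))
  · rw [mem_syzygy_rel, mem_syzygy_rel, hf']; rfl
  · rw [mem_syzygy_rel] at hy
    exact (mulMap_residueSyzygyToPower a y).trans (by rw [hy]; exact map_zero (mulMap 𝒜 a))
  · obtain ⟨y, rfl⟩ := baseChange_surjective (A := A) hsurj z
    -- A relation of `𝔪^(a+1)`, lifted and evaluated in `A ⊗ A_a`, multiplies to zero, so it is a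
    -- relation of `𝔪^a`. Linear relatedness of `𝔪^a` supplies the correction.
    have hy : (residuePresentation 𝒜 a).evalMap 𝒜 y ∈ (powerPresentation 𝒜 a).rel :=
      (mulMap_residueSyzygyToPower a y).symm.trans hz
    obtain ⟨s, hs⟩ := hR.exists_eq hy
    refine ⟨y - f.baseChange A s, ?_, ?_⟩
    · rw [mem_syzygy_rel, map_sub, hf', hs]; exact sub_self _
    · rw [map_sub, (baseChange_exact hexact).apply_apply_eq_zero, sub_zero]

/-- Since `A₀ = k`, multiplication identifies `A ⊗ A₀` with `A`; this freeness is the base of the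
induction on `a`. -/
theorem powerPresentation_zero_rel (hA : IsStandardGraded 𝒜) :
    (powerPresentation 𝒜 0).rel = ⊥ := by
  have h1 : (1 : A) ∈ 𝒜 0 := SetLike.GradedOne.one_mem
  have key : ∀ y : A ⊗[k] 𝒜 0, y = mulMap 𝒜 0 y ⊗ₜ ⟨1, h1⟩ := by
    intro y
    induction y using TensorProduct.induction_on with
    | zero => simp
    | tmul b y =>
      obtain ⟨c, hc⟩ := exists_algebraMap_eq hA y.2
      have hy : y = c • ⟨1, h1⟩ := Subtype.ext (by
        rw [← hc, Algebra.algebraMap_eq_smul_one]; rfl)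
      rw [mulMap_tmul, ← hc, hy, TensorProduct.tmul_smul, TensorProduct.smul_tmul',
        ← Algebra.commutes, Algebra.smul_def]
    | add y z hy hz => rw [map_add, TensorProduct.add_tmul, ← hy, ← hz]
  refine (Submodule.eq_bot_iff _).2 fun y hy => ?_
  exact (key y).trans (by rw [mem_powerPresentation_rel.1 hy]; exact TensorProduct.zero_tmul _ _)

theorem exists_isBiproduct_residue (hA : IsStandardGraded 𝒜) (a : ℕ) :
    ∃ (f : Fin (dimA 𝒜 a) → (residuePresentation 𝒜 0).U →ₗ[k] (residuePresentation 𝒜 a).U)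
      (p : Fin (dimA 𝒜 a) → (residuePresentation 𝒜 a).U →ₗ[k] (residuePresentation 𝒜 0).U),
      IsBiproduct f p := by
  have := hA.finite a
  have := hA.finite 0
  let b : Module.Basis (Fin (dimA 𝒜 a)) k (𝒜 a) := Module.finBasis k (𝒜 a)
  let e : 𝒜 0 ≃ₗ[k] k := LinearEquiv.ofFinrankEq _ _ (by
    rw [finrank_degree_zero hA, Module.finrank_self])
  let f : Fin (dimA 𝒜 a) → 𝒜 0 →ₗ[k] 𝒜 a := fun j => LinearMap.toSpanSingleton k _ (b j) ∘ₗ e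
  let p : Fin (dimA 𝒜 a) → 𝒜 a →ₗ[k] 𝒜 0 := fun j => e.symm ∘ₗ b.coord j
  refine ⟨f, p, fun j y hy => ?_, fun j y hy => ?_, ?_, fun i j => ?_⟩
  · exact (degProj_baseChange 𝒜 (f j) 0 y).trans
      ((congrArg _ (mem_residuePresentation_rel.1 hy)).trans (map_zero ((f j).baseChange A)))
  · exact (degProj_baseChange 𝒜 (p j) 0 y).trans
      ((congrArg _ (mem_residuePresentation_rel.1 hy)).trans (map_zero ((p j).baseChange A)))
  · have : ∑ j, f j ∘ₗ p j = LinearMap.id := by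
      refine LinearMap.ext fun y => ?_
      simp [f, p, LinearMap.sum_apply, b.sum_repr]
    exact this
  · have : p i ∘ₗ f j = if i = j then LinearMap.id else 0 := by
      refine LinearMap.ext fun y => ?_
      by_cases h : i = j
      · subst h; simp [f, p]
      · simp [f, p, h]
    exact this

instance finite_residuePresentation (a : ℕ) [h : Module.Finite k (𝒜 a)] :
    Module.Finite k (residuePresentation 𝒜 a).U := h

/-- The Betti numbers of the residue field. -/
noncomputable def residueBetti (𝒜 : ℕ → Submodule k A) [GradedAlgebra 𝒜] (n : ℕ) : ℕ :=
  Module.finrank k ((syzygy 𝒜)^[n] (residuePresentation 𝒜 0)).U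

/-- The Betti numbers of `𝔪 ^ a`. -/
noncomputable def powerBetti (𝒜 : ℕ → Submodule k A) [GradedAlgebra 𝒜] (a n : ℕ) : ℕ :=
  Module.finrank k ((syzygy 𝒜)^[n] (powerPresentation 𝒜 a)).U

theorem hasLinearResolution_residue (hA : IsStandardGraded 𝒜)
    (h : (residuePresentation 𝒜 0).HasLinearResolution 𝒜) (a : ℕ) :
    (residuePresentation 𝒜 a).HasLinearResolution 𝒜 := by
  obtain ⟨f, p, hfp⟩ := exists_isBiproduct_residue hA a
  exact hfp.hasLinearResolution h

theorem hasLinearResolution_power (hA : IsStandardGraded 𝒜)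
    (h : (residuePresentation 𝒜 0).HasLinearResolution 𝒜) (a : ℕ) :
    (powerPresentation 𝒜 a).HasLinearResolution 𝒜 := by
  induction a with
  | zero => exact hasLinearResolution_of_rel_eq_bot (powerPresentation_zero_rel hA)
  | succ a ih =>
    exact (isShortExact_power hA a ih.isLinearlyRelated).hasLinearResolution ih.syzygy
      (hasLinearResolution_residue hA h a).syzygy

theorem finrank_iterate_residue (hA : IsStandardGraded 𝒜) (a n : ℕ) :
    Module.finrank k ((syzygy 𝒜)^[n] (residuePresentation 𝒜 a)).U =
      dimA 𝒜 a * residueBetti 𝒜 n := by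
  have := hA.finite 0
  have := finite_iterate hA (residuePresentation 𝒜 0) n
  obtain ⟨f, p, hfp⟩ := exists_isBiproduct_residue hA a
  obtain ⟨f', p', hfp'⟩ := hfp.exists_iterate (𝒜 := 𝒜) n
  rw [hfp'.finrank_eq, Fintype.card_fin]
  rfl

/-- Rank count in the `n`-th syzygies of the sequence `0 → Ω(𝔪^a) → Ω(k ⊗ A_a) → 𝔪^(a+1) → 0`. The
shift between `n + 1` and `n` arises because the first two terms are already syzygies. -/
theorem dimA_mul_residueBetti (hA : IsStandardGraded 𝒜)
    (h : (residuePresentation 𝒜 0).HasLinearResolution 𝒜) (a n : ℕ) :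
    dimA 𝒜 a * residueBetti 𝒜 (n + 1) = powerBetti 𝒜 a (n + 1) + powerBetti 𝒜 (a + 1) n := by
  have := hA.finite a
  have : Module.Finite k ((syzygy 𝒜)^[n] ((residuePresentation 𝒜 a).syzygy 𝒜)).U :=
    finite_iterate hA (residuePresentation 𝒜 a) (n + 1)
  have hR := hasLinearResolution_power hA h a
  obtain ⟨f, g, hfg⟩ := (isShortExact_power hA a hR.isLinearlyRelated).exists_iterate hR.syzygy
    (hasLinearResolution_residue hA h a).syzygy n
  rw [← finrank_iterate_residue hA]
  exact hfg.finrank_eq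

theorem powerBetti_zero_succ (hA : IsStandardGraded 𝒜) (n : ℕ) : powerBetti 𝒜 0 (n + 1) = 0 := by
  rw [powerBetti, Function.iterate_succ_apply']
  exact finrank_syzygy_eq_zero (rel_iterate_eq_bot (powerPresentation_zero_rel hA) n)

theorem powerBetti_zero (a : ℕ) : powerBetti 𝒜 a 0 = dimA 𝒜 a := rfl

/-- The pair `a = n = 0` must be excluded: `𝔪^0 = A` has one generator, whereas the sum is empty. -/
theorem powerBetti_eq (hA : IsStandardGraded 𝒜)
    (h : (residuePresentation 𝒜 0).HasLinearResolution 𝒜) (a n : ℕ) (hn : a ≠ 0 ∨ n ≠ 0) :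
    (powerBetti 𝒜 a n : ℤ) =
      ∑ i ∈ Finset.Icc 1 a, (-1 : ℤ) ^ (i + 1) * residueBetti 𝒜 (n + i) * dimA 𝒜 (a - i) := by
  induction a generalizing n with
  | zero =>
    obtain ⟨n, rfl⟩ := Nat.exists_eq_succ_of_ne_zero (hn.resolve_left fun h => h rfl)
    simp [powerBetti_zero_succ hA]
  | succ a ih =>
    have h1 : (dimA 𝒜 a : ℤ) * residueBetti 𝒜 (n + 1) =
        powerBetti 𝒜 a (n + 1) + powerBetti 𝒜 (a + 1) n := by
      exact_mod_cast dimA_mul_residueBetti hA h a n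
    rw [← sub_eq_iff_eq_add'] at h1
    have hsum : ∀ (m : ℕ) (f : ℕ → ℤ), ∑ i ∈ Finset.Icc 1 m, f i =
        ∑ i ∈ Finset.range m, f (i + 1) := fun m f => by
      rw [Finset.range_eq_Ico, Finset.sum_Ico_add', zero_add]; rfl
    -- The product `dim A_a · β_(n+1)(k)` is the term `i = 1`; subtracting the formula for
    -- `β_(n+1)(𝔪^a)` supplies the other terms, with `i` raised by one and the sign reversed.
    rw [← h1, ih (n + 1) (Or.inr n.succ_ne_zero), hsum, hsum, Finset.sum_range_succ',
      sub_eq_add_neg, add_comm, ← Finset.sum_neg_distrib]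
    refine congrArg₂ _ (Finset.sum_congr rfl fun i _ => ?_) ?_
    · rw [show n + 1 + (i + 1) = n + (i + 1 + 1) by ring, Nat.add_sub_add_right]
      ring
    · simp [mul_comm]

end PowerPresentations

/-! ### Graded free modules, comparison of resolutions, and independence of `Tor`. -/

section GradedFree

variable {k : Type u} {A : Type v} [Field k] [Ring A] [Algebra k A]
  {𝒜 : ℕ → Submodule k A}

theorem mem_freeComponent {ι : Type w} {deg : ι → ℤ} {j : ℤ} {f : ι →₀ A} :
    f ∈ freeComponent 𝒜 deg j ↔ ∀ b, f b ∈ component 𝒜 (j - deg b) := by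
  simp [freeComponent, Submodule.mem_iInf]

theorem single_mem_freeComponent {ι : Type w} {deg : ι → ℤ} {j : ℤ} {b : ι} {a : A}
    (ha : a ∈ component 𝒜 (j - deg b)) : Finsupp.single b a ∈ freeComponent 𝒜 deg j := by
  classical
  refine mem_freeComponent.2 fun c => ?_
  rw [Finsupp.single_apply]
  split_ifs with h
  · exact h ▸ ha
  · exact zero_mem _

/-- A family of submodules with compatible projections, such as the graded components of a graded
module. -/
def HasProjections {M : Type x} [AddCommGroup M] [Module k M] (ℳ : ℤ → Submodule k M) : Prop :=
  ∃ p : ℤ → M →ₗ[k] M, (∀ j, ∀ m ∈ ℳ j, p j m = m) ∧ ∀ i j, i ≠ j → ∀ m ∈ ℳ i, p j m = 0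

theorem exists_lift {ι : Type w} {N N' : Type*} [AddCommGroup N] [Module A N] [AddCommGroup N']
    [Module A N'] {q : N →ₗ[A] N'} {r : (ι →₀ A) →ₗ[A] N'} (hqr : ∀ f, ∃ g, q g = r f) :
    ∃ φ : (ι →₀ A) →ₗ[A] N, ∀ f, q (φ f) = r f := by
  choose g hg using fun b => hqr (Finsupp.single b 1)
  refine ⟨Finsupp.linearCombination A g, fun f => ?_⟩
  induction f using Finsupp.induction_linear with
  | zero => simp
  | add f g hf hg => simp only [map_add, hf, hg]
  | single b a =>
    rw [Finsupp.linearCombination_single, map_smul, hg, ← map_smul, Finsupp.smul_single,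
      smul_eq_mul, mul_one]

namespace GradedFreeResolution

variable {M : Type x} [AddCommGroup M] [Module k M] [Module A M] {ℳ : ℤ → Submodule k M}

/-- The cycles of the augmented complex `F → M`. -/
noncomputable def kernel (F : GradedFreeResolution.{u, v, x, w} 𝒜 ℳ) :
    ∀ n, Submodule A (F.ι n →₀ A)
  | 0 => LinearMap.ker F.ε
  | n + 1 => LinearMap.ker (F.d n)

theorem mem_kernel_iff (F : GradedFreeResolution.{u, v, x, w} 𝒜 ℳ) {n : ℕ} {f : F.ι n →₀ A} :
    f ∈ F.kernel n ↔ ∃ g, F.d n g = f := by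
  cases n with
  | zero => exact F.exact_zero f
  | succ n => exact F.exact_succ n f

theorem d_mem_kernel (F : GradedFreeResolution.{u, v, x, w} 𝒜 ℳ) (n : ℕ)
    (f : F.ι (n + 1) →₀ A) : F.d n f ∈ F.kernel n := F.mem_kernel_iff.2 ⟨f, rfl⟩

/-- A graded chain map between resolutions of `M`, compatible with the augmentations. -/
structure IsComparison (F : GradedFreeResolution.{u, v, x, w} 𝒜 ℳ)
    (G : GradedFreeResolution.{u, v, x, w'} 𝒜 ℳ)
    (φ : ∀ n, (F.ι n →₀ A) →ₗ[A] (G.ι n →₀ A)) : Prop where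
  mem : ∀ n j, ∀ f ∈ freeComponent 𝒜 (F.deg n) j, φ n f ∈ freeComponent 𝒜 (G.deg n) j
  d_apply : ∀ n f, G.d n (φ (n + 1) f) = φ n (F.d n f)
  ε_apply : ∀ f, G.ε (φ 0 f) = F.ε f

theorem IsComparison.comp {F : GradedFreeResolution.{u, v, x, w} 𝒜 ℳ}
    {G : GradedFreeResolution.{u, v, x, w'} 𝒜 ℳ} {φ ψ} (hφ : IsComparison F G φ)
    (hψ : IsComparison G F ψ) : IsComparison F F fun n => ψ n ∘ₗ φ n where
  mem n j f hf := hψ.mem n j _ (hφ.mem n j f hf)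
  d_apply n f := by simp only [LinearMap.comp_apply, hψ.d_apply, hφ.d_apply]
  ε_apply f := by simp only [LinearMap.comp_apply, hψ.ε_apply, hφ.ε_apply]

/-- A self-map of a resolution lifting the identity is homotopic to the identity. The homotopy need
not respect degrees, because `tor` divides the cycles of a given degree by everything in them that
is a boundary, of whatever origin. -/
theorem IsComparison.exists_homotopy {F : GradedFreeResolution.{u, v, x, w} 𝒜 ℳ} {α}
    (hα : IsComparison F F α) :
    ∃ h : ∀ n, (F.ι n →₀ A) →ₗ[A] (F.ι (n + 1) →₀ A), (∀ f, α 0 f - f = F.d 0 (h 0 f)) ∧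
      ∀ n f, α (n + 1) f - f = F.d (n + 1) (h (n + 1) f) + h n (F.d n f) := by
  -- The recursion only remembers that `h` is a homotopy on cycles. This suffices to make `α - 1 - h
  -- d` land in cycles one step further.
  let C : ℕ → Type _ := fun n => {h : (F.ι n →₀ A) →ₗ[A] (F.ι (n + 1) →₀ A) //
    ∀ f ∈ F.kernel n, F.d n (h f) = α n f - f}
  obtain ⟨h₀, hh₀⟩ := exists_lift (q := F.d 0) (r := α 0 - LinearMap.id) fun f =>
    (F.exact_zero _).1 (show F.ε (α 0 f - f) = 0 by rw [map_sub, hα.ε_apply, sub_self])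
  have step : ∀ n (h : C n), ∃ h' : C (n + 1),
      ∀ f, F.d (n + 1) (h'.1 f) = α (n + 1) f - f - h.1 (F.d n f) := by
    rintro n ⟨h, hh⟩
    obtain ⟨h', hh'⟩ := exists_lift (q := F.d (n + 1))
      (r := α (n + 1) - LinearMap.id - h ∘ₗ F.d n) fun f =>
      (F.exact_succ n _).1 (show F.d n (α (n + 1) f - f - h (F.d n f)) = 0 by
        rw [map_sub, map_sub, hh _ (F.d_mem_kernel n f), hα.d_apply, sub_self])
    refine ⟨⟨h', fun f hf => ?_⟩, hh'⟩
    have hf : F.d n f = 0 := hf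
    rw [hh']
    simp [hf]
  choose S hS using step
  let H : ∀ n, C n := fun n => Nat.rec ⟨h₀, fun f _ => hh₀ f⟩ S n
  refine ⟨fun n => (H n).1, fun f => (hh₀ f).symm, fun n f => ?_⟩
  have := hS n (H n) f
  change F.d (n + 1) ((H (n + 1)).1 f) = _ at this
  rw [this, sub_add_cancel]

end GradedFreeResolution

variable [GradedAlgebra 𝒜]

theorem component_mul_mem {i j : ℤ} {a b : A} (ha : a ∈ component 𝒜 i)
    (hb : b ∈ component 𝒜 j) : a * b ∈ component 𝒜 (i + j) := by
  rcases i with i | i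
  · rcases j with j | j
    · exact SetLike.mul_mem_graded (A := 𝒜) (i := i) (j := j) ha hb
    · rw [(Submodule.mem_bot k).1 (show b ∈ (⊥ : Submodule k A) from hb), mul_zero]
      exact zero_mem _
  · rw [(Submodule.mem_bot k).1 (show a ∈ (⊥ : Submodule k A) from ha), zero_mul]
    exact zero_mem _

theorem smul_mem_freeComponent {ι : Type w} {deg : ι → ℤ} {i j : ℤ} {a : A} {f : ι →₀ A}
    (ha : a ∈ component 𝒜 i) (hf : f ∈ freeComponent 𝒜 deg j) :
    a • f ∈ freeComponent 𝒜 deg (i + j) := by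
  refine mem_freeComponent.2 fun b => ?_
  rw [add_sub_assoc]
  exact component_mul_mem ha (mem_freeComponent.1 hf b)

variable (𝒜) in
/-- The projection of `A` to its component of degree `j : ℤ`. -/
noncomputable def componentProj : ℤ → A →ₗ[k] A
  | Int.ofNat n => GradedAlgebra.proj 𝒜 n
  | Int.negSucc _ => 0

theorem componentProj_mem (j : ℤ) (a : A) : componentProj 𝒜 j a ∈ component 𝒜 j := by
  rcases j with n | n
  · exact proj_mem 𝒜 n a
  · exact zero_mem _

theorem componentProj_of_mem {j : ℤ} {a : A} (ha : a ∈ component 𝒜 j) :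
    componentProj 𝒜 j a = a := by
  rcases j with n | n
  · exact proj_of_mem ha
  · exact ((Submodule.mem_bot k).1 ha).symm

theorem componentProj_of_mem_ne {i j : ℤ} (h : i ≠ j) {a : A} (ha : a ∈ component 𝒜 i) :
    componentProj 𝒜 j a = 0 := by
  rcases j with n | n
  · rcases i with m | m
    · exact proj_of_mem_ne (i := m) (j := n) ha (fun h' => h (by rw [h']))
    · rw [(Submodule.mem_bot k).1 (show a ∈ (⊥ : Submodule k A) from ha), map_zero]
  · rfl

variable (𝒜) in
/-- The projection of a graded free module to its component of degree `j`. -/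
noncomputable def freeProj {ι : Type w} (deg : ι → ℤ) (j : ℤ) : (ι →₀ A) →ₗ[k] (ι →₀ A) :=
  Finsupp.lsum k fun b => Finsupp.lsingle b ∘ₗ componentProj 𝒜 (j - deg b)

theorem freeProj_single {ι : Type w} (deg : ι → ℤ) (j : ℤ) (b : ι) (a : A) :
    freeProj 𝒜 deg j (Finsupp.single b a) =
      Finsupp.single b (componentProj 𝒜 (j - deg b) a) := by
  simp [freeProj]

theorem freeProj_mem {ι : Type w} (deg : ι → ℤ) (j : ℤ) (f : ι →₀ A) :
    freeProj 𝒜 deg j f ∈ freeComponent 𝒜 deg j := by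
  induction f using Finsupp.induction_linear with
  | zero => simp
  | add f g hf hg => rw [map_add]; exact add_mem hf hg
  | single b a =>
    rw [freeProj_single]; exact single_mem_freeComponent (componentProj_mem _ _)

theorem freeProj_apply {ι : Type w} (deg : ι → ℤ) (j : ℤ) (f : ι →₀ A) (b : ι) :
    freeProj 𝒜 deg j f b = componentProj 𝒜 (j - deg b) (f b) := by
  classical
  induction f using Finsupp.induction_linear with
  | zero => simp
  | add f g hf hg => simp only [map_add, Finsupp.add_apply, hf, hg]
  | single c a =>
    rw [freeProj_single, Finsupp.single_apply, Finsupp.single_apply]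
    split_ifs with h
    · rw [h]
    · rw [map_zero]

theorem hasProjections_freeComponent {ι : Type w} (deg : ι → ℤ) :
    HasProjections (freeComponent 𝒜 deg) := by
  refine ⟨freeProj 𝒜 deg, fun j f hf => ?_, fun i j hij f hf => ?_⟩
  · ext b
    rw [freeProj_apply, componentProj_of_mem (mem_freeComponent.1 hf b)]
  · ext b
    rw [freeProj_apply, componentProj_of_mem_ne _ (mem_freeComponent.1 hf b), Finsupp.zero_apply]
    intro h
    exact hij (by linarith)

/-! ### Lifting along graded maps. -/

section Lift

variable {M : Type x} [AddCommGroup M] [Module k M] [Module A M]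
  {ℳ : ℤ → Submodule k M}

/-- It is enough to check homogeneous multiples of basis elements; each has a single degree, which
`q` preserves. -/
theorem proj_map_eq {M : Type x} [AddCommGroup M] [Module k M]
    {ℳ : ℤ → Submodule k M} {ι : Type w} {deg : ι → ℤ} {q : (ι →₀ A) →ₗ[k] M}
    (hq : ∀ j, ∀ f ∈ freeComponent 𝒜 deg j, q f ∈ ℳ j) {p : ℤ → M →ₗ[k] M}
    (hp : ∀ j, ∀ m ∈ ℳ j, p j m = m) (hp' : ∀ i j, i ≠ j → ∀ m ∈ ℳ i, p j m = 0) (j : ℤ)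
    (f : ι →₀ A) : p j (q f) = q (freeProj 𝒜 deg j f) := by
  induction f using Finsupp.induction_linear with
  | zero => simp
  | add f g hf hg => simp only [map_add, hf, hg]
  | single b a =>
    induction a using homogeneous_induction 𝒜 with
    | zero => simp
    | add a c ha hc => simp only [Finsupp.single_add, map_add, ha, hc]
    | hom i a ha =>
      have hmem := hq (i + deg b) _ (single_mem_freeComponent (𝒜 := 𝒜) (deg := deg) (b := b)
        (a := a) (by rw [add_sub_cancel_right]; exact ha))
      rw [freeProj_single]
      by_cases h : (i : ℤ) = j - deg b
      · rw [← h, componentProj_of_mem (j := i) ha]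
        exact hp j _ (by rwa [h, sub_add_cancel] at hmem)
      · rw [componentProj_of_mem_ne h (i := i) ha, Finsupp.single_zero, map_zero]
        exact hp' _ _ (fun h' => h (by rw [← h', add_sub_cancel_right])) _ hmem

/-- A homogeneous element in the image of a graded map has a homogeneous preimage. -/
theorem exists_homogeneous_preimage [IsScalarTower k A M] {ι : Type w} {deg : ι → ℤ}
    {q : (ι →₀ A) →ₗ[A] M} (hℳ : HasProjections ℳ)
    (hq : ∀ j, ∀ f ∈ freeComponent 𝒜 deg j, q f ∈ ℳ j) {j : ℤ} {m : M}
    (hm : m ∈ ℳ j) {y : ι →₀ A} (hy : q y = m) :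
    freeProj 𝒜 deg j y ∈ freeComponent 𝒜 deg j ∧ q (freeProj 𝒜 deg j y) = m := by
  obtain ⟨p, hp, hp'⟩ := hℳ
  refine ⟨freeProj_mem deg j y, ?_⟩
  have := proj_map_eq (q := q.restrictScalars k) hq hp hp' j y
  rw [LinearMap.restrictScalars_apply, LinearMap.restrictScalars_apply, hy, hp j m hm] at this
  exact this.symm

/-- Graded maps out of a graded free module lift along graded maps. -/
theorem exists_graded_lift [IsScalarTower k A M] {ι : Type w} {ι' : Type w'} {deg : ι → ℤ}
    {deg' : ι' → ℤ} (hℳ : HasProjections ℳ) {q : (ι' →₀ A) →ₗ[A] M}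
    (hq : ∀ j, ∀ f ∈ freeComponent 𝒜 deg' j, q f ∈ ℳ j) {r : (ι →₀ A) →ₗ[A] M}
    (hr : ∀ j, ∀ f ∈ freeComponent 𝒜 deg j, r f ∈ ℳ j) (hqr : ∀ f, ∃ g, q g = r f) :
    ∃ φ : (ι →₀ A) →ₗ[A] (ι' →₀ A),
      (∀ j, ∀ f ∈ freeComponent 𝒜 deg j, φ f ∈ freeComponent 𝒜 deg' j) ∧
        ∀ f, q (φ f) = r f := by
  have h : ∀ b, ∃ g ∈ freeComponent 𝒜 deg' (deg b), q g = r (Finsupp.single b 1) := fun b => by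
    obtain ⟨g, hg⟩ := hqr (Finsupp.single b 1)
    exact ⟨_, exists_homogeneous_preimage hℳ hq (hr (deg b) _ (single_mem_freeComponent (by
      rw [sub_self]; exact SetLike.GradedOne.one_mem (A := 𝒜)))) hg⟩
  choose g hg hg' using h
  refine ⟨Finsupp.linearCombination A g, fun j f hf => ?_, fun f => ?_⟩
  · rw [Finsupp.linearCombination_apply]
    refine sum_mem fun b _ => ?_
    have := smul_mem_freeComponent (mem_freeComponent.1 hf b) (hg b)
    rwa [sub_add_cancel] at this
  · induction f using Finsupp.induction_linear with
    | zero => simp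
    | add f g hf hg => simp only [map_add, hf, hg]
    | single b a =>
      rw [Finsupp.linearCombination_single, map_smul, hg', ← map_smul, Finsupp.smul_single,
        smul_eq_mul, mul_one]

end Lift

variable (𝒜) in
/-- The map induced by an `A`-linear map after applying `k ⊗_A -`. -/
noncomputable def residueMap {N N' : Type*} [AddCommGroup N] [Module k N] [Module A N]
    [IsScalarTower k A N] [AddCommGroup N'] [Module k N'] [Module A N'] [IsScalarTower k A N']
    (L : N →ₗ[A] N') :
    (N ⧸ (maxIdeal 𝒜 • (⊤ : Submodule A N))) →ₗ[k] (N' ⧸ (maxIdeal 𝒜 • (⊤ : Submodule A N'))) :=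
  (Submodule.mapQ _ _ L (Submodule.map_le_iff_le_comap.mp (by
    rw [Submodule.map_smul'']
    exact Submodule.smul_mono le_rfl le_top))).restrictScalars k

namespace GradedFreeResolution

variable {M : Type x} [AddCommGroup M] [Module k M] [Module A M]
  {ℳ : ℤ → Submodule k M}

/-- The comparison theorem, built degree by degree; the recursion carries along that cycles go to
cycles, which is what makes the next lift possible. -/
theorem exists_isComparison [IsScalarTower k A M] (hℳ : HasProjections ℳ)
    (F : GradedFreeResolution.{u, v, x, w} 𝒜 ℳ)
    (G : GradedFreeResolution.{u, v, x, w'} 𝒜 ℳ) : ∃ φ, IsComparison F G φ := by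
  let C : ℕ → Type _ := fun n => {φ : (F.ι n →₀ A) →ₗ[A] (G.ι n →₀ A) //
    (∀ j, ∀ f ∈ freeComponent 𝒜 (F.deg n) j, φ f ∈ freeComponent 𝒜 (G.deg n) j) ∧
      ∀ f ∈ F.kernel n, φ f ∈ G.kernel n}
  obtain ⟨φ₀, h₀, h₀'⟩ := exists_graded_lift hℳ G.ε_mem F.ε_mem fun f => G.ε_surjective (F.ε f)
  have step : ∀ n (φ : C n), ∃ ψ : C (n + 1), ∀ f, G.d n (ψ.1 f) = φ.1 (F.d n f) := by
    rintro n ⟨φ, h, h'⟩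
    obtain ⟨ψ, hψ, hψ'⟩ := exists_graded_lift (hasProjections_freeComponent (G.deg n))
      (G.d_mem n) (r := φ ∘ₗ F.d n) (fun j f hf => h j _ (F.d_mem n j f hf))
      fun f => G.mem_kernel_iff.1 (h' _ (F.d_mem_kernel n f))
    refine ⟨⟨ψ, hψ, fun f hf => ?_⟩, hψ'⟩
    have hf : F.d n f = 0 := hf
    change G.d n (ψ f) = 0
    rw [hψ', LinearMap.comp_apply, hf, map_zero]
  choose S hS using step
  let Φ : ∀ n, C n := fun n => Nat.rec ⟨φ₀, h₀, fun f hf => by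
    change G.ε (φ₀ f) = 0
    rw [h₀']; exact hf⟩ S n
  exact ⟨fun n => (Φ n).1, fun n => (Φ n).2.1, fun n => hS n (Φ n), h₀'⟩

theorem IsComparison.residueMap_mem_cycles {F : GradedFreeResolution.{u, v, x, w} 𝒜 ℳ}
    {G : GradedFreeResolution.{u, v, x, w'} 𝒜 ℳ} {φ} (hφ : IsComparison F G φ) (n : ℕ) (j : ℤ) :
    ∀ y ∈ F.cycles n j, residueMap 𝒜 (φ n) y ∈ G.cycles n j := by
  have hcomp : ∀ n j, ∀ y ∈ F.residueComponent n j,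
      residueMap 𝒜 (φ n) y ∈ G.residueComponent n j := by
    rintro n j _ ⟨f, hf, rfl⟩
    exact ⟨φ n f, hφ.mem n j f hf, rfl⟩
  cases n with
  | zero => exact hcomp 0 j
  | succ n =>
    intro y hy
    refine ⟨hcomp (n + 1) j y hy.1, ?_⟩
    have hy' : F.residueD n y = 0 := hy.2
    obtain ⟨f, rfl⟩ := Submodule.Quotient.mk_surjective _ y
    change Submodule.Quotient.mk (G.d n (φ (n + 1) f)) = _
    rw [hφ.d_apply]
    exact (congrArg (residueMap 𝒜 (φ n)) hy').trans (map_zero _)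

theorem IsComparison.residueMap_mem_range {F : GradedFreeResolution.{u, v, x, w} 𝒜 ℳ}
    {G : GradedFreeResolution.{u, v, x, w'} 𝒜 ℳ} {φ} (hφ : IsComparison F G φ) (n : ℕ) :
    ∀ y ∈ LinearMap.range (F.residueD n),
      residueMap 𝒜 (φ n) y ∈ LinearMap.range (G.residueD n) := by
  rintro _ ⟨y, rfl⟩
  obtain ⟨f, rfl⟩ := Submodule.Quotient.mk_surjective _ y
  refine ⟨Submodule.Quotient.mk (φ (n + 1) f), ?_⟩
  exact congrArg Submodule.Quotient.mk (hφ.d_apply n f)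

theorem IsComparison.residueMap_sub_mem {F : GradedFreeResolution.{u, v, x, w} 𝒜 ℳ} {α}
    (hα : IsComparison F F α) (n : ℕ) (j : ℤ) :
    ∀ y ∈ F.cycles n j, residueMap 𝒜 (α n) y - y ∈ LinearMap.range (F.residueD n) := by
  obtain ⟨h, h₀, hs⟩ := hα.exists_homotopy
  intro y hy
  cases n with
  | zero =>
    obtain ⟨f, rfl⟩ := Submodule.Quotient.mk_surjective _ y
    exact ⟨Submodule.Quotient.mk (h 0 f), congrArg Submodule.Quotient.mk (h₀ f).symm⟩
  | succ n =>
    have hy' : F.residueD n y = 0 := hy.2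
    obtain ⟨f, rfl⟩ := Submodule.Quotient.mk_surjective _ y
    refine ⟨Submodule.Quotient.mk (h (n + 1) f), ?_⟩
    have h1 : (Submodule.Quotient.mk (h n (F.d n f)) : F.residue (n + 1)) = 0 :=
      (congrArg (residueMap 𝒜 (h n)) hy').trans (map_zero _)
    refine Eq.trans ?_ (congrArg Submodule.Quotient.mk (hs n f)).symm
    rw [Submodule.Quotient.mk_add, h1, add_zero]
    rfl

/-- The map induced on `Tor` by a comparison of resolutions. -/
noncomputable def torMap {F : GradedFreeResolution.{u, v, x, w} 𝒜 ℳ}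
    {G : GradedFreeResolution.{u, v, x, w'} 𝒜 ℳ} {φ} (hφ : IsComparison F G φ) (n : ℕ) (j : ℤ) :
    F.tor n j →ₗ[k] G.tor n j :=
  Submodule.mapQ _ _ ((residueMap 𝒜 (φ n)).restrict (hφ.residueMap_mem_cycles n j))
    fun y hy => hφ.residueMap_mem_range n y.1 hy

theorem torMap_torMap {F : GradedFreeResolution.{u, v, x, w} 𝒜 ℳ}
    {G : GradedFreeResolution.{u, v, x, w'} 𝒜 ℳ} {φ ψ} (hφ : IsComparison F G φ)
    (hψ : IsComparison G F ψ) (n : ℕ) (j : ℤ) (y : F.tor n j) :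
    torMap hψ n j (torMap hφ n j y) = y := by
  obtain ⟨⟨y, hy⟩, rfl⟩ := Submodule.Quotient.mk_surjective _ y
  refine (Submodule.Quotient.eq _).2 ?_
  obtain ⟨f, rfl⟩ := Submodule.Quotient.mk_surjective _ y
  exact (hφ.comp hψ).residueMap_sub_mem n j _ hy

/-- `Tor` does not depend on the resolution. -/
theorem nonempty_tor_equiv [IsScalarTower k A M] (hℳ : HasProjections ℳ)
    (F : GradedFreeResolution.{u, v, x, w} 𝒜 ℳ)
    (G : GradedFreeResolution.{u, v, x, w'} 𝒜 ℳ) (n : ℕ) (j : ℤ) :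
    Nonempty (F.tor n j ≃ₗ[k] G.tor n j) := by
  obtain ⟨φ, hφ⟩ := exists_isComparison hℳ F G
  obtain ⟨ψ, hψ⟩ := exists_isComparison hℳ G F
  exact ⟨LinearEquiv.ofLinearMap (torMap hφ n j) (torMap hψ n j)
    (LinearMap.ext (torMap_torMap hψ hφ n j)) (LinearMap.ext (torMap_torMap hφ hψ n j))⟩

end GradedFreeResolution

end GradedFree

/-! ### The first isomorphism theorem over the ground field. -/

section Quotient

variable {k : Type u} {A : Type v} [Field k] [Ring A] [Algebra k A]

/-- The first isomorphism theorem for the `k`-linear quotient by an `A`-submodule. -/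
noncomputable def quotientEquivOfSurjective {N : Type*} {N' : Type*} [AddCommGroup N] [Module k N]
    [Module A N] [IsScalarTower k A N] [AddCommGroup N'] [Module k N'] (L : Submodule A N)
    {g : N →ₗ[k] N'} (hg : LinearMap.ker g = L.restrictScalars k)
    (hg' : Function.Surjective g) : (N ⧸ L) ≃ₗ[k] N' :=
  LinearEquiv.ofBijective
    ((L.restrictScalars k).liftQ g hg.ge ∘ₗ
      (Submodule.Quotient.restrictScalarsEquiv k L).symm.toLinearMap)
    ⟨(injective_iff_map_eq_zero _).2 fun y => by
      obtain ⟨y, rfl⟩ := Submodule.Quotient.mk_surjective _ y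
      intro hy
      exact (Submodule.Quotient.mk_eq_zero _).2 (hg.le hy), fun z => by
      obtain ⟨y, rfl⟩ := hg' z
      exact ⟨Submodule.Quotient.mk y, rfl⟩⟩

end Quotient

/-! ### Minimal resolutions and Betti numbers. -/

section Minimal

variable {k : Type u} {A : Type v} [Field k] [Ring A] [Algebra k A]
  {𝒜 : ℕ → Submodule k A} [GradedAlgebra 𝒜]

theorem mem_maxIdeal_smul_top {ι : Type w} {f : ι →₀ A} :
    f ∈ maxIdeal 𝒜 • (⊤ : Submodule A (ι →₀ A)) ↔ ∀ b, f b ∈ maxIdeal 𝒜 := by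
  refine ⟨fun hf => ?_, fun hf => ?_⟩
  · refine Submodule.smul_induction_on hf (fun a ha g _ b => ?_) fun f g hf hg b => ?_
    · exact mul_mem_maxIdeal_left ha (g b)
    · exact add_mem (hf b) (hg b)
  · rw [← f.sum_single]
    refine sum_mem fun b _ => ?_
    rw [← mul_one (f b), ← smul_eq_mul, ← Finsupp.smul_single]
    exact Submodule.smul_mem_smul (hf b) trivial

theorem mem_maxIdeal_of_mem_component {j : ℤ} (hj : j ≠ 0) {a : A} (ha : a ∈ component 𝒜 j) :
    a ∈ maxIdeal 𝒜 := by
  rcases j with n | n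
  · exact mem_maxIdeal_of_mem (Nat.pos_of_ne_zero fun h => hj (by rw [h]; rfl)) ha
  · rw [(Submodule.mem_bot k).1 (show a ∈ (⊥ : Submodule k A) from ha)]
    exact zero_mem _

/-- The degree zero parts of the coordinates of an element of a free module. -/
noncomputable def residueCoord (𝒜 : ℕ → Submodule k A) [GradedAlgebra 𝒜] (ι : Type w) :
    (ι →₀ A) →ₗ[k] (ι →₀ 𝒜 0) :=
  Finsupp.mapRange.linearMap ((GradedAlgebra.proj 𝒜 0).codRestrict (𝒜 0) (proj_mem 𝒜 0))

theorem ker_residueCoord (ι : Type w) : LinearMap.ker (residueCoord 𝒜 ι) =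
    (maxIdeal 𝒜 • (⊤ : Submodule A (ι →₀ A))).restrictScalars k := by
  ext f
  rw [Submodule.restrictScalars_mem, mem_maxIdeal_smul_top, LinearMap.mem_ker, Finsupp.ext_iff]
  refine forall_congr' fun b => ?_
  rw [mem_maxIdeal, Finsupp.zero_apply, ← Submodule.coe_eq_zero]
  rfl

theorem residueCoord_surjective (ι : Type w) : Function.Surjective (residueCoord 𝒜 ι) :=
  Finsupp.mapRange_surjective _ (map_zero _) fun y => ⟨y, Subtype.ext (proj_of_mem y.2)⟩

/-- `k ⊗_A F` for a free module `F`. -/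
noncomputable def residueEquiv (𝒜 : ℕ → Submodule k A) [GradedAlgebra 𝒜] (ι : Type w) :
    ((ι →₀ A) ⧸ (maxIdeal 𝒜 • (⊤ : Submodule A (ι →₀ A)))) ≃ₗ[k] (ι →₀ 𝒜 0) :=
  quotientEquivOfSurjective (N' := ι →₀ 𝒜 0) (g := residueCoord 𝒜 ι)
    (maxIdeal 𝒜 • (⊤ : Submodule A (ι →₀ A))) (ker_residueCoord ι) (residueCoord_surjective ι)

theorem finite_residue (hA : IsStandardGraded 𝒜) (ι : Type w) [Finite ι] :
    Module.Finite k ((ι →₀ A) ⧸ (maxIdeal 𝒜 • (⊤ : Submodule A (ι →₀ A)))) := by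
  have := hA.finite 0
  exact Module.Finite.equiv (residueEquiv 𝒜 ι).symm

theorem finrank_residue (hA : IsStandardGraded 𝒜) (ι : Type w) [Fintype ι] :
    Module.finrank k ((ι →₀ A) ⧸ (maxIdeal 𝒜 • (⊤ : Submodule A (ι →₀ A)))) =
      Fintype.card ι := by
  have := hA.finite 0
  let e : 𝒜 0 ≃ₗ[k] k := LinearEquiv.ofFinrankEq _ _ (by
    rw [finrank_degree_zero hA, Module.finrank_self])
  rw [((residueEquiv 𝒜 ι).trans (Finsupp.mapRange.linearEquiv e)).finrank_eq,
    Module.finrank_finsupp_self]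

namespace GradedFreeResolution

variable {M : Type x} [AddCommGroup M] [Module k M] [Module A M] {ℳ : ℤ → Submodule k M}

/-- A resolution whose differentials raise the degrees of generators is minimal. -/
theorem isMinimal_of_deg_ne (F : GradedFreeResolution.{u, v, x, w} 𝒜 ℳ)
    (h : ∀ n b b', F.deg (n + 1) b ≠ F.deg n b') : F.IsMinimal := by
  rintro n _ ⟨f, rfl⟩
  induction f using Finsupp.induction_linear with
  | zero => simp
  | add f g hf hg => rw [map_add]; exact add_mem hf hg
  | single b a =>
    rw [← mul_one a, ← smul_eq_mul, ← Finsupp.smul_single, map_smul]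
    refine Submodule.smul_mem _ _ (mem_maxIdeal_smul_top.2 fun b' => ?_)
    have h1 := F.d_mem n (F.deg (n + 1) b) (Finsupp.single b 1) (single_mem_freeComponent (by
      rw [sub_self]; exact SetLike.GradedOne.one_mem (A := 𝒜)))
    exact mem_maxIdeal_of_mem_component (sub_ne_zero.2 (h n b b')) (mem_freeComponent.1 h1 b')

theorem IsLinear.isMinimal {F : GradedFreeResolution.{u, v, x, w} 𝒜 ℳ} {a : ℤ}
    (h : F.IsLinear a) : F.IsMinimal :=
  F.isMinimal_of_deg_ne fun n b b' => by rw [h, h]; push_cast; linarith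

theorem IsMinimal.residueD_eq_zero {F : GradedFreeResolution.{u, v, x, w} 𝒜 ℳ}
    (h : F.IsMinimal) (n : ℕ) : F.residueD n = 0 := by
  refine LinearMap.ext fun y => ?_
  obtain ⟨f, rfl⟩ := Submodule.Quotient.mk_surjective _ y
  exact (Submodule.Quotient.mk_eq_zero _).2 (h n ⟨f, rfl⟩)

theorem IsMinimal.cycles_eq {F : GradedFreeResolution.{u, v, x, w} 𝒜 ℳ}
    (h : F.IsMinimal) (n : ℕ) (j : ℤ) : F.cycles n j = F.residueComponent n j := by
  cases n with
  | zero => rfl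
  | succ n =>
    change _ ⊓ LinearMap.ker (F.residueD n) = _
    rw [h.residueD_eq_zero, LinearMap.ker_zero, inf_top_eq]

/-- `Tor` computed from a minimal resolution. -/
noncomputable def IsMinimal.torEquiv {F : GradedFreeResolution.{u, v, x, w} 𝒜 ℳ}
    (h : F.IsMinimal) (n : ℕ) (j : ℤ) : F.tor n j ≃ₗ[k] F.residueComponent n j :=
  Submodule.quotEquivOfEqBot _ (by
    rw [h.residueD_eq_zero, LinearMap.range_zero, Submodule.comap_bot, Submodule.ker_subtype])
    ≪≫ₗ LinearEquiv.ofEq _ _ (h.cycles_eq n j)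

theorem residueComponent_eq_top {F : GradedFreeResolution.{u, v, x, w} 𝒜 ℳ} {n : ℕ} {c : ℤ}
    (h : ∀ b, F.deg n b = c) : F.residueComponent n c = ⊤ := by
  refine eq_top_iff.2 fun y _ => ?_
  obtain ⟨f, rfl⟩ := Submodule.Quotient.mk_surjective _ y
  refine ⟨freeProj 𝒜 (F.deg n) c f, freeProj_mem _ _ _, ?_⟩
  refine (Submodule.Quotient.eq _).2 (mem_maxIdeal_smul_top.2 fun b => ?_)
  rw [Finsupp.sub_apply, freeProj_apply, h b, sub_self, mem_maxIdeal, map_sub]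
  exact sub_eq_zero.2 (proj_of_mem (proj_mem 𝒜 0 (f b)))

theorem residueComponent_eq_bot {F : GradedFreeResolution.{u, v, x, w} 𝒜 ℳ} {n : ℕ} {j : ℤ}
    (h : ∀ b, F.deg n b ≠ j) : F.residueComponent n j = ⊥ := by
  refine (Submodule.eq_bot_iff _).2 ?_
  rintro _ ⟨f, hf, rfl⟩
  refine (Submodule.Quotient.mk_eq_zero _).2 (mem_maxIdeal_smul_top.2 fun b => ?_)
  exact mem_maxIdeal_of_mem_component (sub_ne_zero.2 (h b).symm) (mem_freeComponent.1 hf b)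

theorem IsMinimal.finite_tor (hA : IsStandardGraded 𝒜)
    {F : GradedFreeResolution.{u, v, x, w} 𝒜 ℳ} (h : F.IsMinimal) (n : ℕ) [Finite (F.ι n)]
    (j : ℤ) : Module.Finite k (F.tor n j) := by
  have : Module.Finite k (F.residue n) := finite_residue hA (F.ι n)
  have := isNoetherian_of_isNoetherianRing_of_finite k (F.residue n)
  have : Module.Finite k (F.residueComponent n j) := Module.Finite.of_injective
    (F.residueComponent n j).subtype Subtype.val_injective
  exact Module.Finite.equiv (h.torEquiv n j).symm

/-- Minimality kills the differential of `k ⊗ F`, so `Tor_n` is `F_n / 𝔪 F_n`, which has one basis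
vector per generator and is concentrated in the common degree `c`. -/
theorem IsMinimal.betti_eq (hA : IsStandardGraded 𝒜)
    {F : GradedFreeResolution.{u, v, x, w} 𝒜 ℳ} (h : F.IsMinimal) {n : ℕ} [Fintype (F.ι n)]
    {c : ℤ} (hc : ∀ b, F.deg n b = c) (j : ℤ) :
    F.betti n j = if j = c then Fintype.card (F.ι n) else 0 := by
  rw [betti, (h.torEquiv n j).finrank_eq]
  split_ifs with hj
  · rw [hj, residueComponent_eq_top hc, finrank_top, finrank_residue hA]
  · rw [residueComponent_eq_bot fun b hb => hj (hb.symm.trans (hc b)), finrank_bot]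

/-- In a minimal resolution the degrees of generators are detected by `Tor`. -/
theorem IsMinimal.betti_deg_ne_zero (hA : IsStandardGraded 𝒜)
    {F : GradedFreeResolution.{u, v, x, w} 𝒜 ℳ} (h : F.IsMinimal) {n : ℕ} (b : F.ι n)
    [Module.Finite k (F.tor n (F.deg n b))] : F.betti n (F.deg n b) ≠ 0 := by
  have hA' := hA.nontrivial
  have h1 : (1 : A) ∈ 𝒜 0 := SetLike.GradedOne.one_mem
  have hmem : (Submodule.Quotient.mk (Finsupp.single b 1) : F.residue n) ∈
      F.residueComponent n (F.deg n b) :=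
    ⟨Finsupp.single b 1, single_mem_freeComponent (by rw [sub_self]; exact h1), rfl⟩
  have hne : (Submodule.Quotient.mk (Finsupp.single b 1) : F.residue n) ≠ 0 := by
    rw [Ne, Submodule.Quotient.mk_eq_zero, mem_maxIdeal_smul_top]
    intro hb
    have := hb b
    rw [Finsupp.single_eq_same, mem_maxIdeal, proj_of_mem h1] at this
    exact one_ne_zero this
  have : Module.Finite k (F.residueComponent n (F.deg n b)) :=
    Module.Finite.equiv (h.torEquiv n _)
  rw [betti, (h.torEquiv n _).finrank_eq]
  have : Nontrivial (F.residueComponent n (F.deg n b)) :=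
    ⟨⟨⟨_, hmem⟩, 0, fun h0 => hne (congrArg Subtype.val h0)⟩⟩
  exact Module.finrank_pos.ne'

end GradedFreeResolution

end Minimal

/-! ### From a linearly related presentation to a linear free resolution. -/

section Build

variable {k : Type u} {A : Type v} [Field k] [Ring A] [Algebra k A]

/-- The identification of `A ⊗ U` with a free module, given a basis of `U`. -/
noncomputable def freeEquiv {ι : Type w} {U : Type x} [AddCommGroup U] [Module k U]
    (b : Module.Basis ι k U) : (ι →₀ A) ≃ₗ[A] A ⊗[k] U :=
  (Algebra.TensorProduct.basis A b).repr.symm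

theorem freeEquiv_single {ι : Type w} {U : Type x} [AddCommGroup U] [Module k U]
    (b : Module.Basis ι k U) (i : ι) (a : A) :
    freeEquiv b (Finsupp.single i a) = a ⊗ₜ b i := by
  rw [freeEquiv, Algebra.TensorProduct.basis_repr_symm_apply, Module.Basis.repr_symm_single_one]

variable {𝒜 : ℕ → Submodule k A}

/-- A map out of a graded free module is graded if it is so on generators. -/
theorem map_freeComponent_mem {ι : Type w} {deg : ι → ℤ} {M : Type x} [AddCommGroup M]
    [Module k M] [Module A M] {ℳ : ℤ → Submodule k M} (q : (ι →₀ A) →ₗ[A] M)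
    (hsmul : ∀ i j, ∀ a ∈ component 𝒜 i, ∀ m ∈ ℳ j, a • m ∈ ℳ (i + j))
    (hq : ∀ i, q (Finsupp.single i 1) ∈ ℳ (deg i)) (j : ℤ) :
    ∀ f ∈ freeComponent 𝒜 deg j, q f ∈ ℳ j := by
  intro f hf
  rw [← f.sum_single, Finsupp.sum, map_sum]
  refine sum_mem fun i _ => ?_
  rw [← mul_one (f i), ← smul_eq_mul, ← Finsupp.smul_single, map_smul]
  have := hsmul _ _ (f i) (mem_freeComponent.1 hf i) _ (hq i)
  rwa [sub_add_cancel] at this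

variable [GradedAlgebra 𝒜]

theorem degProj_freeEquiv {ι : Type w} {U : Type x} [AddCommGroup U] [Module k U]
    (b : Module.Basis ι k U) {deg : ι → ℤ} {c : ℤ} (hdeg : ∀ i, deg i = c) (j : ℕ) (f : ι →₀ A) :
    degProj 𝒜 U j (freeEquiv b f) = freeEquiv b (freeProj 𝒜 deg (j + c) f) := by
  induction f using Finsupp.induction_linear with
  | zero => simp
  | add f g hf hg => simp only [map_add, hf, hg]
  | single i a =>
    rw [freeProj_single, freeEquiv_single, freeEquiv_single, hdeg, add_sub_cancel_right]
    rfl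

theorem freeEquiv_symm_mem {ι : Type w} {U : Type x} [AddCommGroup U] [Module k U]
    (b : Module.Basis ι k U) {deg : ι → ℤ} {c : ℤ} (hdeg : ∀ i, deg i = c) {j : ℕ} {y : A ⊗[k] U}
    (hy : degProj 𝒜 U j y = y) : (freeEquiv b).symm y ∈ freeComponent 𝒜 deg (j + c) := by
  obtain ⟨f, rfl⟩ := (freeEquiv b).surjective y
  rw [degProj_freeEquiv b hdeg] at hy
  rw [LinearEquiv.symm_apply_apply, ← (freeEquiv b).injective hy]
  exact freeProj_mem _ _ _

namespace Presentation

/-- The iterated syzygies of a presentation. -/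
noncomputable def iterSyzygy (𝒜 : ℕ → Submodule k A) [GradedAlgebra 𝒜] (P : Presentation k A) :
    ℕ → Presentation k A
  | 0 => P
  | n + 1 => (iterSyzygy 𝒜 P n).syzygy 𝒜

theorem iterSyzygy_eq (P : Presentation k A) (n : ℕ) :
    P.iterSyzygy 𝒜 n = (syzygy 𝒜)^[n] P := by
  induction n with
  | zero => rfl
  | succ n ih => rw [Function.iterate_succ_apply', ← ih]; rfl

variable (P : Presentation k A)

/-- A basis of the generators of the `n`-th syzygy. -/
noncomputable def syzygyBasis [h : ∀ n, Module.Finite k (P.iterSyzygy 𝒜 n).U] (n : ℕ) :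
    Module.Basis (ULift.{w} (Fin (Module.finrank k (P.iterSyzygy 𝒜 n).U))) k
      (P.iterSyzygy 𝒜 n).U :=
  (Module.finBasis k (P.iterSyzygy 𝒜 n).U).reindex Equiv.ulift.symm

/-- The differential between the free modules covering consecutive syzygies. -/
noncomputable def iterEvalMap (n : ℕ) :
    A ⊗[k] (P.iterSyzygy 𝒜 (n + 1)).U →ₗ[A] A ⊗[k] (P.iterSyzygy 𝒜 n).U :=
  (P.iterSyzygy 𝒜 n).evalMap 𝒜

theorem mem_iterSyzygy_rel {n : ℕ} {y : A ⊗[k] (P.iterSyzygy 𝒜 (n + 1)).U} :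
    y ∈ (P.iterSyzygy 𝒜 (n + 1)).rel ↔ P.iterEvalMap n y = 0 := Iff.rfl

theorem degProj_iterEvalMap (n : ℕ) (y : (P.iterSyzygy 𝒜 (n + 1)).U) :
    degProj 𝒜 _ 1 (P.iterEvalMap n (1 ⊗ₜ y)) = P.iterEvalMap n (1 ⊗ₜ y) := by
  have h : P.iterEvalMap n (1 ⊗ₜ y) = (P.iterSyzygy 𝒜 n).incl 𝒜 y :=
    (evalMap_tmul 𝒜 _ _ _).trans (one_smul A _)
  rw [h]
  exact degProj_incl 𝒜 _ _

variable {P} in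
theorem HasLinearResolution.mem_rel_iff (hP : P.HasLinearResolution 𝒜) (n : ℕ)
    (y : A ⊗[k] (P.iterSyzygy 𝒜 n).U) :
    y ∈ (P.iterSyzygy 𝒜 n).rel ↔ ∃ z, P.iterEvalMap n z = y := by
  have h := (hP n).range_evalMap
  rw [← iterSyzygy_eq] at h
  rw [← h]
  rfl

/-- The linear resolution of the module presented by `P`, all of whose syzygies are linearly
related. -/
noncomputable def resolution [∀ n, Module.Finite k (P.iterSyzygy 𝒜 n).U]
    (hP : P.HasLinearResolution 𝒜) {M : Type x} [AddCommGroup M] [Module k M] [Module A M]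
    {ℳ : ℤ → Submodule k M} (c : ℤ) (ε : A ⊗[k] (P.iterSyzygy 𝒜 0).U →ₗ[A] M)
    (hε : Function.Surjective ε) (hker : ∀ y, ε y = 0 ↔ y ∈ (P.iterSyzygy 𝒜 0).rel)
    (hsmul : ∀ i j, ∀ a ∈ component 𝒜 i, ∀ m ∈ ℳ j, a • m ∈ ℳ (i + j))
    (hgen : ∀ y, ε (1 ⊗ₜ y) ∈ ℳ c) : GradedFreeResolution.{u, v, x, w} 𝒜 ℳ where
  ι n := ULift.{w} (Fin (Module.finrank k (P.iterSyzygy 𝒜 n).U))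
  deg n _ := n + c
  d n := (freeEquiv (P.syzygyBasis n)).symm.toLinearMap ∘ₗ P.iterEvalMap n ∘ₗ
    (freeEquiv (P.syzygyBasis (n + 1))).toLinearMap
  ε := ε ∘ₗ (freeEquiv (P.syzygyBasis 0)).toLinearMap
  d_mem n := map_freeComponent_mem _ (fun i j a ha m hm => smul_mem_freeComponent ha hm) fun i => by
    have h : (((n + 1 : ℕ) : ℤ) + c) = ((1 : ℕ) : ℤ) + (n + c) := by push_cast; ring
    rw [h]
    refine freeEquiv_symm_mem (P.syzygyBasis n) (fun _ => rfl) ?_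
    rw [LinearMap.comp_apply, LinearEquiv.coe_coe, freeEquiv_single, degProj_iterEvalMap]
  ε_mem := map_freeComponent_mem _ hsmul fun i => by
    rw [LinearMap.comp_apply, LinearEquiv.coe_coe, freeEquiv_single, Nat.cast_zero, zero_add]
    exact hgen _
  ε_surjective := hε.comp (freeEquiv _).surjective
  exact_zero := fun f => by
    simp only [LinearMap.comp_apply, LinearEquiv.coe_coe]
    rw [hker, hP.mem_rel_iff]
    constructor
    · rintro ⟨y, hy⟩
      obtain ⟨g, rfl⟩ := (freeEquiv (P.syzygyBasis (0 + 1))).surjective y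
      exact ⟨g, (LinearEquiv.symm_apply_eq _).2 hy⟩
    · rintro ⟨g, hg⟩
      exact ⟨_, (LinearEquiv.symm_apply_eq _).1 hg⟩
  exact_succ n := fun f => by
    simp only [LinearMap.comp_apply, LinearEquiv.coe_coe]
    rw [LinearEquiv.map_eq_zero_iff, ← mem_iterSyzygy_rel, hP.mem_rel_iff]
    constructor
    · rintro ⟨y, hy⟩
      obtain ⟨g, rfl⟩ := (freeEquiv (P.syzygyBasis (n + 1 + 1))).surjective y
      exact ⟨g, (LinearEquiv.symm_apply_eq _).2 hy⟩
    · rintro ⟨g, hg⟩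
      exact ⟨_, (LinearEquiv.symm_apply_eq _).1 hg⟩

end Presentation

end Build

/-! ### Resolving `A ⧸ I` from a resolution of `I`. -/

section Splice

variable {k : Type u} {A : Type v} [Field k] [Ring A] [Algebra k A]
  {𝒜 : ℕ → Submodule k A} [GradedAlgebra 𝒜] {I : Ideal A}

namespace GradedFreeResolution

/-- The generators of the resolution of `A ⧸ I` obtained from one of `I`. -/
def spliceIndex (G : GradedFreeResolution.{u, v, v, w} 𝒜 (idealGrading 𝒜 I)) : ℕ → Type w
  | 0 => PUnit
  | n + 1 => G.ι n

/-- The degrees of the generators of the resolution of `A ⧸ I` obtained from one of `I`. -/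
def spliceDeg (G : GradedFreeResolution.{u, v, v, w} 𝒜 (idealGrading 𝒜 I)) :
    ∀ n, G.spliceIndex n → ℤ
  | 0 => fun _ => 0
  | n + 1 => G.deg n

/-- The differential of the resolution of `A ⧸ I` obtained from one of `I`. -/
noncomputable def spliceD (G : GradedFreeResolution.{u, v, v, w} 𝒜 (idealGrading 𝒜 I)) :
    ∀ n, (G.spliceIndex (n + 1) →₀ A) →ₗ[A] (G.spliceIndex n →₀ A)
  | 0 => (Finsupp.lsingle PUnit.unit : A →ₗ[A] (PUnit →₀ A)) ∘ₗ I.subtype ∘ₗ G.ε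
  | n + 1 => G.d n

/-- The resolution of `A ⧸ I` obtained from a resolution of `I`. -/
noncomputable def splice (G : GradedFreeResolution.{u, v, v, w} 𝒜 (idealGrading 𝒜 I)) :
    GradedFreeResolution.{u, v, v, w} 𝒜 (quotientGrading 𝒜 I) where
  ι := G.spliceIndex
  deg := G.spliceDeg
  d := G.spliceD
  ε := I.mkQ ∘ₗ (Finsupp.lapply PUnit.unit : (PUnit →₀ A) →ₗ[A] A)
  d_mem n j f hf := by
    cases n with
    | zero =>
      refine single_mem_freeComponent (b := PUnit.unit) (deg := fun _ => 0) ?_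
      rw [sub_zero]
      exact G.ε_mem j f hf
    | succ n => exact G.d_mem n j f hf
  ε_mem j f hf := by
    refine ⟨f PUnit.unit, ?_, rfl⟩
    have := mem_freeComponent.1 hf PUnit.unit
    change f PUnit.unit ∈ component 𝒜 (j - 0) at this
    rwa [sub_zero] at this
  ε_surjective := I.mkQ_surjective.comp fun a => ⟨Finsupp.single PUnit.unit a,
    Finsupp.single_eq_same⟩
  exact_zero := fun f => by
    change I.mkQ (f PUnit.unit) = 0 ↔ _
    rw [Submodule.mkQ_apply, Submodule.Quotient.mk_eq_zero]
    constructor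
    · intro hf
      obtain ⟨g, hg⟩ := G.ε_surjective ⟨f PUnit.unit, hf⟩
      refine ⟨g, Finsupp.ext fun _ => ?_⟩
      exact Finsupp.single_eq_same.trans (congrArg Subtype.val hg)
    · rintro ⟨g, rfl⟩
      have : G.spliceD 0 g PUnit.unit = (G.ε g : A) := Finsupp.single_eq_same
      rw [this]
      exact (G.ε g).2
  exact_succ n := by
    cases n with
    | zero =>
      intro f
      refine Iff.trans ?_ (G.exact_zero f)
      change Finsupp.single PUnit.unit (G.ε f : A) = 0 ↔ _
      rw [Finsupp.single_eq_zero, Submodule.coe_eq_zero]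
    | succ n => exact G.exact_succ n

end GradedFreeResolution

theorem hasProjections_idealGrading (hI : ∀ y ∈ I, ∀ i, GradedAlgebra.proj 𝒜 i y ∈ I) :
    HasProjections (idealGrading 𝒜 I) := by
  have hI' : ∀ j, ∀ y ∈ I.restrictScalars k, componentProj 𝒜 j y ∈ I.restrictScalars k := by
    rintro (j | j) y hy
    · exact hI y hy j
    · exact zero_mem _
  refine ⟨fun j => (componentProj 𝒜 j).restrict (hI' j), fun j m hm => Subtype.ext ?_,
    fun i j hij m hm => Subtype.ext ?_⟩
  · exact componentProj_of_mem hm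
  · exact componentProj_of_mem_ne hij hm

theorem hasProjections_quotientGrading (hI : ∀ y ∈ I, ∀ i, GradedAlgebra.proj 𝒜 i y ∈ I) :
    HasProjections (quotientGrading 𝒜 I) := by
  have hI' : ∀ j, I.restrictScalars k ≤ (I.restrictScalars k).comap (componentProj 𝒜 j) := by
    rintro (j | j) y hy
    · exact hI y hy j
    · exact zero_mem (I.restrictScalars k)
  let e := Submodule.Quotient.restrictScalarsEquiv k I
  have he : ∀ j (a : A), (e.toLinearMap ∘ₗ Submodule.mapQ _ _ (componentProj 𝒜 j) (hI' j) ∘ₗ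
      e.symm.toLinearMap) (Submodule.Quotient.mk a) =
      Submodule.Quotient.mk (componentProj 𝒜 j a) := fun j a => rfl
  refine ⟨fun j => e.toLinearMap ∘ₗ Submodule.mapQ _ _ (componentProj 𝒜 j) (hI' j) ∘ₗ
    e.symm.toLinearMap, ?_, ?_⟩
  · rintro j _ ⟨a, ha, rfl⟩
    exact (he j a).trans (by rw [componentProj_of_mem ha]; rfl)
  · rintro i j hij _ ⟨a, ha, rfl⟩
    exact (he j a).trans (by rw [componentProj_of_mem_ne hij ha]; rfl)

end Splice

/-! ### A linear resolution forces the iterated syzygies to be linearly related. -/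

section Koszul

variable {k : Type u} {A : Type v} [Field k] [Ring A] [Algebra k A]
  {𝒜 : ℕ → Submodule k A}

variable (k A) in
/-- The inclusion `U → A ⊗ U` for `U` free on `ι`. -/
noncomputable def unitMap (ι : Type w) : (ι →₀ k) →ₗ[k] (ι →₀ A) :=
  Finsupp.mapRange.linearMap (Algebra.linearMap k A)

theorem unitMap_injective [Nontrivial A] (ι : Type w) : Function.Injective (unitMap k A ι) :=
  Finsupp.mapRange_injective _ (map_zero _) (FaithfulSMul.algebraMap_injective k A)

theorem freeComponent_eq_range_unitMap [GradedAlgebra 𝒜] (hA : IsStandardGraded 𝒜)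
    {ι : Type w} {deg : ι → ℤ} {j : ℤ} (hdeg : ∀ b, deg b = j) (f : ι →₀ A) :
    f ∈ freeComponent 𝒜 deg j ↔ ∃ c, unitMap k A ι c = f := by
  have h : ∀ a : A, a ∈ component 𝒜 0 ↔ ∃ c : k, algebraMap k A c = a := fun a => by
    change a ∈ 𝒜 0 ↔ _
    rw [hA.zero_eq_one, Submodule.mem_one]
  simp only [mem_freeComponent, hdeg, sub_self]
  constructor
  · intro hf
    induction f using Finsupp.induction with
    | zero => exact ⟨0, map_zero _⟩
    | single_add b a f hb ha ih =>
      have hf' : ∀ c, f c ∈ component 𝒜 0 := fun c => by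
        classical
        by_cases hc : c = b
        · rw [hc, Finsupp.notMem_support_iff.1 hb]; exact zero_mem _
        · have := hf c
          rwa [Finsupp.add_apply, Finsupp.single_eq_of_ne hc, zero_add] at this
      obtain ⟨c, rfl⟩ := ih hf'
      have hb' := hf b
      rw [Finsupp.add_apply, Finsupp.notMem_support_iff.1 hb, add_zero,
        Finsupp.single_eq_same] at hb'
      obtain ⟨r, rfl⟩ := (h a).1 hb'
      exact ⟨Finsupp.single b r + c, by rw [map_add]; simp [unitMap]⟩
  · rintro ⟨c, rfl⟩ b
    exact (h _).2 ⟨c b, rfl⟩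

theorem freeComponent_eq_zero {ι : Type w} {deg : ι → ℤ} {j : ℤ} (hdeg : ∀ b, j < deg b)
    {f : ι →₀ A} (hf : f ∈ freeComponent 𝒜 deg j) : f = 0 := by
  ext b
  have h := mem_freeComponent.1 hf b
  obtain ⟨n, hn⟩ := Int.eq_negSucc_of_lt_zero (sub_neg.2 (hdeg b))
  rw [hn] at h
  exact (Submodule.mem_bot k).1 h

variable [GradedAlgebra 𝒜] {M : Type x} [AddCommGroup M] [Module k M] [Module A M]
  {ℳ : ℤ → Submodule k M}

namespace GradedFreeResolution

/-- `P` presents the `n`-th syzygy of the resolution `F`. -/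
def IsPresentedBy (F : GradedFreeResolution.{u, v, x, w} 𝒜 ℳ) (P : Presentation k A) (n : ℕ) :
    Prop :=
  ∃ b : Module.Basis (F.ι n) k P.U, ∀ f, freeEquiv b f ∈ P.rel ↔ f ∈ F.kernel n

variable {F : GradedFreeResolution.{u, v, x, w} 𝒜 ℳ}

theorem exists_kernel_preimage {n : ℕ} {j : ℤ} {f : F.ι n →₀ A}
    (hf : f ∈ freeComponent 𝒜 (F.deg n) j) (hf' : f ∈ F.kernel n) :
    ∃ g ∈ freeComponent 𝒜 (F.deg (n + 1)) j, F.d n g = f := by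
  obtain ⟨g, hg⟩ := F.mem_kernel_iff.1 hf'
  exact ⟨_, exists_homogeneous_preimage (hasProjections_freeComponent _) (F.d_mem n) hf hg⟩

/-- Such a cycle is the image of an element of the same degree in `F_(n+1)`, whose generators live
one degree higher. -/
theorem eq_zero_of_mem_kernel {a : ℤ} (hF : F.IsLinear a) {n : ℕ} {f : F.ι n →₀ A}
    (hf : f ∈ freeComponent 𝒜 (F.deg n) (n + a)) (hf' : f ∈ F.kernel n) : f = 0 := by
  obtain ⟨g, hg, rfl⟩ := exists_kernel_preimage hf hf'
  rw [freeComponent_eq_zero (fun b => by rw [hF]; push_cast; linarith) hg, map_zero]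

/-- In its lowest degree `n + 1 + a`, the module `F_(n+1)` is the `k`-span of its basis. There `d`
is injective by `eq_zero_of_mem_kernel`, and by exactness its image consists of all cycles of that
degree, that is, of the linear relations of `P`. The standard basis is transported along this
isomorphism. -/
theorem IsPresentedBy.exists_basis (hA : IsStandardGraded 𝒜) {a : ℤ} (hF : F.IsLinear a) {n : ℕ}
    {P : Presentation k A} {b : Module.Basis (F.ι n) k P.U}
    (hb : ∀ f, freeEquiv b f ∈ P.rel ↔ f ∈ F.kernel n) :
    ∃ b' : Module.Basis (F.ι (n + 1)) k (P.syzygy 𝒜).U,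
      ∀ f, P.evalMap 𝒜 (freeEquiv b' f) = freeEquiv b (F.d n f) := by
  have := hA.nontrivial
  have hdeg : ∀ n b, F.deg n b = (n : ℤ) + a := fun n b => hF n b
  have hone : ((n + 1 : ℕ) : ℤ) + a = ((1 : ℕ) : ℤ) + (n + a) := by push_cast; ring
  have hex : ∀ i, ∃ y, P.incl 𝒜 y = freeEquiv b (F.d n (Finsupp.single i 1)) := by
    intro i
    refine P.exists_incl_eq 𝒜 ((hb _).2 (F.d_mem_kernel n _)) ?_
    rw [degProj_freeEquiv b (hdeg n), ← hone]
    have h1 := F.d_mem n (F.deg (n + 1) i) (Finsupp.single i 1) (single_mem_freeComponent (by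
      rw [sub_self]; exact SetLike.GradedOne.one_mem (A := 𝒜)))
    rw [hdeg] at h1
    congr 1
    ext c
    rw [freeProj_apply, componentProj_of_mem (mem_freeComponent.1 h1 c)]
  choose γ hγ using hex
  let κ : (F.ι (n + 1) →₀ k) →ₗ[k] (P.syzygy 𝒜).U := Finsupp.linearCombination k γ
  have hκ : ∀ c, P.incl 𝒜 (κ c) = freeEquiv b (F.d n (unitMap k A _ c)) := by
    intro c
    induction c using Finsupp.induction_linear with
    | zero => simp
    | add c c' hc hc' => simp only [map_add, hc, hc']
    | single i r =>
      have h1 : κ (Finsupp.single i r) = r • γ i := Finsupp.linearCombination_single _ _ _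
      have h2 : unitMap k A _ (Finsupp.single i r) = algebraMap k A r • Finsupp.single i 1 := by
        simp [unitMap, Algebra.algebraMap_eq_smul_one]
      rw [h1, map_smul, hγ, h2, map_smul, map_smul, algebraMap_smul]
  have hinj : Function.Injective κ := by
    refine (injective_iff_map_eq_zero κ).2 fun c hc => ?_
    have h0 : F.d n (unitMap k A _ c) = 0 := (freeEquiv b).map_eq_zero_iff.1 (by
      rw [← hκ, hc, map_zero])
    have := eq_zero_of_mem_kernel hF (n := n + 1)
      ((freeComponent_eq_range_unitMap hA (hdeg (n + 1)) _).2 ⟨c, rfl⟩) h0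
    exact unitMap_injective _ (this.trans (map_zero _).symm)
  have hsurj : Function.Surjective κ := by
    intro y
    obtain ⟨f, hf⟩ := (freeEquiv b).surjective (P.incl 𝒜 y)
    have hfk : f ∈ F.kernel n := (hb f).1 (hf ▸ P.incl_mem_rel 𝒜 y)
    have hfd : f ∈ freeComponent 𝒜 (F.deg n) ((n + 1 : ℕ) + a) := by
      have := P.degProj_incl 𝒜 y
      rw [← hf, degProj_freeEquiv b (hdeg n), ← hone] at this
      rw [← (freeEquiv b).injective this]
      exact freeProj_mem _ _ _
    obtain ⟨g, hg, rfl⟩ := exists_kernel_preimage hfd hfk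
    obtain ⟨c, rfl⟩ := (freeComponent_eq_range_unitMap hA (hdeg (n + 1)) g).1 hg
    exact ⟨c, P.incl_injective 𝒜 ((hκ c).trans hf)⟩
  let e := LinearEquiv.ofBijective κ ⟨hinj, hsurj⟩
  refine ⟨Module.Basis.ofRepr e.symm, fun f => ?_⟩
  have he : ∀ i, (Module.Basis.ofRepr e.symm) i = γ i := fun i => by
    rw [Module.Basis.coe_ofRepr, LinearEquiv.symm_symm]
    exact (Finsupp.linearCombination_single k (1 : k) i).trans (one_smul k _)
  induction f using Finsupp.induction_linear with
  | zero => simp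
  | add f g hf hg => simp only [map_add, hf, hg]
  | single i r =>
    rw [freeEquiv_single, Presentation.evalMap_tmul, he, hγ, ← map_smul, ← map_smul,
      Finsupp.smul_single, smul_eq_mul, mul_one]

theorem IsPresentedBy.syzygy (hA : IsStandardGraded 𝒜) {a : ℤ} (hF : F.IsLinear a) {n : ℕ}
    {P : Presentation k A} (h : F.IsPresentedBy P n) : F.IsPresentedBy (P.syzygy 𝒜) (n + 1) := by
  obtain ⟨b, hb⟩ := h
  obtain ⟨b', hb'⟩ := exists_basis hA hF hb
  refine ⟨b', fun f => ?_⟩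
  rw [Presentation.mem_syzygy_rel, hb', LinearEquiv.map_eq_zero_iff]
  rfl

variable [IsScalarTower k A M]

theorem freeProj_mem_kernel (hℳ : HasProjections ℳ) {n : ℕ} (j : ℤ) {f : F.ι n →₀ A}
    (hf : f ∈ F.kernel n) : freeProj 𝒜 (F.deg n) j f ∈ F.kernel n := by
  cases n with
  | zero =>
    obtain ⟨p, hp, hp'⟩ := hℳ
    have hf : F.ε f = 0 := hf
    have := proj_map_eq (q := F.ε.restrictScalars k) F.ε_mem hp hp' j f
    rw [LinearMap.restrictScalars_apply, hf, map_zero] at this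
    exact this.symm
  | succ n =>
    obtain ⟨p, hp, hp'⟩ := hasProjections_freeComponent (𝒜 := 𝒜) (F.deg n)
    have hf : F.d n f = 0 := hf
    have := proj_map_eq (q := (F.d n).restrictScalars k) (F.d_mem n) hp hp' j f
    rw [LinearMap.restrictScalars_apply, hf, map_zero] at this
    exact this.symm

theorem IsPresentedBy.degProj_mem {a : ℤ} (hF : F.IsLinear a) (hℳ : HasProjections ℳ) {n : ℕ}
    {P : Presentation k A} (h : F.IsPresentedBy P n) :
    ∀ y ∈ P.rel, degProj 𝒜 P.U 1 y ∈ P.rel := by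
  obtain ⟨b, hb⟩ := h
  intro y hy
  obtain ⟨f, rfl⟩ := (freeEquiv b).surjective y
  rw [degProj_freeEquiv b (hF n), hb]
  exact freeProj_mem_kernel hℳ _ ((hb f).1 hy)

theorem IsPresentedBy.isLinearlyRelated (hA : IsStandardGraded 𝒜) {a : ℤ} (hF : F.IsLinear a)
    (hℳ : HasProjections ℳ) {n : ℕ} {P : Presentation k A} (h : F.IsPresentedBy P n) :
    P.IsLinearlyRelated 𝒜 := by
  refine .of_exists (fun y hy => ?_) (h.degProj_mem hF hℳ)
  obtain ⟨b, hb⟩ := h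
  obtain ⟨b', hb'⟩ := exists_basis hA hF hb
  obtain ⟨f, rfl⟩ := (freeEquiv b).surjective y
  obtain ⟨g, rfl⟩ := F.mem_kernel_iff.1 ((hb f).1 hy)
  exact ⟨_, hb' g⟩

theorem IsPresentedBy.hasLinearResolution (hA : IsStandardGraded 𝒜) {a : ℤ} (hF : F.IsLinear a)
    (hℳ : HasProjections ℳ) {n : ℕ} {P : Presentation k A} (h : F.IsPresentedBy P n) :
    P.HasLinearResolution 𝒜 := fun m => by
  induction m generalizing P n with
  | zero => exact h.isLinearlyRelated hA hF hℳ
  | succ m ih => exact ih (h.syzygy hA hF)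

end GradedFreeResolution

theorem proj_mem_maxIdeal {y : A} (hy : y ∈ maxIdeal 𝒜) (i : ℕ) :
    GradedAlgebra.proj 𝒜 i y ∈ maxIdeal 𝒜 := by
  rcases Nat.eq_zero_or_pos i with rfl | hi
  · rw [mem_maxIdeal.1 hy]; exact zero_mem _
  · exact mem_maxIdeal_of_mem hi (proj_mem 𝒜 i y)

theorem mulMap_zero_injective (hA : IsStandardGraded 𝒜) : Function.Injective (mulMap 𝒜 0) := by
  rw [← LinearMap.ker_eq_bot]
  exact powerPresentation_zero_rel hA

/-- The same argument for the augmentation: in degree zero `F₀` is the `k`-span of its basis, and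
`ε` maps it isomorphically onto the degree zero part of `A/𝔪`, a copy of `A₀`. -/
theorem isPresentedBy_residue (hA : IsStandardGraded 𝒜)
    {F : GradedFreeResolution.{u, v, v, w} 𝒜 (quotientGrading 𝒜 (maxIdeal 𝒜))}
    (hF : F.IsLinear 0) : F.IsPresentedBy (residuePresentation 𝒜 0) 0 := by
  have := hA.nontrivial
  have hdeg : ∀ b, F.deg 0 b = 0 := fun b => by rw [hF]; simp
  have hℳ := hasProjections_quotientGrading (𝒜 := 𝒜) (I := maxIdeal 𝒜)
    fun y hy i => proj_mem_maxIdeal hy i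
  have hex : ∀ i, ∃ y : 𝒜 0, (Submodule.Quotient.mk (y : A) : A ⧸ maxIdeal 𝒜) =
      F.ε (Finsupp.single i 1) := by
    intro i
    obtain ⟨a, ha, ha'⟩ := F.ε_mem 0 (Finsupp.single i 1) (single_mem_freeComponent (by
      rw [hdeg, sub_self]; exact SetLike.GradedOne.one_mem (A := 𝒜)))
    exact ⟨⟨a, ha⟩, ha'⟩
  choose γ hγ using hex
  let κ : (F.ι 0 →₀ k) →ₗ[k] 𝒜 0 := Finsupp.linearCombination k γ
  have hκ : ∀ c, (Submodule.Quotient.mk (κ c : A) : A ⧸ maxIdeal 𝒜) =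
      F.ε (unitMap k A _ c) := by
    intro c
    induction c using Finsupp.induction_linear with
    | zero => simp; exact (map_zero F.ε).symm
    | add c c' hc hc' =>
      simp only [map_add, ← hc, ← hc', Submodule.coe_add, Submodule.Quotient.mk_add]
    | single i r =>
      have h1 : κ (Finsupp.single i r) = r • γ i := Finsupp.linearCombination_single _ _ _
      have h2 : unitMap k A _ (Finsupp.single i r) = algebraMap k A r • Finsupp.single i 1 := by
        simp [unitMap, Algebra.algebraMap_eq_smul_one]
      rw [h1, h2, map_smul, ← hγ, algebraMap_smul]
      rfl
  have hmk : ∀ y : 𝒜 0, (Submodule.Quotient.mk (y : A) : A ⧸ maxIdeal 𝒜) = 0 → y = 0 := by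
    intro y hy
    rw [Submodule.Quotient.mk_eq_zero, mem_maxIdeal, proj_of_mem y.2] at hy
    exact Subtype.ext hy
  have hinj : Function.Injective κ := by
    refine (injective_iff_map_eq_zero κ).2 fun c hc => ?_
    have h0 : F.ε (unitMap k A _ c) = 0 := by rw [← hκ, hc]; rfl
    have := GradedFreeResolution.eq_zero_of_mem_kernel hF (n := 0)
      ((freeComponent_eq_range_unitMap hA (by simpa using hdeg) _).2 ⟨c, rfl⟩) h0
    exact unitMap_injective _ (this.trans (map_zero _).symm)
  have hsurj : Function.Surjective κ := by
    intro y
    obtain ⟨f, hf⟩ := F.ε_surjective (Submodule.Quotient.mk (y : A))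
    obtain ⟨hg, hg'⟩ := exists_homogeneous_preimage hℳ F.ε_mem (j := 0) ⟨(y : A), y.2, rfl⟩ hf
    obtain ⟨c, hc⟩ := (freeComponent_eq_range_unitMap hA hdeg _).1 hg
    refine ⟨c, sub_eq_zero.1 (hmk _ ?_)⟩
    rw [Submodule.coe_sub, Submodule.Quotient.mk_sub, hκ, hc, hg']
    exact sub_self _
  let e := LinearEquiv.ofBijective κ ⟨hinj, hsurj⟩
  let b : Module.Basis (F.ι 0) k (𝒜 0) := Module.Basis.ofRepr e.symm
  have he : ∀ i, b i = γ i := fun i => by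
    rw [Module.Basis.coe_ofRepr, LinearEquiv.symm_symm]
    exact (Finsupp.linearCombination_single k (1 : k) i).trans (one_smul k _)
  have hb : ∀ f, (Submodule.Quotient.mk (mulMap 𝒜 0 (freeEquiv b f)) : A ⧸ maxIdeal 𝒜) =
      F.ε f := by
    intro f
    induction f using Finsupp.induction_linear with
    | zero => simp; exact (map_zero F.ε).symm
    | add f g hf hg => simp only [map_add, Submodule.Quotient.mk_add, hf, hg]
    | single i r =>
      rw [freeEquiv_single, mulMap_tmul, he, ← smul_eq_mul, Submodule.Quotient.mk_smul, hγ,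
        ← map_smul, Finsupp.smul_single, smul_eq_mul, mul_one]
  refine ⟨b, fun f => ?_⟩
  change degProj 𝒜 (𝒜 0) 0 (freeEquiv b f) = 0 ↔ F.ε f = 0
  rw [← hb, Submodule.Quotient.mk_eq_zero, mem_maxIdeal, ← mulMap_degProj 0 0,
    map_eq_zero_iff _ (mulMap_zero_injective hA)]

theorem IsKoszul.hasLinearResolution (hA : IsStandardGraded 𝒜) (hK : IsKoszul.{u, v, w} 𝒜) :
    (residuePresentation 𝒜 0).HasLinearResolution 𝒜 := by
  obtain ⟨F, hF⟩ := hK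
  exact (isPresentedBy_residue hA hF).hasLinearResolution hA hF
    (hasProjections_quotientGrading fun y hy i => proj_mem_maxIdeal hy i)

end Koszul

/-! ### The quadratic dual algebra as the graded dual of a system of contractions. -/

section QuadraticDual

variable {k : Type u} {A : Type v} [Field k] [Ring A] [Algebra k A]
  {𝒜 : ℕ → Submodule k A} {I : Type} [Fintype I]

/-- A functional vanishing on the kernel of `f` factors through `f`. -/
theorem exists_dual_factor {N : Type w} {N' : Type w'} [AddCommMonoid N] [Module k N]
    [AddCommGroup N'] [Module k N'] (f : N →ₗ[k] N') (θ : Module.Dual k N)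
    (h : ∀ y, f y = 0 → θ y = 0) : ∃ ψ : Module.Dual k N', ∀ y, ψ (f y) = θ y := by
  let := Module.addCommMonoidToAddCommGroup k (M := N)
  have hθ : θ ∈ (LinearMap.ker f).dualAnnihilator := (Submodule.mem_dualAnnihilator _).2 h
  rw [← LinearMap.range_dualMap_eq_dualAnnihilator_ker] at hθ
  obtain ⟨ψ, hψ⟩ := hθ
  exact ⟨ψ, LinearMap.congr_fun hψ⟩

/-- The image in `A^!` of a linear form on `A₁`. -/
noncomputable def dualGen (𝒜 : ℕ → Submodule k A) : Module.Dual k (𝒜 1) →ₗ[k] QuadraticDual 𝒜 :=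
  (RingQuot.mkAlgHom k (DualRel 𝒜)).toLinearMap ∘ₗ TensorAlgebra.ι k

theorem dualGen_mul_mem (f : Module.Dual k (𝒜 1)) {n : ℕ} {y : QuadraticDual 𝒜}
    (hy : y ∈ dualComponent 𝒜 n) : dualGen 𝒜 f * y ∈ dualComponent 𝒜 (n + 1) := by
  obtain ⟨t, ht, rfl⟩ := hy
  refine ⟨TensorAlgebra.ι k f * t, ?_, map_mul (RingQuot.mkAlgHom k (DualRel 𝒜)) _ _⟩
  have : TensorAlgebra.ι k f * t ∈ LinearMap.range (TensorAlgebra.ι k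
      (M := Module.Dual k (𝒜 1))) ^ (n + 1) := by
    rw [pow_succ']
    exact Submodule.mul_mem_mul ⟨f, rfl⟩ ht
  exact this

theorem dualComponent_zero_induction {y : QuadraticDual 𝒜} (hy : y ∈ dualComponent 𝒜 0) :
    ∃ c : k, y = algebraMap k _ c := by
  obtain ⟨t, ht, rfl⟩ := hy
  have ht : t ∈ (LinearMap.range (TensorAlgebra.ι k (M := Module.Dual k (𝒜 1)))) ^ 0 := ht
  rw [pow_zero, Submodule.mem_one] at ht
  obtain ⟨c, rfl⟩ := ht
  exact ⟨c, AlgHom.commutes _ c⟩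

theorem dualComponent_succ_induction {n : ℕ} {p : QuadraticDual 𝒜 → Prop}
    (mul : ∀ f, ∀ y ∈ dualComponent 𝒜 n, p (dualGen 𝒜 f * y))
    (add : ∀ y z, p y → p z → p (y + z)) {y : QuadraticDual 𝒜}
    (hy : y ∈ dualComponent 𝒜 (n + 1)) : p y := by
  obtain ⟨t, ht, rfl⟩ := hy
  have ht : t ∈ (LinearMap.range (TensorAlgebra.ι k (M := Module.Dual k (𝒜 1)))) ^ (n + 1) := ht
  rw [pow_succ'] at ht
  refine Submodule.mul_induction_on ht ?_ fun s t hs ht => ?_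
  · rintro _ ⟨f, rfl⟩ t ht
    have := mul f _ ⟨t, ht, rfl⟩
    rwa [dualGen, LinearMap.comp_apply, AlgHom.toLinearMap_apply, AlgHom.toLinearMap_apply,
      ← map_mul] at this
  · rw [map_add]; exact add _ _ hs ht

/-- As a functional on `V ⊗ V`, the tensor `∑ ψ(v_i v_l) v_i^* ⊗ v_l^*` is `ψ` after multiplication.
It therefore kills `Q₂`, and is a defining relation of `A^!`. -/
theorem sum_dualGen_mul_dualGen (v : Module.Basis I k (𝒜 1)) (ψ : Module.Dual k A) :
    ∑ i, ∑ l, ψ (v i * v l) • (dualGen 𝒜 (v.coord i) * dualGen 𝒜 (v.coord l)) = 0 := by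
  set φ : Module.Dual k (𝒜 1) ⊗[k] Module.Dual k (𝒜 1) :=
    ∑ i, ∑ l, ψ (v i * v l) • (v.coord i ⊗ₜ[k] v.coord l) with hφ
  have hdist : TensorProduct.dualDistrib k (𝒜 1) (𝒜 1) φ =
      ψ ∘ₗ LinearMap.mul' k A ∘ₗ TensorProduct.map (𝒜 1).subtype (𝒜 1).subtype := by
    classical
    refine (v.tensorProduct v).ext fun ⟨i, l⟩ => ?_
    simp [hφ, Finsupp.single_apply, LinearMap.sum_apply]
  have hmem : φ ∈ dualRelations 𝒜 := by
    rw [dualRelations, Submodule.mem_comap, Submodule.mem_dualAnnihilator]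
    intro w hw
    rw [hdist]
    exact (congrArg ψ hw).trans (map_zero ψ)
  have h0 : RingQuot.mkAlgHom k (DualRel 𝒜) (toTensorAlgebra 𝒜 φ) = 0 := by
    rw [RingQuot.mkAlgHom_rel k (s := DualRel 𝒜) ⟨⟨φ, hmem, rfl⟩, rfl⟩, map_zero]
  rw [← h0, hφ]
  simp [toTensorAlgebra, dualGen]

/-- Finite-dimensional spaces `U n` with contractions `U (n + 1) → U n` by linear forms on `A₁`,
which embed `U (n + 2)` in `A₁ ⊗ U (n + 1)` as the kernel of the map to `A₂ ⊗ U n`. -/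
structure ContractionSystem (𝒜 : ℕ → Submodule k A) (v : Module.Basis I k (𝒜 1)) where
  U : ℕ → Type v
  [addCommGroup : ∀ n, AddCommGroup (U n)]
  [module : ∀ n, Module k (U n)]
  [finite : ∀ n, Module.Finite k (U n)]
  δ : ∀ n, I → U (n + 1) →ₗ[k] U n
  eq_zero : ∀ n (y : U (n + 1)), (∀ i, δ n i y = 0) → y = 0
  exists_zero : ∀ y : I → U 0, ∃ z, ∀ i, δ 0 i z = y i
  exists_succ : ∀ n (y : I → U (n + 1)),
    ∑ i, ∑ l, ((v i : A) * (v l : A)) ⊗ₜ[k] δ n l (y i) = 0 ↔ ∃ z, ∀ i, δ (n + 1) i z = y i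
  finrank_zero : Module.finrank k (U 0) = 1

namespace ContractionSystem

attribute [instance] addCommGroup module finite

variable {v : Module.Basis I k (𝒜 1)} (S : ContractionSystem 𝒜 v)

/-- The functional on `U (n + 1)` obtained from a family of functionals on `U n`. -/
noncomputable def codual (n : ℕ) : (I → Module.Dual k (S.U n)) →ₗ[k] Module.Dual k (S.U (n + 1)) :=
  ∑ i, (S.δ n i).dualMap ∘ₗ LinearMap.proj i

theorem codual_apply (n : ℕ) (t : I → Module.Dual k (S.U n)) (y : S.U (n + 1)) :
    S.codual n t y = ∑ i, t i (S.δ n i y) := by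
  simp [codual, LinearMap.sum_apply]

theorem codual_surjective (n : ℕ) : Function.Surjective (S.codual n) := by
  classical
  intro t
  have hinj : Function.Injective (LinearMap.pi (S.δ n)) :=
    (injective_iff_map_eq_zero _).2 fun y hy => S.eq_zero n y fun i => congrFun hy i
  obtain ⟨s, hs⟩ := LinearMap.dualMap_surjective_of_injective hinj t
  refine ⟨fun i => s ∘ₗ LinearMap.single k (fun _ => S.U n) i, LinearMap.ext fun y => ?_⟩
  rw [codual_apply, ← hs, LinearMap.dualMap_apply]
  simp only [LinearMap.comp_apply, LinearMap.coe_single]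
  rw [← map_sum, Finset.univ_sum_single (fun i => S.δ n i y)]
  rfl

/-- The candidate for the map `U (n + 1)^* → A^!` on families of functionals. -/
noncomputable def genSum {n : ℕ} (g : Module.Dual k (S.U n) →ₗ[k] QuadraticDual 𝒜) :
    (I → Module.Dual k (S.U n)) →ₗ[k] QuadraticDual 𝒜 :=
  ∑ i, LinearMap.mulLeft k (dualGen 𝒜 (v.coord i)) ∘ₗ g ∘ₗ LinearMap.proj i

theorem genSum_apply {n : ℕ} (g : Module.Dual k (S.U n) →ₗ[k] QuadraticDual 𝒜)
    (t : I → Module.Dual k (S.U n)) :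
    S.genSum g t = ∑ i, dualGen 𝒜 (v.coord i) * g (t i) := by
  simp [genSum, LinearMap.sum_apply]

theorem exists_factor {n : ℕ} {g : Module.Dual k (S.U n) →ₗ[k] QuadraticDual 𝒜}
    (hg : ∀ t, S.codual n t = 0 → S.genSum g t = 0) :
    ∃ g' : Module.Dual k (S.U (n + 1)) →ₗ[k] QuadraticDual 𝒜,
      ∀ t, g' (S.codual n t) = S.genSum g t := by
  obtain ⟨s, hs⟩ := (S.codual n).exists_rightInverse_of_surjective
    (LinearMap.range_eq_top.2 (S.codual_surjective n))
  refine ⟨S.genSum g ∘ₗ s, fun t => ?_⟩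
  rw [LinearMap.comp_apply, ← sub_eq_zero, ← map_sub]
  refine hg _ ?_
  rw [map_sub, ← LinearMap.comp_apply, hs, LinearMap.id_apply, sub_self]

/-- The hypothesis says that the functional defined by `t` on `A₁ ⊗ U_(n+1)` vanishes on `U_(n+2)`,
the kernel of the map to `A₂ ⊗ U_n`. It thus factors through `A ⊗ U_n`, and expanding along a basis
of `U_n` gives functionals `ψ s` on `A`. -/
theorem exists_expansion {n : ℕ} {t : I → Module.Dual k (S.U (n + 1))}
    (ht : S.codual (n + 1) t = 0) :
    ∃ (m : ℕ) (ψ : Fin m → Module.Dual k A) (e : Fin m → Module.Dual k (S.U n)),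
      ∀ i, t i = ∑ s, S.codual n fun l => ψ s (v i * v l) • e s := by
  classical
  let D : (I → S.U (n + 1)) →ₗ[k] A ⊗[k] S.U n :=
    ∑ i, ∑ l, TensorProduct.mk k A (S.U n) (v i * v l) ∘ₗ S.δ n l ∘ₗ LinearMap.proj i
  have hD : ∀ y, D y = ∑ i, ∑ l, ((v i : A) * (v l : A)) ⊗ₜ[k] S.δ n l (y i) := fun y => by
    simp [D, LinearMap.sum_apply]
  let τ : Module.Dual k (I → S.U (n + 1)) := ∑ i, t i ∘ₗ LinearMap.proj i
  obtain ⟨ρ, hρ⟩ := exists_dual_factor D τ fun y hy => by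
    rw [hD, S.exists_succ] at hy
    obtain ⟨z, hz⟩ := hy
    have := LinearMap.congr_fun ht z
    rw [codual_apply] at this
    simpa [τ, LinearMap.sum_apply, hz] using this
  let e := Module.finBasis k (S.U n)
  refine ⟨_, fun s => ρ ∘ₗ (TensorProduct.mk k A (S.U n)).flip (e s), fun s => e.coord s,
    fun i => LinearMap.ext fun y => ?_⟩
  have h1 : t i y = τ (Pi.single i y) := by
    simp [τ, LinearMap.sum_apply, Pi.single_apply, apply_ite]
  rw [h1, ← hρ, hD]
  have h2 : ∑ j, ∑ l, ((v j : A) * (v l : A)) ⊗ₜ[k] S.δ n l ((Pi.single i y : I → _) j) =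
      ∑ l, ((v i : A) * (v l : A)) ⊗ₜ[k] S.δ n l y := by
    rw [Finset.sum_eq_single i]
    · simp
    · intro j _ hj
      simp [Pi.single_eq_of_ne hj]
    · simp
  rw [h2, map_sum, LinearMap.sum_apply]
  simp only [codual_apply, LinearMap.smul_apply, LinearMap.comp_apply, LinearMap.flip_apply,
    TensorProduct.mk_apply, Module.Basis.coord_apply, smul_eq_mul]
  rw [Finset.sum_comm]
  refine Finset.sum_congr rfl fun l _ => ?_
  conv_lhs => rw [← e.sum_repr (S.δ n l y), TensorProduct.tmul_sum, map_sum]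
  refine Finset.sum_congr rfl fun s _ => ?_
  rw [TensorProduct.tmul_smul, map_smul, smul_eq_mul, mul_comm]

/-- The inductive step for the map `U_n^* → A^!`. By `exists_expansion`, the obstruction to
continuing is a sum of quadratic relations `∑ ψ(v_i v_l) v_i^* v_l^*` times elements `g (e s)`,
hence zero in `A^!`. -/
theorem exists_next {n : ℕ} {g : Module.Dual k (S.U n) →ₗ[k] QuadraticDual 𝒜}
    (hg : ∀ t, S.codual n t = 0 → S.genSum g t = 0) :
    ∃ g' : Module.Dual k (S.U (n + 1)) →ₗ[k] QuadraticDual 𝒜,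
      (∀ t, S.codual (n + 1) t = 0 → S.genSum g' t = 0) ∧
        ∀ t, g' (S.codual n t) = S.genSum g t := by
  obtain ⟨g', hg'⟩ := S.exists_factor hg
  refine ⟨g', fun t ht => ?_, hg'⟩
  obtain ⟨m, ψ, e, hte⟩ := S.exists_expansion ht
  have h1 : ∀ i, g' (t i) =
      ∑ s, ∑ l, ψ s (v i * v l) • (dualGen 𝒜 (v.coord l) * g (e s)) := fun i => by
    rw [hte, map_sum]
    refine Finset.sum_congr rfl fun s _ => ?_
    rw [hg', genSum_apply]
    exact Finset.sum_congr rfl fun l _ => by rw [map_smul, mul_smul_comm]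
  have h2 : S.genSum g' t = ∑ s, (∑ i, ∑ l, ψ s (v i * v l) •
      (dualGen 𝒜 (v.coord i) * dualGen 𝒜 (v.coord l))) * g (e s) := by
    rw [genSum_apply]
    simp only [h1, Finset.mul_sum, Finset.sum_mul]
    rw [Finset.sum_comm]
    refine Finset.sum_congr rfl fun s _ => Finset.sum_congr rfl fun i _ =>
      Finset.sum_congr rfl fun l _ => ?_
    rw [mul_smul_comm, smul_mul_assoc, mul_assoc]
  rw [h2]
  exact Finset.sum_eq_zero fun s _ => by rw [sum_dualGen_mul_dualGen, zero_mul]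

theorem exists_dual_map (t₀ : Module.Dual k (S.U 0)) (ht₀ : t₀ ≠ 0) :
    ∃ g : ∀ n, Module.Dual k (S.U n) →ₗ[k] QuadraticDual 𝒜,
      g 0 t₀ = 1 ∧ ∀ n t, g (n + 1) (S.codual n t) = S.genSum (g n) t := by
  classical
  let C : ℕ → Type _ := fun n => {g : Module.Dual k (S.U n) →ₗ[k] QuadraticDual 𝒜 //
    ∀ t, S.codual n t = 0 → S.genSum g t = 0}
  obtain ⟨f₀, hf₀⟩ : ∃ f : Module.Dual k (Module.Dual k (S.U 0)), f t₀ = 1 :=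
    Module.Projective.exists_dual_eq_one k ht₀
  have step : ∀ n (g : C n), ∃ g' : C (n + 1), ∀ t, g'.1 (S.codual n t) = S.genSum g.1 t := by
    rintro n ⟨g, hg⟩
    obtain ⟨g', hg', h⟩ := S.exists_next hg
    exact ⟨⟨g', hg'⟩, h⟩
  choose T hT using step
  let g₀ : C 0 := ⟨LinearMap.toSpanSingleton k _ 1 ∘ₗ f₀, fun t ht => by
    -- The obstruction is absent at the start: `U₁` is all of `A₁ ⊗ U₀`, so `codual 0` is injective.
    have : t = 0 := by
      refine funext fun i => LinearMap.ext fun y => ?_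
      obtain ⟨z, hz⟩ := S.exists_zero (Pi.single i y)
      have := LinearMap.congr_fun ht z
      rw [codual_apply] at this
      simpa [hz, Pi.single_apply, apply_ite] using this
    rw [this, map_zero]⟩
  let G : ∀ n, C n := fun n => Nat.rec g₀ T n
  refine ⟨fun n => (G n).1, ?_, fun n => hT n (G n)⟩
  change f₀ t₀ • (1 : QuadraticDual 𝒜) = 1
  rw [hf₀, one_smul]

/-- The product of the duals of the `U n`, on which `A^!` acts. -/
abbrev DualProd : Type _ := ∀ n, Module.Dual k (S.U n)

/-- The action of a linear form on `A₁` on the product of the duals. -/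
noncomputable def act : Module.Dual k (𝒜 1) →ₗ[k] Module.End k S.DualProd where
  toFun f :=
    { toFun := fun t n => match n with
        | 0 => 0
        | n + 1 => S.codual n fun i => f (v i) • t n
      map_add' := fun s t => funext fun n => by
        cases n with
        | zero => exact (add_zero _).symm
        | succ n =>
          refine LinearMap.ext fun y => ?_
          simp [codual_apply, Finset.sum_add_distrib]
      map_smul' := fun c t => funext fun n => by
        cases n with
        | zero => exact (smul_zero (A := Module.Dual k (S.U 0)) c).symm
        | succ n =>
          refine LinearMap.ext fun y => ?_
          simp [codual_apply, Finset.mul_sum, mul_left_comm] }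
  map_add' f g := LinearMap.ext fun t => funext fun n => by
    cases n with
    | zero => exact (add_zero _).symm
    | succ n =>
      refine LinearMap.ext fun y => ?_
      simp [codual_apply, add_mul, Finset.sum_add_distrib]
  map_smul' c f := LinearMap.ext fun t => funext fun n => by
    cases n with
    | zero => exact (smul_zero (A := Module.Dual k (S.U 0)) c).symm
    | succ n =>
      refine LinearMap.ext fun y => ?_
      simp [codual_apply, Finset.mul_sum, mul_assoc]

theorem act_zero (f : Module.Dual k (𝒜 1)) (t : S.DualProd) : S.act f t 0 = 0 := rfl

theorem act_succ (f : Module.Dual k (𝒜 1)) (t : S.DualProd) (n : ℕ) :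
    S.act f t (n + 1) = S.codual n fun i => f (v i) • t n := rfl

theorem act_act (f g : Module.Dual k (𝒜 1)) (t : S.DualProd) (n : ℕ) (y : S.U (n + 2)) :
    S.act f (S.act g t) (n + 2) y =
      ∑ i, ∑ l, (f (v i) * g (v l)) * t n (S.δ n l (S.δ (n + 1) i y)) := by
  rw [act_succ, codual_apply]
  refine Finset.sum_congr rfl fun i _ => ?_
  rw [LinearMap.smul_apply, act_succ, codual_apply, smul_eq_mul, Finset.mul_sum]
  exact Finset.sum_congr rfl fun l _ => by rw [LinearMap.smul_apply, smul_eq_mul, mul_assoc]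

theorem lift_act_toTensorAlgebra (φ : Module.Dual k (𝒜 1) ⊗[k] Module.Dual k (𝒜 1))
    (t : S.DualProd) :
    (TensorAlgebra.lift k S.act (toTensorAlgebra 𝒜 φ) t 0 = 0) ∧
    (TensorAlgebra.lift k S.act (toTensorAlgebra 𝒜 φ) t 1 = 0) ∧
    ∀ n y, TensorAlgebra.lift k S.act (toTensorAlgebra 𝒜 φ) t (n + 2) y =
      ∑ i, ∑ l, TensorProduct.dualDistrib k (𝒜 1) (𝒜 1) φ (v i ⊗ₜ v l) *
        t n (S.δ n l (S.δ (n + 1) i y)) := by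
  induction φ using TensorProduct.induction_on with
  | zero => simp
  | tmul f g =>
    have h : TensorAlgebra.lift k S.act (toTensorAlgebra 𝒜 (f ⊗ₜ g)) t = S.act f (S.act g t) := by
      simp [toTensorAlgebra]
    rw [h]
    refine ⟨rfl, ?_, fun n y => ?_⟩
    · rw [act_succ]
      refine LinearMap.ext fun y => ?_
      simp [codual_apply, act_zero]
    · rw [act_act]
      simp
  | add φ χ hφ hχ =>
    refine ⟨?_, ?_, fun n y => ?_⟩
    · simp [hφ.1, hχ.1]
    · simp [hφ.2.1, hχ.2.1]
    · simp [hφ.2.2, hχ.2.2, add_mul, Finset.sum_add_distrib]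

/-- An element orthogonal to `Q₂` is a functional `ψ` on `A` composed with multiplication. Its
action on `t` is then `ψ ⊗ t n` applied to `∑ v_i v_l ⊗ δ_l δ_i y`, which is zero because `y` lies
in `U_(n+2)`. -/
theorem lift_act_eq_zero {φ : Module.Dual k (𝒜 1) ⊗[k] Module.Dual k (𝒜 1)}
    (hφ : φ ∈ dualRelations 𝒜) : TensorAlgebra.lift k S.act (toTensorAlgebra 𝒜 φ) = 0 := by
  obtain ⟨ψ, hψ⟩ := exists_dual_factor
    (LinearMap.mul' k A ∘ₗ TensorProduct.map (𝒜 1).subtype (𝒜 1).subtype)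
    (TensorProduct.dualDistrib k (𝒜 1) (𝒜 1) φ)
    fun y hy => (Submodule.mem_dualAnnihilator _).1 (Submodule.mem_comap.1 hφ) y hy
  refine LinearMap.ext fun t => funext fun n => ?_
  obtain ⟨h0, h1, h2⟩ := S.lift_act_toTensorAlgebra φ t
  match n with
  | 0 => exact h0
  | 1 => exact h1
  | n + 2 =>
    refine LinearMap.ext fun y => ?_
    simp only [h2, ← hψ]
    have hy := (S.exists_succ n fun i => S.δ (n + 1) i y).2 ⟨y, fun _ => rfl⟩
    have := congrArg (LinearMap.mul' k k ∘ₗ TensorProduct.map ψ (t n)) hy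
    simpa using this

/-- The action of `A^!` on the product of the duals. -/
noncomputable def dualAction : QuadraticDual 𝒜 →ₐ[k] Module.End k S.DualProd :=
  RingQuot.liftAlgHom k ⟨TensorAlgebra.lift k S.act, fun {s t} h => by
    obtain ⟨⟨φ, hφ, rfl⟩, rfl⟩ := h
    rw [S.lift_act_eq_zero hφ, map_zero]⟩

theorem dualAction_dualGen (f : Module.Dual k (𝒜 1)) : S.dualAction (dualGen 𝒜 f) = S.act f := by
  rw [dualAction, dualGen, LinearMap.comp_apply, AlgHom.toLinearMap_apply,
    RingQuot.liftAlgHom_mkAlgHom_apply, TensorAlgebra.lift_ι_apply]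

/-- The graded pieces of `A^!` are dual to the spaces `U n`. -/
theorem finrank_dualComponent (n : ℕ) :
    Module.finrank k (dualComponent 𝒜 n) = Module.finrank k (S.U n) := by
  classical
  have hfin : Module.finrank k (Module.Dual k (S.U 0)) = 1 := by
    rw [Subspace.dual_finrank_eq, S.finrank_zero]
  obtain ⟨t₀, ht₀, hspan⟩ := finrank_eq_one_iff'.1 hfin
  obtain ⟨g, hg0, hg⟩ := S.exists_dual_map t₀ ht₀
  -- The vector `e₀` plays the role of the unit of `A^!`: acting on it and reading off the component
  -- `n` inverts `g n` on the degree `n` part, as `hleft` and `hright` verify.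
  let e₀ : S.DualProd := Pi.single 0 t₀
  have hmem : ∀ n t, g n t ∈ dualComponent 𝒜 n := by
    intro n
    induction n with
    | zero =>
      intro t
      obtain ⟨c, rfl⟩ := hspan t
      rw [map_smul, hg0]
      refine Submodule.smul_mem _ _ ⟨1, ?_, map_one (RingQuot.mkAlgHom k (DualRel 𝒜))⟩
      exact Submodule.one_le.1 (pow_zero (LinearMap.range (TensorAlgebra.ι k
        (M := Module.Dual k (𝒜 1)))) ▸ le_rfl)
    | succ n ih =>
      intro t
      obtain ⟨t, rfl⟩ := S.codual_surjective n t
      rw [hg, genSum_apply]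
      exact sum_mem fun i _ => dualGen_mul_mem _ (ih _)
  have hleft : ∀ n, ∀ y ∈ dualComponent 𝒜 n, g n (S.dualAction y e₀ n) = y := by
    intro n
    induction n with
    | zero =>
      intro y hy
      obtain ⟨c, rfl⟩ := dualComponent_zero_induction hy
      rw [AlgHom.commutes, Module.algebraMap_end_apply]
      change g 0 (c • t₀) = _
      rw [map_smul, hg0, Algebra.algebraMap_eq_smul_one]
    | succ n ih =>
      intro y hy
      refine dualComponent_succ_induction
        (p := fun y => g (n + 1) (S.dualAction y e₀ (n + 1)) = y) (fun f y hy => ?_)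
        (fun y z hy hz => ?_) hy
      · rw [map_mul, dualAction_dualGen, Module.End.mul_apply, act_succ, hg, genSum_apply]
        simp only [map_smul, ih y hy]
        have hf : f = ∑ i, f (v i) • v.coord i := by
          refine v.ext fun j => ?_
          simp
        conv_rhs => rw [hf, map_sum, Finset.sum_mul]
        exact Finset.sum_congr rfl fun i _ => by rw [map_smul, mul_smul_comm, smul_mul_assoc]
      · rw [map_add, LinearMap.add_apply, Pi.add_apply, map_add, hy, hz]
  have hright : ∀ n t, S.dualAction (g n t) e₀ n = t := by
    intro n
    induction n with
    | zero =>
      intro t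
      obtain ⟨c, rfl⟩ := hspan t
      rw [map_smul, hg0, map_smul, map_one]
      rfl
    | succ n ih =>
      intro t
      obtain ⟨t, rfl⟩ := S.codual_surjective n t
      rw [hg, genSum_apply, map_sum, LinearMap.sum_apply, Finset.sum_apply]
      refine LinearMap.ext fun y => ?_
      rw [LinearMap.sum_apply, codual_apply]
      refine Finset.sum_congr rfl fun i _ => ?_
      rw [map_mul, dualAction_dualGen, Module.End.mul_apply, act_succ, codual_apply]
      simp only [ih, Module.Basis.coord_apply, Module.Basis.repr_self, LinearMap.smul_apply]
      rw [Finset.sum_eq_single i (fun j _ hj => by rw [Finsupp.single_eq_of_ne hj.symm, zero_smul])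
        (by simp), Finsupp.single_eq_same, one_smul]
  have hrange : LinearMap.range (g n) = dualComponent 𝒜 n := by
    refine le_antisymm ?_ fun y hy => ⟨_, hleft n y hy⟩
    rintro _ ⟨t, rfl⟩
    exact hmem n t
  rw [← hrange, LinearMap.finrank_range_of_inj fun s t h => by rw [← hright n s, h, hright],
    Subspace.dual_finrank_eq]

end ContractionSystem

end QuadraticDual

/-! ### Syzygies of the residue field as a contraction system. -/

section Contraction

variable {k : Type u} {A : Type v} [Field k] [Ring A] [Algebra k A]
  {𝒜 : ℕ → Submodule k A} [GradedAlgebra 𝒜] {I : Type} [Fintype I]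

/-- The contraction `A ⊗ U → U` by the `i`-th coordinate on `A₁`. -/
noncomputable def contraction (v : Module.Basis I k (𝒜 1)) (U : Type w) [AddCommGroup U]
    [Module k U] (i : I) : A ⊗[k] U →ₗ[k] U :=
  TensorProduct.lid k U ∘ₗ LinearMap.rTensor U
    (v.coord i ∘ₗ (GradedAlgebra.proj 𝒜 1).codRestrict (𝒜 1) (proj_mem 𝒜 1))

theorem sum_tmul_contraction (v : Module.Basis I k (𝒜 1)) {U : Type w} [AddCommGroup U]
    [Module k U] (y : A ⊗[k] U) :
    ∑ i, (v i : A) ⊗ₜ[k] contraction v U i y = degProj 𝒜 U 1 y := by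
  induction y using TensorProduct.induction_on with
  | zero => simp
  | tmul a y =>
    have h := congrArg Subtype.val (v.sum_repr ⟨GradedAlgebra.proj 𝒜 1 a, proj_mem 𝒜 1 a⟩)
    rw [AddSubmonoidClass.coe_finsetSum] at h
    refine Eq.trans ?_ ((TensorProduct.sum_tmul _ _ _).symm.trans
      ((congrArg (· ⊗ₜ[k] y) h).trans (degProj_tmul _ _ _ _).symm))
    refine Finset.sum_congr rfl fun i _ => ?_
    rw [Submodule.coe_smul, TensorProduct.smul_tmul]
    rfl
  | add y z hy hz => simp only [map_add, TensorProduct.tmul_add, Finset.sum_add_distrib, hy, hz]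

theorem contraction_sum (v : Module.Basis I k (𝒜 1)) {U : Type w} [AddCommGroup U]
    [Module k U] (y : I → U) (i : I) :
    contraction v U i (∑ j, (v j : A) ⊗ₜ[k] y j) = y i := by
  classical
  have h : ∀ j, contraction v U i ((v j : A) ⊗ₜ[k] y j) = if j = i then y i else 0 := by
    intro j
    have h1 : (GradedAlgebra.proj 𝒜 1).codRestrict (𝒜 1) (proj_mem 𝒜 1) (v j : A) = v j :=
      Subtype.ext (proj_of_mem (v j).2)
    simp only [contraction, LinearMap.comp_apply, LinearMap.rTensor_tmul, h1,
      LinearEquiv.coe_coe, TensorProduct.lid_tmul, Module.Basis.coord_apply,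
      Module.Basis.repr_self]
    split_ifs with hj
    · subst hj; rw [Finsupp.single_eq_same, one_smul]
    · rw [Finsupp.single_eq_of_ne (Ne.symm hj), zero_smul]
  rw [map_sum]
  simp [h]

theorem degProj_sum (v : Module.Basis I k (𝒜 1)) {U : Type w} [AddCommGroup U]
    [Module k U] (y : I → U) :
    degProj 𝒜 U 1 (∑ j, (v j : A) ⊗ₜ[k] y j) = ∑ j, (v j : A) ⊗ₜ[k] y j := by
  rw [map_sum]
  exact Finset.sum_congr rfl fun j _ => by rw [degProj_tmul, proj_of_mem (v j).2]

open Presentation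

theorem sum_tmul_contraction_incl (v : Module.Basis I k (𝒜 1)) (P : Presentation k A)
    (z : (P.syzygy 𝒜).U) :
    ∑ i, (v i : A) ⊗ₜ[k] contraction v P.U i (P.incl 𝒜 z) = P.incl 𝒜 z := by
  rw [sum_tmul_contraction, degProj_incl]

theorem eq_zero_of_contraction (v : Module.Basis I k (𝒜 1)) (P : Presentation k A)
    {z : (P.syzygy 𝒜).U} (h : ∀ i, contraction v P.U i (P.incl 𝒜 z) = 0) : z = 0 := by
  refine (map_eq_zero_iff _ (incl_injective 𝒜 P)).1 ?_
  rw [← sum_tmul_contraction_incl v]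
  exact Finset.sum_eq_zero fun i _ => by rw [h, TensorProduct.tmul_zero]

/-- Expanding each linear relation `y i` along the basis of `A₁` turns evaluation in `A ⊗ P.U` into
a double sum; together with `exists_syzygy_iff` this is the axiom `exists_succ` of a contraction
system. -/
theorem sum_mem_syzygy_rel_iff (v : Module.Basis I k (𝒜 1)) (P : Presentation k A)
    (y : I → (P.syzygy 𝒜).U) :
    ∑ i, (v i : A) ⊗ₜ[k] y i ∈ (P.syzygy 𝒜).rel ↔ ∑ i, ∑ l, ((v i : A) * (v l : A)) ⊗ₜ[k]
      contraction v P.U l (P.incl 𝒜 (y i)) = 0 := by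
  rw [mem_syzygy_rel, map_sum]
  refine Eq.congr_left (Finset.sum_congr rfl fun i _ => ?_)
  rw [evalMap_tmul, ← sum_tmul_contraction_incl v P (y i), Finset.smul_sum]
  rw [sum_tmul_contraction_incl v P (y i)]
  rfl

theorem exists_syzygy_iff (v : Module.Basis I k (𝒜 1)) (P : Presentation k A) (y : I → P.U) :
    (∃ z : (P.syzygy 𝒜).U, ∀ i, contraction v P.U i (P.incl 𝒜 z) = y i) ↔
      ∑ i, (v i : A) ⊗ₜ[k] y i ∈ P.rel := by
  constructor
  · rintro ⟨z, hz⟩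
    simp only [← hz, sum_tmul_contraction_incl]
    exact P.incl_mem_rel 𝒜 z
  · intro h
    obtain ⟨z, hz⟩ := P.exists_incl_eq 𝒜 h (degProj_sum v y)
    exact ⟨z, fun i => by rw [hz, contraction_sum]⟩

/-- The syzygies of the residue field form the Koszul dual coalgebra. -/
noncomputable def residueContractionSystem (hA : IsStandardGraded 𝒜)
    (v : Module.Basis I k (𝒜 1)) : ContractionSystem 𝒜 v where
  U n := ((residuePresentation 𝒜 0).iterSyzygy 𝒜 n).U
  finite n := by
    have := hA.finite 0
    rw [iterSyzygy_eq]
    exact finite_iterate hA _ n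
  δ n i := contraction v _ i ∘ₗ ((residuePresentation 𝒜 0).iterSyzygy 𝒜 n).incl 𝒜
  eq_zero n y hy := eq_zero_of_contraction v _ hy
  exists_zero y := by
    refine (exists_syzygy_iff v (residuePresentation 𝒜 0) y).2 ?_
    refine mem_residuePresentation_rel.2 ?_
    refine (congrArg _ (degProj_sum v y).symm).trans ?_
    exact degProj_degProj_ne one_ne_zero _
  exists_succ n y :=
    (sum_mem_syzygy_rel_iff v ((residuePresentation 𝒜 0).iterSyzygy 𝒜 n) y).symm.trans
      (exists_syzygy_iff v ((residuePresentation 𝒜 0).iterSyzygy 𝒜 (n + 1)) y).symm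
  finrank_zero := finrank_degree_zero hA

theorem finrank_dual (k : Type u) (N : Type w) [Field k] [AddCommMonoid N] [Module k N] :
    Module.finrank k (Module.Dual k N) = Module.finrank k N := by
  let := Module.addCommMonoidToAddCommGroup k (M := N)
  exact Subspace.dual_finrank_eq

/-- Koszulness plays no role here: iterated linear relations of `k` always give the graded dual of
`A^!`. Koszulness enters only in saying that they exhaust the resolution. -/
theorem dimDual_eq_residueBetti (hA : IsStandardGraded 𝒜) (n : ℕ) :
    dimDual 𝒜 n = residueBetti 𝒜 n := by
  have := hA.finite 1
  have h := (residueContractionSystem hA (Module.finBasis k (𝒜 1))).finrank_dualComponent n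
  have h' : dimDual 𝒜 n = Module.finrank k (dualComponent 𝒜 n) := finrank_dual k _
  rw [h', h, residueBetti, ← iterSyzygy_eq]
  rfl

end Contraction

/-! ### Resolutions and `Tor` of `𝔪 ^ a` and of `A ⧸ 𝔪 ^ a`. -/

section Power

variable {k : Type u} {A : Type v} [Field k] [Ring A] [Algebra k A]
  {𝒜 : ℕ → Submodule k A} [GradedAlgebra 𝒜]

open Presentation

theorem proj_mem_maxIdeal_pow (hA : IsStandardGraded 𝒜) {a : ℕ} {y : A}
    (hy : y ∈ maxIdeal 𝒜 ^ a) (i : ℕ) : GradedAlgebra.proj 𝒜 i y ∈ maxIdeal 𝒜 ^ a := by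
  rcases Nat.lt_or_ge i a with hi | hi
  · rw [proj_eq_zero_of_mem_pow hy hi]; exact zero_mem _
  · exact degree_le_maxIdeal_pow hA hi (proj_mem 𝒜 i y)

theorem range_mulMap (hA : IsStandardGraded 𝒜) (a : ℕ) :
    LinearMap.range (mulMap 𝒜 a) = maxIdeal 𝒜 ^ a := by
  refine le_antisymm ?_ fun y hy => ?_
  · rintro _ ⟨y, rfl⟩
    induction y using TensorProduct.induction_on with
    | zero => simp
    | tmul b y =>
      rw [mulMap_tmul]
      exact Ideal.mul_mem_left _ b (degree_le_maxIdeal_pow hA le_rfl y.2)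
    | add y z hy hz => rw [map_add]; exact add_mem hy hz
  · classical
    rw [← DirectSum.sum_support_decompose 𝒜 y]
    refine sum_mem fun i _ => ?_
    rcases Nat.lt_or_ge i a with hi | hi
    · rw [← GradedAlgebra.proj_apply, proj_eq_zero_of_mem_pow hy hi]; exact zero_mem _
    · obtain ⟨i, rfl⟩ := Nat.exists_eq_add_of_le' hi
      obtain ⟨z, hz, -⟩ := exists_mulMap_eq hA (DirectSum.decompose 𝒜 y (i + a))
      exact ⟨z, hz⟩

instance finite_powerPresentation (a : ℕ) [h : Module.Finite k (𝒜 a)] :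
    Module.Finite k (powerPresentation 𝒜 a).U := h

/-- The augmentation `A ⊗ A_a → 𝔪 ^ a`. -/
noncomputable def powerAugmentation (hA : IsStandardGraded 𝒜) (a : ℕ) :
    A ⊗[k] 𝒜 a →ₗ[A] (maxIdeal 𝒜 ^ a : Ideal A) :=
  (mulMap 𝒜 a).codRestrict _ fun y => range_mulMap hA a ▸ ⟨y, rfl⟩

theorem powerAugmentation_surjective (hA : IsStandardGraded 𝒜) (a : ℕ) :
    Function.Surjective (powerAugmentation hA a) := by
  rintro ⟨y, hy⟩
  rw [← range_mulMap hA] at hy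
  obtain ⟨z, rfl⟩ := hy
  exact ⟨z, rfl⟩

theorem powerAugmentation_eq_zero (hA : IsStandardGraded 𝒜) (a : ℕ) (y : A ⊗[k] 𝒜 a) :
    powerAugmentation hA a y = 0 ↔ mulMap 𝒜 a y = 0 := by
  rw [← Submodule.coe_eq_zero]; rfl

theorem finite_iterSyzygy (hA : IsStandardGraded 𝒜) (P : Presentation k A)
    [Module.Finite k P.U] (n : ℕ) : Module.Finite k (P.iterSyzygy 𝒜 n).U := by
  rw [iterSyzygy_eq]
  exact finite_iterate hA _ n

/-- The linear resolution of `𝔪 ^ a`. -/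
noncomputable def powerResolution (hA : IsStandardGraded 𝒜)
    (h : (residuePresentation 𝒜 0).HasLinearResolution 𝒜) (a : ℕ) :
    GradedFreeResolution.{u, v, v, w} 𝒜 (idealGrading 𝒜 (maxIdeal 𝒜 ^ a)) :=
  haveI := hA.finite a
  haveI := finite_iterSyzygy hA (powerPresentation 𝒜 a)
  (powerPresentation 𝒜 a).resolution (hasLinearResolution_power hA h a) a
    (powerAugmentation hA a) (powerAugmentation_surjective hA a)
    (powerAugmentation_eq_zero hA a)
    (fun i j c hc m hm => component_mul_mem hc hm)
    (fun y => by
      change (1 : A) * (show 𝒜 a from y).1 ∈ 𝒜 a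
      rw [one_mul]
      exact (show 𝒜 a from y).2)

noncomputable instance fintype_powerResolution (hA : IsStandardGraded 𝒜)
    (h : (residuePresentation 𝒜 0).HasLinearResolution 𝒜) (a n : ℕ) :
    Fintype ((powerResolution.{u, v, w} hA h a).ι n) :=
  inferInstanceAs
    (Fintype (ULift.{w} (Fin (Module.finrank k ((powerPresentation 𝒜 a).iterSyzygy 𝒜 n).U))))

theorem card_powerResolution (hA : IsStandardGraded 𝒜)
    (h : (residuePresentation 𝒜 0).HasLinearResolution 𝒜) (a n : ℕ) :
    Fintype.card ((powerResolution.{u, v, w} hA h a).ι n) = powerBetti 𝒜 a n := by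
  refine (Fintype.card_ulift _).trans ((Fintype.card_fin _).trans ?_)
  rw [powerBetti, iterSyzygy_eq]

theorem exists_linear_resolution (hA : IsStandardGraded 𝒜)
    (h : (residuePresentation 𝒜 0).HasLinearResolution 𝒜) (a : ℕ) :
    ∃ (F : GradedFreeResolution.{u, v, v, w} 𝒜 (idealGrading 𝒜 (maxIdeal 𝒜 ^ a)))
      (_ : ∀ n, Fintype (F.ι n)),
      F.IsLinear a ∧ ∀ n, Fintype.card (F.ι n) = powerBetti 𝒜 a n :=
  ⟨powerResolution hA h a, fintype_powerResolution hA h a, fun _ _ => rfl,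
    card_powerResolution hA h a⟩

open GradedFreeResolution

theorem tor_power (hA : IsStandardGraded 𝒜)
    (h : (residuePresentation 𝒜 0).HasLinearResolution 𝒜) (a : ℕ)
    (F : GradedFreeResolution.{u, v, v, w} 𝒜 (idealGrading 𝒜 (maxIdeal 𝒜 ^ a))) (n : ℕ) (j : ℤ) :
    Module.Finite k (F.tor n j) ∧
      F.betti n j = if j = n + a then powerBetti 𝒜 a n else 0 := by
  obtain ⟨G, hfin, hG, hcard⟩ := exists_linear_resolution.{u, v, w} hA h a
  obtain ⟨e⟩ := nonempty_tor_equiv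
    (hasProjections_idealGrading fun y hy => proj_mem_maxIdeal_pow hA hy) G F n j
  have := hG.isMinimal.finite_tor hA n j
  refine ⟨Module.Finite.equiv e, ?_⟩
  rw [← hcard, ← hG.isMinimal.betti_eq hA (hG n) j]
  exact e.symm.finrank_eq

/-- A generator of a minimal resolution contributes to `Tor` in its own degree, and `Tor_n` vanishes
outside degree `n + a`. -/
theorem isLinear_of_isMinimal (hA : IsStandardGraded 𝒜)
    (h : (residuePresentation 𝒜 0).HasLinearResolution 𝒜) (a : ℕ)
    (F : GradedFreeResolution.{u, v, v, w} 𝒜 (idealGrading 𝒜 (maxIdeal 𝒜 ^ a)))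
    (hF : F.IsMinimal) : F.IsLinear a := by
  intro n b
  have := (tor_power hA h a F n (F.deg n b)).1
  by_contra hne
  exact hF.betti_deg_ne_zero hA b (by rw [(tor_power hA h a F n _).2, if_neg hne])

/-- Here `1 ≤ a` matters: the new generator has degree `0`, and the generators of `𝔪^a` must have a
different degree. -/
theorem isMinimal_splice {a : ℕ} (ha : 1 ≤ a)
    {G : GradedFreeResolution.{u, v, v, w} 𝒜 (idealGrading 𝒜 (maxIdeal 𝒜 ^ a))}
    (hG : G.IsLinear a) : G.splice.IsMinimal := by
  refine G.splice.isMinimal_of_deg_ne fun n b b' => ?_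
  cases n with
  | zero =>
    have h1 : G.splice.deg 1 b = (0 : ℕ) + a := hG 0 b
    have h2 : G.splice.deg 0 b' = 0 := rfl
    rw [h1, h2]
    push_cast
    omega
  | succ n =>
    have h1 : G.splice.deg (n + 1 + 1) b = (n + 1 : ℕ) + a := hG (n + 1) b
    have h2 : G.splice.deg (n + 1) b' = n + a := hG n b'
    rw [h1, h2]
    push_cast
    omega

theorem exists_minimal_quotient (hA : IsStandardGraded 𝒜)
    (h : (residuePresentation 𝒜 0).HasLinearResolution 𝒜) {a : ℕ} (ha : 1 ≤ a) :
    ∃ F : GradedFreeResolution.{u, v, v, w} 𝒜 (quotientGrading 𝒜 (maxIdeal 𝒜 ^ a)),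
      F.IsMinimal := by
  obtain ⟨G, -, hG, -⟩ := exists_linear_resolution.{u, v, w} hA h a
  exact ⟨G.splice, isMinimal_splice ha hG⟩

theorem tor_quotient (hA : IsStandardGraded 𝒜)
    (h : (residuePresentation 𝒜 0).HasLinearResolution 𝒜) {a : ℕ} (ha : 1 ≤ a)
    (F : GradedFreeResolution.{u, v, v, w} 𝒜 (quotientGrading 𝒜 (maxIdeal 𝒜 ^ a))) :
    (∀ n j, Module.Finite k (F.tor n j)) ∧ (∀ j, F.betti 0 j = if j = 0 then 1 else 0) ∧
      ∀ n j, F.betti (n + 1) j = if j = n + a then powerBetti 𝒜 a n else 0 := by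
  obtain ⟨G, hfin, hG, hcard⟩ := exists_linear_resolution.{u, v, w} hA h a
  have hmin := isMinimal_splice ha hG
  have e := nonempty_tor_equiv
    (hasProjections_quotientGrading fun y hy => proj_mem_maxIdeal_pow hA hy) G.splice F
  have hbetti : ∀ n j, F.betti n j = G.splice.betti n j := fun n j =>
    (e n j).some.symm.finrank_eq
  have : ∀ n, Fintype (G.splice.ι n) := fun n => match n with
    | 0 => inferInstanceAs (Fintype PUnit)
    | n + 1 => hfin n
  refine ⟨fun n j => ?_, fun j => ?_, fun n j => ?_⟩
  · have := hmin.finite_tor hA n j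
    exact Module.Finite.equiv (e n j).some
  · rw [hbetti, hmin.betti_eq hA (c := 0) fun b => rfl]
    have : Fintype.card (G.splice.ι 0) = 1 := Fintype.card_eq_one_iff.2 ⟨PUnit.unit, fun _ => rfl⟩
    rw [this]
  · have hdeg : ∀ b, G.splice.deg (n + 1) b = n + a := hG n
    have hc : Fintype.card (G.splice.ι (n + 1)) = Fintype.card (G.ι n) :=
      Fintype.card_congr (Equiv.refl _)
    rw [hbetti, hmin.betti_eq hA hdeg, ← hcard, hc]

theorem residueBetti_zero (hA : IsStandardGraded 𝒜) : residueBetti 𝒜 0 = 1 :=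
  finrank_degree_zero hA

end Power

/-! ### The Poincaré series as an identity of coefficients. -/

section Poincare

variable {k : Type u} {A : Type v} [Field k] [Ring A] [Algebra k A]
  {𝒜 : ℕ → Submodule k A}

theorem coeff_hilbertTrunc (a n : ℕ) : PowerSeries.coeff n (hilbertTrunc 𝒜 a) =
    if n < a then (dimA 𝒜 n : ℤ) else 0 := by
  simp [hilbertTrunc, PowerSeries.coeff_monomial]

variable [GradedAlgebra 𝒜]

/-- This is `powerBetti_eq` for `n = m - a`, reindexed by `q = a - i` so as to look like a
coefficient of a product of series. -/
theorem sum_range_residueBetti (hA : IsStandardGraded 𝒜)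
    (h : (residuePresentation 𝒜 0).HasLinearResolution 𝒜) {a m : ℕ} (ha : 1 ≤ a) (hm : a ≤ m) :
    ∑ q ∈ Finset.range a, (residueBetti 𝒜 (m - q) : ℤ) * ((-1) ^ q * dimA 𝒜 q) =
      -((-1) ^ a * powerBetti 𝒜 a (m - a)) := by
  rw [powerBetti_eq hA h a (m - a) (Or.inl (by omega)), Finset.mul_sum, ← Finset.sum_neg_distrib]
  refine Finset.sum_bij' (fun q _ => a - q) (fun i _ => a - i) ?_ ?_ ?_ ?_ ?_
  · intro q hq
    rw [Finset.mem_range] at hq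
    rw [Finset.mem_Icc]
    omega
  · intro i hi
    rw [Finset.mem_Icc] at hi
    rw [Finset.mem_range]
    omega
  · intro q hq
    rw [Finset.mem_range] at hq
    omega
  · intro i hi
    rw [Finset.mem_Icc] at hi
    omega
  · intro q hq
    rw [Finset.mem_range] at hq
    rw [show m - a + (a - q) = m - q by omega, show a - (a - q) = q by omega]
    have hs : (-1 : ℤ) ^ q = (-1) ^ a * (-1) ^ (a - q) := by
      rw [← pow_add, show a + (a - q) = 2 * (a - q) + q by omega, pow_add, pow_mul]
      simp
    rw [hs, pow_succ]
    ring

/-- The coefficient of `(yz)^m` in the product of `H_{(A^!)^*}(yz)` and `H_{A/𝔪^a}(-yz)`. The range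
`0 < m < a` contributes nothing, so after removing the constant term the product is divisible by
`z^a`. -/
theorem sum_antidiagonal_residueBetti (hA : IsStandardGraded 𝒜)
    (h : (residuePresentation 𝒜 0).HasLinearResolution 𝒜) {a : ℕ} (ha : 1 ≤ a) (m : ℕ) :
    ∑ p ∈ Finset.HasAntidiagonal.antidiagonal m, (residueBetti 𝒜 p.1 : ℤ) *
        ((-1 : ℤ) ^ p.2 * if p.2 < a then (dimA 𝒜 p.2 : ℤ) else 0) =
      if m = 0 then (1 : ℤ) else if m < a then 0 else -((-1 : ℤ) ^ a * powerBetti 𝒜 a (m - a)) := by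
  rw [← Finset.Nat.sum_antidiagonal_swap, Finset.Nat.sum_antidiagonal_eq_sum_range_succ_mk]
  simp only [Prod.fst_swap, Prod.snd_swap]
  have hd : dimA 𝒜 0 = 1 := finrank_degree_zero hA
  split_ifs with h0 hm
  · subst h0
    have : 0 < a := ha
    simp [residueBetti_zero hA, hd, this]
  · have h1 : ∀ q ∈ Finset.range (m + 1), (residueBetti 𝒜 (m - q) : ℤ) *
        ((-1) ^ q * if q < a then (dimA 𝒜 q : ℤ) else 0) =
        (residueBetti 𝒜 (m - q) : ℤ) * ((-1) ^ q * dimA 𝒜 q) := fun q hq => by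
      rw [if_pos (by rw [Finset.mem_range] at hq; omega)]
    -- For `0 < m < a` the truncation is invisible. Applying the previous identity to the exponent
    -- `m` in place of `a`, the terms `q < m` sum to `-(-1)^m dim A_m`, since `β_0(𝔪^m) = dim A_m`;
    -- the term `q = m` cancels this.
    rw [Finset.sum_congr rfl h1, Finset.sum_range_succ,
      sum_range_residueBetti hA h (Nat.pos_of_ne_zero h0) le_rfl, Nat.sub_self,
      residueBetti_zero hA, powerBetti_zero]
    push_cast
    ring
  · rw [← sum_range_residueBetti hA h ha (not_lt.1 hm)]
    symm
    refine Finset.sum_subset_zero_on_sdiff (fun q hq => ?_) (fun q hq => ?_) fun q hq => ?_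
    · rw [Finset.mem_range] at *; omega
    · rw [Finset.mem_sdiff, Finset.mem_range, Finset.mem_range] at hq
      rw [if_neg hq.2]; simp
    · rw [Finset.mem_range] at hq
      rw [if_pos hq]

/-- The substitution `H(t) ↦ H(c y z)` before passing to Laurent series. -/
noncomputable def substYZ (c : ℤ) (H : PowerSeries ℤ) : PowerSeries (PowerSeries ℤ) :=
  PowerSeries.mk fun n => PowerSeries.monomial n (c ^ n * PowerSeries.coeff n H)

theorem substYZ_mul (hA : IsStandardGraded 𝒜)
    (h : (residuePresentation 𝒜 0).HasLinearResolution 𝒜) {a : ℕ} (ha : 1 ≤ a)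
    (F : GradedFreeResolution.{u, v, v, w} 𝒜 (idealGrading 𝒜 (maxIdeal 𝒜 ^ a))) :
    substYZ 1 (hilbertDual 𝒜) * substYZ (-1) (hilbertTrunc 𝒜 a) - 1 =
      -(PowerSeries.C ((-1) ^ a) * (PowerSeries.X ^ a * F.poincareSeries)) := by
  have hP : ∀ n, PowerSeries.coeff n F.poincareSeries =
      PowerSeries.monomial (n + a) (powerBetti 𝒜 a n : ℤ) := by
    intro n
    rw [GradedFreeResolution.poincareSeries, PowerSeries.coeff_mk]
    ext j
    rw [PowerSeries.coeff_mk, (tor_power hA h a F n j).2, PowerSeries.coeff_monomial]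
    have : ((j : ℤ) = n + a) ↔ j = n + a := by omega
    simp only [this]
    split_ifs <;> simp
  have hprod : ∀ m, PowerSeries.coeff m (substYZ 1 (hilbertDual 𝒜) *
      substYZ (-1) (hilbertTrunc 𝒜 a)) = PowerSeries.monomial m
      (if m = 0 then 1 else if m < a then 0 else -((-1) ^ a * powerBetti 𝒜 a (m - a) : ℤ)) := by
    intro m
    rw [← sum_antidiagonal_residueBetti hA h ha m, PowerSeries.coeff_mul, map_sum]
    refine Finset.sum_congr rfl fun p hp => ?_
    rw [substYZ, substYZ, PowerSeries.coeff_mk, PowerSeries.coeff_mk,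
      PowerSeries.monomial_mul_monomial, Finset.HasAntidiagonal.mem_antidiagonal.1 hp,
      coeff_hilbertTrunc, hilbertDual, PowerSeries.coeff_mk, dimDual_eq_residueBetti hA,
      one_pow, one_mul]
  have hsign : (-1 : PowerSeries ℤ) ^ a = PowerSeries.C ((-1 : ℤ) ^ a) := by simp
  refine PowerSeries.ext fun m => ?_
  rw [map_sub, hprod, map_neg, hsign, PowerSeries.coeff_C_mul, PowerSeries.coeff_X_pow_mul',
    PowerSeries.coeff_one]
  by_cases h0 : m = 0
  · subst h0
    rw [if_pos rfl, if_pos rfl, if_neg (by omega), mul_zero, neg_zero]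
    exact sub_eq_zero.2 (PowerSeries.ext fun j => by
      rw [PowerSeries.coeff_monomial, PowerSeries.coeff_one])
  · rw [if_neg h0, if_neg h0, sub_zero]
    by_cases hm : m < a
    · rw [if_pos hm, if_neg (not_le.2 hm), map_zero, mul_zero, neg_zero]
    · rw [if_neg hm, if_pos (not_lt.1 hm), hP, Nat.sub_add_cancel (not_lt.1 hm), map_neg]
      congr 1
      ext j
      rw [PowerSeries.coeff_C_mul, PowerSeries.coeff_monomial, PowerSeries.coeff_monomial]
      split_ifs <;> simp

theorem eq_neg_mul_of_eq_neg_mul {R : Type w} [CommRing R] {s e x p q : R}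
    (hq : q = -(e * (x * p))) (h : s * (e * x) = 1) : p = -s * q := by
  rw [hq]
  linear_combination (-p) * h

theorem ofPowerSeries_poincareSeries (hA : IsStandardGraded 𝒜)
    (h : (residuePresentation 𝒜 0).HasLinearResolution 𝒜) {a : ℕ} (ha : 1 ≤ a)
    (F : GradedFreeResolution.{u, v, v, w} 𝒜 (idealGrading 𝒜 (maxIdeal 𝒜 ^ a))) :
    HahnSeries.ofPowerSeries ℤ _ F.poincareSeries =
      -(HahnSeries.single (-(a : ℤ)) ((-1 : PowerSeries ℤ) ^ a)) *
        (evalYZ 1 (hilbertDual 𝒜) * evalYZ (-1) (hilbertTrunc 𝒜 a) - 1) := by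
  have h1 := congrArg (HahnSeries.ofPowerSeries ℤ (PowerSeries ℤ)) (substYZ_mul hA h ha F)
  rw [map_sub, map_mul, map_one, map_neg, map_mul, map_mul, HahnSeries.ofPowerSeries_X_pow,
    HahnSeries.ofPowerSeries_C, HahnSeries.C_apply] at h1
  have h2 : evalYZ 1 (hilbertDual 𝒜) * evalYZ (-1) (hilbertTrunc 𝒜 a) - 1 =
      -(HahnSeries.single 0 ((-1 : PowerSeries ℤ) ^ a) * (HahnSeries.single (a : ℤ) 1 *
        HahnSeries.ofPowerSeries ℤ _ F.poincareSeries)) := h1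
  -- The factor `(-z)^(-a)` inverts `(-1)^a z^a`, which is a unit only after passing to Laurent
  -- series.
  have h3 : HahnSeries.single (-(a : ℤ)) ((-1 : PowerSeries ℤ) ^ a) *
      (HahnSeries.single 0 ((-1 : PowerSeries ℤ) ^ a) * HahnSeries.single (a : ℤ) 1) = 1 := by
    rw [HahnSeries.single_mul_single, HahnSeries.single_mul_single, mul_one, ← mul_pow,
      neg_one_mul, neg_neg, one_pow, zero_add, neg_add_cancel]
    rfl
  exact eq_neg_mul_of_eq_neg_mul h2 h3

end Poincare

end KoszulPowers

/-! ### Assembly of the theorem. -/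

open KoszulPowers in
theorem corollary5p4 {k : Type u} {A : Type v} [Field k] [Ring A] [Algebra k A]
    (𝒜 : ℕ → Submodule k A) [GradedAlgebra 𝒜] (hA : IsStandardGraded 𝒜)
    (hK : IsKoszul.{u, v, w'} 𝒜) (a : ℕ) (ha : 1 ≤ a) :
    -- `𝔪 ^ a` has a minimal graded free resolution, and every such resolution is `a`-linear
    (∃ F : GradedFreeResolution.{u, v, v, w} 𝒜 (idealGrading 𝒜 (maxIdeal 𝒜 ^ a)),
      F.IsMinimal) ∧
    (∀ F : GradedFreeResolution.{u, v, v, w} 𝒜 (idealGrading 𝒜 (maxIdeal 𝒜 ^ a)),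
      F.IsMinimal → F.IsLinear a) ∧
    -- the graded Betti numbers of `𝔪 ^ a`, from an arbitrary graded free resolution
    (∀ F : GradedFreeResolution.{u, v, v, w} 𝒜 (idealGrading 𝒜 (maxIdeal 𝒜 ^ a)),
      (∀ n j, Module.Finite k (F.tor n j)) ∧
      (∀ n : ℕ, (F.betti n (n + a) : ℤ) =
        ∑ i ∈ Finset.Icc 1 a, (-1 : ℤ) ^ (i + 1) * dimDual 𝒜 (n + i) * dimA 𝒜 (a - i)) ∧
      (∀ (n : ℕ) (j : ℤ), j ≠ n + a → F.betti n j = 0) ∧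
      -- the graded Poincaré series; the first factor on the right is `-(-z)^(-a)`
      HahnSeries.ofPowerSeries ℤ _ F.poincareSeries =
        -(HahnSeries.single (-(a : ℤ)) ((-1 : PowerSeries ℤ) ^ a)) *
          (evalYZ 1 (hilbertDual 𝒜) * evalYZ (-1) (hilbertTrunc 𝒜 a) - 1)) ∧
    -- the graded Betti numbers of `A ⧸ 𝔪 ^ a`
    (∃ F : GradedFreeResolution.{u, v, v, w} 𝒜 (quotientGrading 𝒜 (maxIdeal 𝒜 ^ a)),
      F.IsMinimal) ∧
    (∀ F : GradedFreeResolution.{u, v, v, w} 𝒜 (quotientGrading 𝒜 (maxIdeal 𝒜 ^ a)),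
      (∀ n j, Module.Finite k (F.tor n j)) ∧
      (∀ (n : ℕ) (j : ℤ), (F.betti n j : ℤ) =
        if 0 < n ∧ j = n + a - 1 then
          ∑ i ∈ Finset.Icc 1 a, (-1 : ℤ) ^ (i + 1) * dimDual 𝒜 (n + i - 1) * dimA 𝒜 (a - i)
        else if n = 0 ∧ j = 0 then 1 else 0)) := by
  have h := hK.hasLinearResolution hA
  refine ⟨?_, isLinear_of_isMinimal hA h a, fun F => ⟨fun n j => (tor_power hA h a F n j).1,
    fun n => ?_, fun n j hj => ?_, ofPowerSeries_poincareSeries hA h ha F⟩,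
    exists_minimal_quotient hA h ha, fun F => ?_⟩
  · obtain ⟨F, -, hF, -⟩ := exists_linear_resolution hA h a
    exact ⟨F, hF.isMinimal⟩
  · rw [(tor_power hA h a F n _).2, if_pos rfl, powerBetti_eq hA h a n (Or.inl (by omega))]
    simp only [dimDual_eq_residueBetti hA]
  · rw [(tor_power hA h a F n j).2, if_neg hj]
  · obtain ⟨hfin, hzero, hsucc⟩ := tor_quotient hA h ha F
    refine ⟨hfin, fun n j => ?_⟩
    cases n with
    | zero =>
      rw [hzero]
      split_ifs <;> simp_all
    | succ n =>
      -- Splicing shifts homological degree by one: `Tor_(n+1)` of `A/𝔪^a` is `Tor_n` of `𝔪^a`, in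
      -- the same internal degree.
      have hj : (j = ((n + 1 : ℕ) : ℤ) + a - 1) ↔ j = n + a := by omega
      simp only [hsucc, hj, Nat.succ_pos, true_and, Nat.succ_ne_zero, false_and, if_false]
      split_ifs
      · rw [powerBetti_eq hA h a n (Or.inl (by omega))]
        refine Finset.sum_congr rfl fun i _ => ?_
        rw [dimDual_eq_residueBetti hA, show n + 1 + i - 1 = n + i by omega]
      · rfl
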